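/- **Setting.** Let $0<\eta<\tfrac13$ and $\varphi(r)=(1+|r|^2)^{1+\eta}$. On $\mathbb R_t\times\mathbb R_x$ write $L=\partial_t+\partial_x$, $\underline L=\partial_t-\partial_x$, $\Box=\partial_t^2-\partial_x^2$, $u=\frac{t-x}2$, $\underline u=\frac{t+x}2$, and $Q_0(f,g)=-f_tg_t+f_xg_x$. For a function $\psi(t,x)$ and $t\ge 0$ put $$E[\psi](t)=\int_{\mathbb R}\big(\varphi(u)|\underline L\psi|^2+\varphi(\underline u)|L\psi|^2\big)(t,x)\,dx,$$ $$F[\psi](t)=\sup_{b\in\mathbb R}\int_0^t \big(\varphi(u)|\underline L\psi|^2\big)(\tau,2b-\tau)\,d\tau+\sup_{a\in\mathbb R}\int_0^t\big(\varphi(\underline u)|L\psi|^2\big)(\tau,\tau-2a)\,d\tau,$$ with values in $[0,\infty]$. For a pair $(z,s)$ let $$\mathcal E=E[z]+E[\partial_xz],\quad \mathcal F=F[z]+F[\partial_xz],\quad \overline{\mathcal E}=E[s]+E[\partial_xs],\quad \overline{\mathcal F}=F[s]+F[\partial_xs].$$ A number $C_0>0$ is called an *energy constant* if for every $\psi\in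 C^2(\mathbb R^2)$ and every $t\ge 0$ $$E[\psi](t)+F[\psi](t)\le C_0E[\psi](0)+C_0\int_0^t\!\!\int_{\mathbb R}\big(\varphi(u)|\underline L\psi|+\varphi(\underline u)|L\psi|\big)|\Box\psi|\,dx\,d\tau .$$ **Soliton.** Let $\lambda>0$, $0<\mu<1$, $\theta,\sigma\in C^2_c(\mathbb R)$, $\varepsilon>0$, and $$c=\Big(\frac{2\mu}{\mu^2-1}\Big)^2,\quad v=-\frac{\mu^2+1}{2\mu},\quad \beta=\frac{1+\mu}{1-\mu},\quad \gamma_1=\lambda+\varepsilon\theta(x+t),\quad \gamma_2=\varepsilon\sigma(x-t),\quad \gamma=\gamma_1+\gamma_2,\quad \omega=\beta\gamma_1+\beta^{-1}\gamma_2 .$$ The 1-soliton of the principal chiral field model is $$B=\operatorname{arcosh}\Big(|v|\cosh\gamma-\tfrac1{\sqrt c}\tanh\omega\,\sinh\gamma\Big),\qquad D=\frac\pi4-\frac12\arctan\Big(\cosh\omega\cosh\gamma\,\big[\tanh\omega+v\sqrt c\,\tanh\gamma\big]\Big).$$ A pair $(z,s)$, of class $C^2$ on $[0,T^*]\times\mathbb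 R$ up to the boundary, is a *perturbation of the soliton on $[0,T^*]$* if on $[0,T^*]\times\mathbb R$ $$\Box z=2\sinh(2B)\,Q_0(D,D)-2\sinh(2(B+z))\big(Q_0(D,D)+2Q_0(D,s)+Q_0(s,s)\big),$$ $$\Box s=-\frac{\sinh 2B}{\sinh^2B}Q_0(D,B)+\frac{\sinh(2(B+z))}{\sinh^2(B+z)}\big(Q_0(D,B)+Q_0(D,z)+Q_0(B,s)+Q_0(z,s)\big).$$ **Theorem 4.1.** Let $0<\eta<\frac13$. Energy constants exist. Moreover, let $C_0$ be any energy constant, and let $C_1>0$, $\lambda>0$, $0<\mu<1$ and $\theta,\sigma\in C^2_c(\mathbb R)$. Then there are $\varepsilon_0>0$ and $\delta_0>0$, depending only on $\eta,C_0,C_1,\lambda,\mu,\theta,\sigma$, such that for all $T^*>0$, all $0<\delta\le\delta_0$, all $0<\varepsilon<\varepsilon_0$ with $\varepsilon<\delta$, and every perturbation $(z,s)$ of the soliton on $[0,T^*]$ for which $z(0,\cdot)$ has compact support and $\mathcal E(0)+\overline{\mathcal E}(0)\le C_1\delta^2$, the following holds. If $$\mathcal E(t)+\mathcal F(t)\le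 6C_1C_0\delta^2,\qquad \overline{\mathcal E}(t)+\overline{\mathcal F}(t)\le 6C_1C_0\delta^2\qquad\text{for all }t\in[0,T^*]$$ and $\sup_{t\in[0,T^*]}\|z(t)\|_{L^\infty(\mathbb R)}\le\frac\lambda2$, then these estimates improve to $$\mathcal E(t)+\mathcal F(t)\le \tfrac{11}2C_1C_0\delta^2,\qquad \overline{\mathcal E}(t)+\overline{\mathcal F}(t)\le \tfrac{11}2C_1C_0\delta^2\qquad\text{for all }t\in[0,T^*],$$ and $\sup_{t\in[0,T^*]}\|z(t)\|_{L^\infty(\mathbb R)}<\frac\lambda2$. -/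

import Mathlib

open MeasureTheory
open scoped ENNReal

namespace PCF

noncomputable section

/-! Functions on space-time are written `f : ℝ → ℝ → ℝ`, with value `f t x` at time `t` and
position `x`. -/

/-- Time derivative. -/
def dt (f : ℝ → ℝ → ℝ) : ℝ → ℝ → ℝ := fun t x => deriv (fun τ => f τ x) t

/-- Space derivative. -/
def dx (f : ℝ → ℝ → ℝ) : ℝ → ℝ → ℝ := fun t x => deriv (fun y => f t y) x

/-- The null vector field `L = ∂_t + ∂_x`. -/
def nullL (f : ℝ → ℝ → ℝ) : ℝ → ℝ → ℝ := fun t x => dt f t x + dx f t x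

/-- The null vector field `L̲ = ∂_t - ∂_x`. -/
def nullLbar (f : ℝ → ℝ → ℝ) : ℝ → ℝ → ℝ := fun t x => dt f t x - dx f t x

/-- The wave operator `□ = ∂_t² - ∂_x²`. -/
def box (f : ℝ → ℝ → ℝ) : ℝ → ℝ → ℝ := fun t x => dt (dt f) t x - dx (dx f) t x

/-- The fundamental null form of the Minkowski metric of signature `(-1, 1)`. -/
def Q0 (f g : ℝ → ℝ → ℝ) : ℝ → ℝ → ℝ :=
  fun t x => -(dt f t x * dt g t x) + dx f t x * dx g t x

/-! ### The soliton -/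

/-- The parameter `c = (2μ / (μ² - 1))²`. -/
def solC (μ : ℝ) : ℝ := (2 * μ / (μ ^ 2 - 1)) ^ 2

/-- The velocity `v = -(μ² + 1) / (2μ)`. -/
def solV (μ : ℝ) : ℝ := -((μ ^ 2 + 1) / (2 * μ))

/-- The parameter `β`, positive for `0 < μ < 1`: with the positive square root of `c`, this is the
sign for which the pair `(solB, solD)` solves the principal chiral field equations. -/
def solBeta (μ : ℝ) : ℝ := (1 + μ) / (1 - μ)

/-- `γ₁ = lam + ε θ(x + t)`. -/
def gam1 (lam ε : ℝ) (θ : ℝ → ℝ) (t x : ℝ) : ℝ := lam + ε * θ (x + t)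

/-- `γ₂ = ε σ(x - t)`. -/
def gam2 (ε : ℝ) (σ : ℝ → ℝ) (t x : ℝ) : ℝ := ε * σ (x - t)

/-- The seed `γ = γ₁ + γ₂`, a solution of the wave equation. -/
def gam (lam ε : ℝ) (θ σ : ℝ → ℝ) (t x : ℝ) : ℝ := gam1 lam ε θ t x + gam2 ε σ t x

/-- The combination `β γ₁ + β⁻¹ γ₂`. -/
def gamBeta (lam μ ε : ℝ) (θ σ : ℝ → ℝ) (t x : ℝ) : ℝ :=
  solBeta μ * gam1 lam ε θ t x + (solBeta μ)⁻¹ * gam2 ε σ t x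

/-- The component `B` (the field `Λ`) of the 1-soliton. -/
def solB (lam μ ε : ℝ) (θ σ : ℝ → ℝ) (t x : ℝ) : ℝ :=
  Real.arcosh (|solV μ| * Real.cosh (gam lam ε θ σ t x)
    - 1 / √(solC μ) * Real.tanh (gamBeta lam μ ε θ σ t x) * Real.sinh (gam lam ε θ σ t x))

/-- The component `D` (the field `φ`) of the 1-soliton. -/
def solD (lam μ ε : ℝ) (θ σ : ℝ → ℝ) (t x : ℝ) : ℝ :=
  Real.pi / 4 - 1 / 2 * Real.arctan
    (Real.cosh (gamBeta lam μ ε θ σ t x) * Real.cosh (gam lam ε θ σ t x)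
      * (Real.tanh (gamBeta lam μ ε θ σ t x)
        + solV μ * √(solC μ) * Real.tanh (gam lam ε θ σ t x)))

/-! ### The perturbation of the soliton -/

/-- The coefficient `sinh(2Λ) / sinh²(Λ)` of the equation for the angle. -/
def angCoef (y : ℝ) : ℝ := Real.sinh (2 * y) / Real.sinh y ^ 2

/-- `(z, s)` solves, at all times of `[0, T]`, the system for a perturbation of `(B, D)`, i.e. the
difference of the principal chiral field equations for `(B + z, D + s)` and for `(B, D)`. -/
def IsPerturbation (B D : ℝ → ℝ → ℝ) (T : ℝ) (z s : ℝ → ℝ → ℝ) : Prop :=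
  ∀ t ∈ Set.Icc 0 T, ∀ x : ℝ,
    box z t x = 2 * Real.sinh (2 * B t x) * Q0 D D t x
      - 2 * Real.sinh (2 * (B t x + z t x)) * (Q0 D D t x + 2 * Q0 D s t x + Q0 s s t x) ∧
    box s t x = -(angCoef (B t x) * Q0 D B t x)
      + angCoef (B t x + z t x) * (Q0 D B t x + Q0 D z t x + Q0 B s t x + Q0 z s t x)

/-! ### Weighted energies and fluxes -/

/-- The weight `φ(u) = (1 + |u|²)^(1 + η)`. -/
def weight (η u : ℝ) : ℝ := (1 + |u| ^ 2) ^ (1 + η)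

/-- The null coordinate `u = (t - x) / 2`. -/
def uCoord (t x : ℝ) : ℝ := (t - x) / 2

/-- The null coordinate `u̲ = (t + x) / 2`. -/
def ubarCoord (t x : ℝ) : ℝ := (t + x) / 2

/-- The weighted energy of `ψ` on the time slice `Σ_t`. -/
def sliceEnergy (η : ℝ) (ψ : ℝ → ℝ → ℝ) (t : ℝ) : ℝ≥0∞ :=
  ∫⁻ x : ℝ, ENNReal.ofReal (weight η (uCoord t x) * |nullLbar ψ t x| ^ 2
    + weight η (ubarCoord t x) * |nullL ψ t x| ^ 2)

/-- The weighted flux of `ψ`: the supremum over the null segments `u̲ = b`, `0 ≤ τ ≤ t`, plus the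
supremum over the null segments `u = a`, `0 ≤ τ ≤ t`, both parametrized by the time `τ`. -/
def nullFlux (η : ℝ) (ψ : ℝ → ℝ → ℝ) (t : ℝ) : ℝ≥0∞ :=
  (⨆ b : ℝ, ∫⁻ τ in Set.Icc 0 t, ENNReal.ofReal
    (weight η (uCoord τ (2 * b - τ)) * |nullLbar ψ τ (2 * b - τ)| ^ 2))
  + ⨆ a : ℝ, ∫⁻ τ in Set.Icc 0 t, ENNReal.ofReal
    (weight η (ubarCoord τ (τ - 2 * a)) * |nullL ψ τ (τ - 2 * a)| ^ 2)

/-- The total energy: the sum over `k = 0, 1` of the energies of `∂_x^k ψ`. For `ψ = z` this is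
the norm `ℰ`, for `ψ = s` the norm with a bar. -/
def totalEnergy (η : ℝ) (ψ : ℝ → ℝ → ℝ) (t : ℝ) : ℝ≥0∞ :=
  sliceEnergy η ψ t + sliceEnergy η (dx ψ) t

/-- The total flux: the sum over `k = 0, 1` of the fluxes of `∂_x^k ψ`. -/
def totalFlux (η : ℝ) (ψ : ℝ → ℝ → ℝ) (t : ℝ) : ℝ≥0∞ :=
  nullFlux η ψ t + nullFlux η (dx ψ) t

/-- `C₀` is a constant for the weighted energy inequality of the linear wave equation
`□ψ = ρ`. Both sides may be infinite. -/
def IsEnergyConstant (η C₀ : ℝ) : Prop :=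
  ∀ ψ : ℝ → ℝ → ℝ, ContDiff ℝ 2 (fun p : ℝ × ℝ => ψ p.1 p.2) → ∀ t : ℝ, 0 ≤ t →
    sliceEnergy η ψ t + nullFlux η ψ t ≤
      ENNReal.ofReal C₀ * sliceEnergy η ψ 0
      + ENNReal.ofReal C₀ * ∫⁻ τ in Set.Icc 0 t, ∫⁻ x : ℝ, ENNReal.ofReal
        ((weight η (uCoord τ x) * |nullLbar ψ τ x| + weight η (ubarCoord τ x) * |nullL ψ τ x|)
          * |box ψ τ x|)

/-- The supremum over `t ∈ [0, T]` of the `L^∞(ℝ)` norm of `z(t, ·)`. -/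
def supNorm (z : ℝ → ℝ → ℝ) (T : ℝ) : ℝ≥0∞ :=
  ⨆ t ∈ Set.Icc 0 T, eLpNorm (z t) ∞ volume

end

end PCF

/-! Put W = B + z and Y = D + s. Both right-hand sides are differences of terms c(·) Q₀(·, ·), one
evaluated on (W, Y) and one on (B, D), with c smooth on (0, ∞). By `Q0_eq` every null form is a sum
of products of one L-derivative and one L̲-derivative. No cancellation between the two terms is
needed: null derivatives of the soliton are O(ε) and localized (`exists_soliton_bound`), and ε < δ,
so they are as small as those of the perturbation.

Since L L̲ψ = □ψ and φ(u) is constant along the integral curves of L, integrating (L̲ψ)² along these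
curves bounds energies and fluxes by twice the initial energy plus four times a weighted integral of
|L̲ψ||□ψ| and its mirror image (`energy_add_flux_le`). Only a transport inequality is required, so
the argument also covers ∂ₓψ, which is merely C¹ (`transport_nullLbar_dx`). The reflection x ↦ -x
exchanges L with L̲ and u with u̲, so each estimate is proved for L̲ alone.

The core is a cubic bound for the source (`source_nonlin_le`). Let P, Q measure first derivatives in
the directions L̲, L, and let P₁, Q₁ include second derivatives. Two integrals occur. (1) φ(u) P₁²
Q: a weighted Sobolev inequality gives Q ≲ δ φ(u̲)^(-1/2), which is integrable in u̲, and the flux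
of P₁ through u̲ = b does the rest (`source_top_mul_base_le`). (2) φ(u) P₁ P Q₁: after
Cauchy–Schwarz the flux of Q₁ through u = a appears, multiplied by φ(u) P². Sobolev only makes φ(u)
P² bounded, whereas an integrable majorant depending on u alone is needed. Transport from time 0
provides it (`exists_charBound`, `source_base_mul_top_le`).

Hence energy plus flux is at most 2C₁δ² + O(δ³), which is at most 5C₁δ² for small δ. This suffices
because every energy constant is at least 1 (`IsEnergyConstant.one_le`). The pointwise bound z =
O(δ) comes from integrating the Sobolev decay along a null line down to t = 0, and then in x from
outside the support (`abs_le_of_partBound`). -/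

namespace PCF

open Set Filter Topology

/-! ### Calculus in the plane: null derivatives, characteristics and reflection. -/

section Calculus

variable {f g ψ : ℝ → ℝ → ℝ}

/-- A function of time and position is of class `C^n`. -/
def IsC (n : WithTop ℕ∞) (f : ℝ → ℝ → ℝ) : Prop := ContDiff ℝ n (fun p : ℝ × ℝ => f p.1 p.2)

theorem _root_.ContDiff.of_forall_eq {n : WithTop ℕ∞} {F G : ℝ × ℝ → ℝ} (hG : ContDiff ℝ n G)
    (h : ∀ p, F p = G p) : ContDiff ℝ n F := (funext h : F = G) ▸ hG

theorem IsC.of_le {m n : WithTop ℕ∞} (hf : IsC n f) (h : m ≤ n) : IsC m f :=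
  ContDiff.of_le hf h

theorem IsC.continuous {n : WithTop ℕ∞} (hf : IsC n f) :
    Continuous (fun p : ℝ × ℝ => f p.1 p.2) :=
  ContDiff.continuous hf

theorem IsC.differentiable (hf : IsC 1 f) : Differentiable ℝ (fun p : ℝ × ℝ => f p.1 p.2) :=
  ContDiff.differentiable hf (by norm_num)

theorem dt_eq_fderiv (hf : IsC 1 f) (t x : ℝ) :
    dt f t x = fderiv ℝ (fun p : ℝ × ℝ => f p.1 p.2) (t, x) (1, 0) := by
  have h := (hf.differentiable (t, x)).hasFDerivAt
  have h2 : HasDerivAt (fun τ : ℝ => (τ, x)) ((1 : ℝ), (0 : ℝ)) t :=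
    (hasDerivAt_id t).prodMk (hasDerivAt_const t x)
  exact (h.comp_hasDerivAt t h2).deriv

theorem dx_eq_fderiv (hf : IsC 1 f) (t x : ℝ) :
    dx f t x = fderiv ℝ (fun p : ℝ × ℝ => f p.1 p.2) (t, x) (0, 1) := by
  have h := (hf.differentiable (t, x)).hasFDerivAt
  have h2 : HasDerivAt (fun y : ℝ => (t, y)) ((0 : ℝ), (1 : ℝ)) x :=
    (hasDerivAt_const x t).prodMk (hasDerivAt_id x)
  exact (h.comp_hasDerivAt x h2).deriv

theorem IsC.dt (hf : IsC 2 f) : IsC 1 (dt f) := by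
  have h : ContDiff ℝ 1 (fun p : ℝ × ℝ => fderiv ℝ (fun p : ℝ × ℝ => f p.1 p.2) p (1, 0)) :=
    (ContDiff.fderiv_right hf (by norm_num)).clm_apply contDiff_const
  exact h.of_forall_eq fun p => dt_eq_fderiv (hf.of_le (by norm_num)) p.1 p.2

theorem IsC.dx (hf : IsC 2 f) : IsC 1 (dx f) := by
  have h : ContDiff ℝ 1 (fun p : ℝ × ℝ => fderiv ℝ (fun p : ℝ × ℝ => f p.1 p.2) p (0, 1)) :=
    (ContDiff.fderiv_right hf (by norm_num)).clm_apply contDiff_const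
  exact h.of_forall_eq fun p => dx_eq_fderiv (hf.of_le (by norm_num)) p.1 p.2

theorem IsC.dt_zero (hf : IsC 1 f) : IsC 0 (PCF.dt f) := by
  have h : ContDiff ℝ 0 (fun p : ℝ × ℝ => fderiv ℝ (fun p : ℝ × ℝ => f p.1 p.2) p (1, 0)) :=
    (ContDiff.fderiv_right hf (by norm_num)).clm_apply contDiff_const
  exact h.of_forall_eq fun p => dt_eq_fderiv hf p.1 p.2

theorem IsC.dx_zero (hf : IsC 1 f) : IsC 0 (PCF.dx f) := by
  have h : ContDiff ℝ 0 (fun p : ℝ × ℝ => fderiv ℝ (fun p : ℝ × ℝ => f p.1 p.2) p (0, 1)) :=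
    (ContDiff.fderiv_right hf (by norm_num)).clm_apply contDiff_const
  exact h.of_forall_eq fun p => dx_eq_fderiv hf p.1 p.2

theorem IsC.add {n : WithTop ℕ∞} (hf : IsC n f) (hg : IsC n g) :
    IsC n (fun t x => f t x + g t x) := ContDiff.add hf hg

theorem IsC.sub {n : WithTop ℕ∞} (hf : IsC n f) (hg : IsC n g) :
    IsC n (fun t x => f t x - g t x) := ContDiff.sub hf hg

theorem IsC.nullLbar (hf : IsC 2 f) : IsC 1 (nullLbar f) := hf.dt.sub hf.dx

theorem IsC.nullL_zero (hf : IsC 1 f) : IsC 0 (PCF.nullL f) := hf.dt_zero.add hf.dx_zero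

theorem IsC.nullLbar_zero (hf : IsC 1 f) : IsC 0 (PCF.nullLbar f) := hf.dt_zero.sub hf.dx_zero

theorem IsC.box (hf : IsC 2 f) : IsC 0 (box f) := hf.dt.dt_zero.sub hf.dx.dx_zero

/-- The chain rule along a curve. -/
theorem IsC.hasDerivAt_curve (hf : IsC 1 f) {p q : ℝ → ℝ} {p' q' τ : ℝ}
    (hp : HasDerivAt p p' τ) (hq : HasDerivAt q q' τ) :
    HasDerivAt (fun r => f (p r) (q r)) (p' * PCF.dt f (p τ) (q τ) + q' * PCF.dx f (p τ) (q τ))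
      τ := by
  have h := (hf.differentiable (p τ, q τ)).hasFDerivAt
  have h2 : HasDerivAt (fun r : ℝ => (p r, q r)) (p', q') τ := hp.prodMk hq
  have h3 := h.comp_hasDerivAt τ h2
  have e : ((p', q') : ℝ × ℝ) = p' • ((1 : ℝ), (0 : ℝ)) + q' • ((0 : ℝ), (1 : ℝ)) := by simp
  rw [e, map_add, map_smul, map_smul, ← dt_eq_fderiv hf, ← dx_eq_fderiv hf] at h3
  exact h3

theorem IsC.hasDerivAt_dx (hf : IsC 1 f) (t x : ℝ) :
    HasDerivAt (fun y => f t y) (PCF.dx f t x) x := by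
  simpa using hf.hasDerivAt_curve (hasDerivAt_const x t) (hasDerivAt_id x)

theorem IsC.hasDerivAt_dt (hf : IsC 1 f) (t x : ℝ) :
    HasDerivAt (fun τ => f τ x) (PCF.dt f t x) t := by
  simpa using hf.hasDerivAt_curve (hasDerivAt_id t) (hasDerivAt_const t x)

theorem deriv_fderiv_apply {F : ℝ × ℝ → ℝ} (hF : ContDiff ℝ 2 F) {p : ℝ → ℝ × ℝ} {p' : ℝ × ℝ}
    {r : ℝ} (hp : HasDerivAt p p' r) (v : ℝ × ℝ) :
    deriv (fun τ => fderiv ℝ F (p τ) v) r = fderiv ℝ (fderiv ℝ F) (p r) p' v := by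
  have hd : HasFDerivAt (fderiv ℝ F) (fderiv ℝ (fderiv ℝ F) (p r)) (p r) :=
    (((ContDiff.fderiv_right (m := 1) hF (by norm_num)).differentiable (by norm_num)) _).hasFDerivAt
  have h1 : HasDerivAt (fun τ => fderiv ℝ F (p τ)) (fderiv ℝ (fderiv ℝ F) (p r) p') r :=
    hd.comp_hasDerivAt r hp
  have h2 := h1.clm_apply (hasDerivAt_const r v)
  rw [h2.deriv, map_zero, add_zero]

/-- Symmetry of the second Fréchet derivative. This is what makes L L̲ equal to the wave operator
and lets ∂ₓ commute with L and L̲ on C² functions. -/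
theorem dt_dx_comm (hf : IsC 2 f) (t x : ℝ) : dt (dx f) t x = dx (dt f) t x := by
  have hs : IsSymmSndFDerivAt ℝ (fun p : ℝ × ℝ => f p.1 p.2) (t, x) :=
    ContDiffAt.isSymmSndFDerivAt (n := 2) (ContDiff.contDiffAt hf) (by simp)
  have hf1 : IsC 1 f := hf.of_le (by norm_num)
  have e1 : dx f = fun t x => fderiv ℝ (fun p : ℝ × ℝ => f p.1 p.2) (t, x) (0, 1) := by
    funext a b; exact dx_eq_fderiv hf1 a b
  have e2 : dt f = fun t x => fderiv ℝ (fun p : ℝ × ℝ => f p.1 p.2) (t, x) (1, 0) := by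
    funext a b; exact dt_eq_fderiv hf1 a b
  have h2 : HasDerivAt (fun τ : ℝ => (τ, x)) ((1 : ℝ), (0 : ℝ)) t :=
    (hasDerivAt_id t).prodMk (hasDerivAt_const t x)
  have h3 : HasDerivAt (fun y : ℝ => (t, y)) ((0 : ℝ), (1 : ℝ)) x :=
    (hasDerivAt_const x t).prodMk (hasDerivAt_id x)
  rw [e1, e2]
  exact (deriv_fderiv_apply hf h2 (0, 1)).trans
    ((hs _ _).trans (deriv_fderiv_apply hf h3 (1, 0)).symm)

theorem dx_nullLbar (hf : IsC 2 f) (t x : ℝ) : dx (nullLbar f) t x = nullLbar (dx f) t x := by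
  have h := (hf.dt.hasDerivAt_dx t x).sub (hf.dx.hasDerivAt_dx t x)
  have h2 : dx (nullLbar f) t x = dx (dt f) t x - dx (dx f) t x := h.deriv
  rw [h2, ← dt_dx_comm hf, nullLbar]

theorem dx_nullL (hf : IsC 2 f) (t x : ℝ) : dx (nullL f) t x = nullL (dx f) t x := by
  have h := (hf.dt.hasDerivAt_dx t x).add (hf.dx.hasDerivAt_dx t x)
  have h2 : dx (nullL f) t x = dx (dt f) t x + dx (dx f) t x := h.deriv
  rw [h2, ← dt_dx_comm hf, nullL]

/-- `L (L̲ ψ) = □ ψ`, along the integral curves of `L`. -/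
theorem hasDerivAt_nullLbar_char (hf : IsC 2 f) (a τ : ℝ) :
    HasDerivAt (fun r => nullLbar f r (r - 2 * a)) (box f τ (τ - 2 * a)) τ := by
  have hq : HasDerivAt (fun r : ℝ => r - 2 * a) 1 τ := (hasDerivAt_id τ).sub_const _
  have h := (hf.dt.hasDerivAt_curve (hasDerivAt_id τ) hq).sub
    (hf.dx.hasDerivAt_curve (hasDerivAt_id τ) hq)
  refine h.congr_deriv ?_
  simp only [box, id, dt_dx_comm hf]
  ring

/-- The reflection `x ↦ -x`. -/
def refl (f : ℝ → ℝ → ℝ) : ℝ → ℝ → ℝ := fun t x => f t (-x)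

@[simp] theorem refl_refl (f : ℝ → ℝ → ℝ) : refl (refl f) = f := by
  funext t x; simp [refl]

theorem IsC.refl {n : WithTop ℕ∞} (hf : IsC n f) : IsC n (refl f) := by
  have h : ContDiff ℝ n (fun p : ℝ × ℝ => (p.1, -p.2)) := contDiff_fst.prodMk contDiff_snd.neg
  exact ContDiff.comp (g := fun p : ℝ × ℝ => f p.1 p.2) hf h

theorem dt_refl (f : ℝ → ℝ → ℝ) (t x : ℝ) : dt (refl f) t x = dt f t (-x) := rfl

theorem dx_refl (f : ℝ → ℝ → ℝ) (t x : ℝ) : dx (refl f) t x = -dx f t (-x) :=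
  deriv_comp_neg (fun y => f t y) x

/-- The reflection exchanges the two null directions, so estimates for L follow from those for L̲.
-/
theorem nullLbar_refl (f : ℝ → ℝ → ℝ) (t x : ℝ) : nullLbar (refl f) t x = nullL f t (-x) := by
  simp [nullLbar, nullL, dt_refl, dx_refl]

theorem dx_refl_eq (f : ℝ → ℝ → ℝ) : dx (refl f) = refl (fun t x => -dx f t x) := by
  funext t x; exact dx_refl f t x

theorem dt_neg (f : ℝ → ℝ → ℝ) (t x : ℝ) : dt (fun t x => -f t x) t x = -dt f t x :=
  deriv.fun_neg

theorem dx_neg (f : ℝ → ℝ → ℝ) (t x : ℝ) : dx (fun t x => -f t x) t x = -dx f t x :=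
  deriv.fun_neg

theorem nullLbar_dx_refl (f : ℝ → ℝ → ℝ) (t x : ℝ) :
    nullLbar (dx (refl f)) t x = -nullL (dx f) t (-x) := by
  rw [dx_refl_eq, nullLbar_refl, nullL, nullL, dt_neg, dx_neg]; ring

theorem box_refl (f : ℝ → ℝ → ℝ) (t x : ℝ) : box (refl f) t x = box f t (-x) := by
  have h : dx (dx (refl f)) t x = dx (dx f) t (-x) := by
    rw [dx_refl_eq, dx_refl, dx_neg, neg_neg]
  rw [box, box, h]
  rfl

/-- The null structure: the products Lf · Lg and L̲f · L̲g, for which the two families of weights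
would give no gain, are absent. -/
theorem Q0_eq (f g : ℝ → ℝ → ℝ) (t x : ℝ) :
    Q0 f g t x = -(nullL f t x * nullLbar g t x + nullLbar f t x * nullL g t x) / 2 := by
  simp only [Q0, nullL, nullLbar]; ring

end Calculus

/-! ### The weight φ and the decay rate φ^(-1/2). -/

section Weights

variable {η : ℝ}

theorem weight_pos (u : ℝ) : 0 < weight η u := Real.rpow_pos_of_pos (by positivity) _

theorem weight_nonneg (u : ℝ) : 0 ≤ weight η u := (weight_pos u).le

theorem continuous_weight : Continuous (weight η) := by
  unfold weight
  exact Continuous.rpow_const (by fun_prop) fun u => Or.inl (by positivity)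

/-- Lets the weight pass through integrals over unit intervals in the Sobolev inequality. -/
theorem weight_le_of_abs_sub_le (hη : 0 < η) (hη' : η < 1) {u v : ℝ} (h : |u - v| ≤ 1) :
    weight η u ≤ 9 * weight η v := by
  have h1 : 1 + |u| ^ 2 ≤ 3 * (1 + |v| ^ 2) := by
    rw [sq_abs, sq_abs]
    have h2 := abs_le.mp h
    -- The square is the identity (u - 2v)² = 2v² + 2(u - v)² - u².
    nlinarith [sq_nonneg (u - 2 * v), h2.1, h2.2]
  calc weight η u ≤ (3 * (1 + |v| ^ 2)) ^ (1 + η) :=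
        Real.rpow_le_rpow (by positivity) h1 (by linarith)
    _ = 3 ^ (1 + η) * weight η v := Real.mul_rpow (by norm_num) (by positivity)
    _ ≤ 9 * weight η v := by
        refine mul_le_mul_of_nonneg_right ?_ (weight_nonneg v)
        calc (3 : ℝ) ^ (1 + η) ≤ 3 ^ (2 : ℝ) :=
              Real.rpow_le_rpow_of_exponent_le (by norm_num) (by linarith)
          _ = 9 := by norm_num

/-- The decay rate `φ(u)^(-1/2)`. -/
noncomputable def rho (η u : ℝ) : ℝ := (1 + ‖u‖ ^ 2) ^ (-(1 + η) / 2)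

theorem rho_pos (u : ℝ) : 0 < rho η u := Real.rpow_pos_of_pos (by positivity) _

theorem rho_neg (u : ℝ) : rho η (-u) = rho η u := by simp [rho]

theorem continuous_rho : Continuous (rho η) := by
  unfold rho
  exact Continuous.rpow_const (by fun_prop) fun u => Or.inl (by positivity)

theorem rho_sq_mul_weight (u : ℝ) : rho η u ^ 2 * weight η u = 1 := by
  have h : (0 : ℝ) < 1 + |u| ^ 2 := by positivity
  rw [rho, weight, Real.norm_eq_abs, ← Real.rpow_natCast, ← Real.rpow_mul h.le,
    ← Real.rpow_add h]
  have : -(1 + η) / 2 * ((2 : ℕ) : ℝ) + (1 + η) = 0 := by push_cast; ring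
  rw [this, Real.rpow_zero]

theorem rho_le_one (hη : 0 < η) (u : ℝ) : rho η u ≤ 1 :=
  Real.rpow_le_one_of_one_le_of_nonpos (by nlinarith [sq_nonneg ‖u‖]) (by linarith)

/-- The product is 1 / `rho η u`. It pays for the factor φ(u̲)^(1/2) lost in the Cauchy–Schwarz
step. -/
theorem inv_rho_le_weight (hη : 0 < η) (u : ℝ) : 1 ≤ rho η u * weight η u := by
  have h1 := rho_sq_mul_weight (η := η) u
  have h2 := rho_le_one hη u
  have h3 := rho_pos (η := η) u
  have h4 := weight_pos (η := η) u
  nlinarith [mul_pos h3 h4]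

/-- The decay exponent at infinity is 1 + η > 1; this is the purpose of a positive η. -/
theorem integrable_rho (hη : 0 < η) : Integrable (rho η) := by
  have := integrable_rpow_neg_one_add_norm_sq (E := ℝ) (μ := volume) (r := 1 + η) (by simp [hη])
  exact this

/-- A pointwise bound by `rho` from a weighted bound. -/
theorem abs_le_mul_rho {y A u : ℝ} (hA : 0 ≤ A) (h : weight η u * y ^ 2 ≤ A ^ 2) :
    |y| ≤ A * rho η u := by
  refine abs_le_of_sq_le_sq ?_ (mul_nonneg hA (rho_pos u).le)
  calc y ^ 2 = rho η u ^ 2 * (weight η u * y ^ 2) := by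
        rw [← mul_assoc, rho_sq_mul_weight, one_mul]
    _ ≤ rho η u ^ 2 * A ^ 2 := mul_le_mul_of_nonneg_left h (sq_nonneg _)
    _ = (A * rho η u) ^ 2 := by ring

end Weights

/-! ### Foliations of the strip by null lines. -/

section ChangeOfVariables

theorem lintegral_eq_two_mul_comp_two_mul (H : ℝ → ℝ≥0∞) :
    ∫⁻ x, H x = 2 * ∫⁻ b, H (2 * b) := by
  have h := Real.smul_map_volume_mul_left (a := 2) (by norm_num)
  conv_lhs => rw [← h]
  rw [lintegral_smul_measure, (measurableEmbedding_mulLeft₀ (two_ne_zero' ℝ)).lintegral_map]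
  simp

theorem lintegral_eq_two_mul_sub (H : ℝ → ℝ≥0∞) (t : ℝ) :
    ∫⁻ x, H x = 2 * ∫⁻ b, H (2 * b - t) := by
  rw [← lintegral_eq_two_mul_comp_two_mul (fun y => H (y - t)),
    lintegral_sub_right_eq_self (fun y => H y) t]

theorem lintegral_eq_two_mul_sub' (H : ℝ → ℝ≥0∞) (t : ℝ) :
    ∫⁻ x, H x = 2 * ∫⁻ a, H (t - 2 * a) := by
  rw [← lintegral_eq_two_mul_comp_two_mul (fun y => H (t - y)),
    lintegral_sub_left_eq_self (fun y => H y) t]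

/-- Substitute x = 2b - τ on each time slice, with Jacobian 2, then apply Tonelli. -/
theorem lintegral_strip_eq_ubar {H : ℝ → ℝ → ℝ≥0∞} (hH : Measurable fun p : ℝ × ℝ => H p.1 p.2)
    (T : ℝ) :
    ∫⁻ τ in Icc 0 T, ∫⁻ x, H τ x = 2 * ∫⁻ b, ∫⁻ τ in Icc 0 T, H τ (2 * b - τ) := by
  simp_rw [fun τ => lintegral_eq_two_mul_sub (H τ) τ]
  rw [lintegral_const_mul' _ _ (by norm_num), lintegral_lintegral_swap]
  refine Measurable.aemeasurable ?_
  exact hH.comp (f := fun p : ℝ × ℝ => (p.1, 2 * p.2 - p.1)) (by fun_prop)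

theorem lintegral_strip_eq_u {H : ℝ → ℝ → ℝ≥0∞} (hH : Measurable fun p : ℝ × ℝ => H p.1 p.2)
    (T : ℝ) :
    ∫⁻ τ in Icc 0 T, ∫⁻ x, H τ x = 2 * ∫⁻ a, ∫⁻ τ in Icc 0 T, H τ (τ - 2 * a) := by
  simp_rw [fun τ => lintegral_eq_two_mul_sub' (H τ) τ]
  rw [lintegral_const_mul' _ _ (by norm_num), lintegral_lintegral_swap]
  refine Measurable.aemeasurable ?_
  exact hH.comp (f := fun p : ℝ × ℝ => (p.1, p.1 - 2 * p.2)) (by fun_prop)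

end ChangeOfVariables

/-! ### Energy and flux bounds from transport along characteristics. -/

section Transport

variable {η T : ℝ} {F M : ℝ → ℝ → ℝ}

/-- The square of a function is controlled by its values at one end and its derivative. -/
theorem ofReal_sq_le_add_lintegral {f g : ℝ → ℝ} {a b : ℝ} (hab : a ≤ b)
    (hf : ContinuousOn f (Icc a b)) (hd : ∀ τ ∈ Ioo a b, HasDerivAt f (g τ) τ)
    (hg : ContinuousOn g (Icc a b)) :
    ENNReal.ofReal (f b ^ 2) ≤
      ENNReal.ofReal (f a ^ 2) + ∫⁻ τ in Icc a b, ENNReal.ofReal (2 * (|f τ| * |g τ|)) ∧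
    ENNReal.ofReal (f a ^ 2) ≤
      ENNReal.ofReal (f b ^ 2) + ∫⁻ τ in Icc a b, ENNReal.ofReal (2 * (|f τ| * |g τ|)) := by
  -- The fundamental theorem of calculus for f², whose derivative is 2fg; the derivative is required
  -- only in the open interval.
  have hc : ContinuousOn (fun τ => 2 * (f τ * g τ)) (Icc a b) := by fun_prop
  have hc' : ContinuousOn (fun τ => 2 * (|f τ| * |g τ|)) (Icc a b) := by fun_prop
  have h1 : ∫ τ in a..b, 2 * (f τ * g τ) = f b ^ 2 - f a ^ 2 := by
    refine intervalIntegral.integral_eq_sub_of_hasDerivAt_of_le (f := fun τ => f τ ^ 2) hab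
      (hf.pow 2) (fun τ hτ => ?_) (hc.intervalIntegrable_of_Icc hab)
    exact ((hd τ hτ).pow 2).congr_deriv (by simp; ring)
  have h2 : |∫ τ in a..b, 2 * (f τ * g τ)| ≤ ∫ τ in a..b, 2 * (|f τ| * |g τ|) := by
    refine (intervalIntegral.abs_integral_le_integral_abs hab).trans_eq ?_
    simp [abs_mul]
  have h3 : ENNReal.ofReal (∫ τ in a..b, 2 * (|f τ| * |g τ|)) =
      ∫⁻ τ in Icc a b, ENNReal.ofReal (2 * (|f τ| * |g τ|)) := by
    rw [intervalIntegral.integral_of_le hab, ← integral_Icc_eq_integral_Ioc]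
    exact ofReal_integral_eq_lintegral_ofReal hc'.integrableOn_Icc
      (ae_of_all _ fun τ => by positivity)
  rw [h1] at h2
  have h4 := abs_le.mp h2
  have h5 : 0 ≤ ∫ τ in a..b, 2 * (|f τ| * |g τ|) :=
    intervalIntegral.integral_nonneg hab fun τ _ => by positivity
  rw [← h3, ← ENNReal.ofReal_add (sq_nonneg _) h5, ← ENNReal.ofReal_add (sq_nonneg _) h5]
  exact ⟨ENNReal.ofReal_le_ofReal (by linarith [h4.2]), ENNReal.ofReal_le_ofReal (by linarith [h4.1])⟩

/-- The squared growth of `F` along the integral curves of `L` in the strip `[0, T] × ℝ` is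
controlled by a source of size `M`. -/
def Transport (F M : ℝ → ℝ → ℝ) (T : ℝ) : Prop :=
  ∀ a : ℝ, ∀ τ ∈ Icc 0 T, ENNReal.ofReal (F τ (τ - 2 * a) ^ 2) ≤
    ENNReal.ofReal (F 0 (-(2 * a)) ^ 2) +
      ∫⁻ r in Icc 0 T, ENNReal.ofReal (2 * (|F r (r - 2 * a)| * M r (r - 2 * a)))

/-- The part of the weighted energy carried by the field `F` in place of `L̲ψ`. -/
noncomputable def slicePart (η : ℝ) (F : ℝ → ℝ → ℝ) (t : ℝ) : ℝ≥0∞ :=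
  ∫⁻ x, ENNReal.ofReal (weight η (uCoord t x) * F t x ^ 2)

/-- The weighted flux of `F` through the null segment `u̲ = b`. -/
noncomputable def fluxPart (η : ℝ) (F : ℝ → ℝ → ℝ) (T b : ℝ) : ℝ≥0∞ :=
  ∫⁻ τ in Icc 0 T, ENNReal.ofReal (weight η (uCoord τ (2 * b - τ)) * F τ (2 * b - τ) ^ 2)

/-- The weighted space-time integral of `|F| M`. -/
noncomputable def source (η : ℝ) (F M : ℝ → ℝ → ℝ) (T : ℝ) : ℝ≥0∞ :=
  ∫⁻ τ in Icc 0 T, ∫⁻ x, ENNReal.ofReal (weight η (uCoord τ x) * (|F τ x| * M τ x))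

/-- The bound for `φ(u) |F|²` on the integral curve `u = a` of `L`. -/
noncomputable def charBound (η : ℝ) (F M : ℝ → ℝ → ℝ) (T a : ℝ) : ℝ≥0∞ :=
  ENNReal.ofReal (weight η a * F 0 (-(2 * a)) ^ 2) +
    ∫⁻ r in Icc 0 T, ENNReal.ofReal (weight η a * (2 * (|F r (r - 2 * a)| * M r (r - 2 * a))))

theorem uCoord_sub (τ a : ℝ) : uCoord τ (τ - 2 * a) = a := by simp [uCoord]

/-- The weight depends on u alone, hence is constant on u = a and multiplies the transport
inequality. The resulting bound does not depend on τ. -/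
theorem Transport.le_charBound (h : Transport F M T) {τ : ℝ} (hτ : τ ∈ Icc 0 T) (a : ℝ) :
    ENNReal.ofReal (weight η a * F τ (τ - 2 * a) ^ 2) ≤ charBound η F M T a := by
  simp only [charBound, ENNReal.ofReal_mul (weight_nonneg (η := η) a)]
  rw [lintegral_const_mul' _ _ ENNReal.ofReal_ne_top, ← mul_add]
  exact mul_le_mul_right (h a τ hτ) _

theorem Transport.le_charBound' (h : Transport F M T) {τ : ℝ} (hτ : τ ∈ Icc 0 T) (x : ℝ) :
    ENNReal.ofReal (weight η (uCoord τ x) * F τ x ^ 2) ≤ charBound η F M T (uCoord τ x) := by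
  have h1 := h.le_charBound (η := η) hτ (uCoord τ x)
  have h2 : τ - 2 * uCoord τ x = x := by simp only [uCoord]; ring
  rwa [h2] at h1

theorem measurable_charBound_source (hF : IsC 0 F) (hM : IsC 0 M) :
    Measurable fun p : ℝ × ℝ => ENNReal.ofReal
      (weight η (uCoord p.1 p.2) * (2 * (|F p.1 p.2| * M p.1 p.2))) := by
  have h1 := hF.continuous
  have h2 := hM.continuous
  have h3 := continuous_weight (η := η)
  have : Continuous fun p : ℝ × ℝ => uCoord p.1 p.2 := by unfold uCoord; fun_prop
  refine ENNReal.measurable_ofReal.comp (Continuous.measurable ?_)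
  fun_prop

/-- Integration over all characteristics recovers the initial energy and the space-time source; the
factors 2 are the Jacobian and the derivative of a square. -/
theorem two_mul_lintegral_charBound (hF : IsC 0 F) (hM : IsC 0 M) :
    2 * ∫⁻ a, charBound η F M T a = slicePart η F 0 + 2 * source η F M T := by
  have h1 := hF.continuous
  have h3 := continuous_weight (η := η)
  have hm : Measurable fun a : ℝ => ENNReal.ofReal (weight η a * F 0 (-(2 * a)) ^ 2) := by
    refine ENNReal.measurable_ofReal.comp (Continuous.measurable ?_)
    have : Continuous fun a : ℝ => F 0 (-(2 * a)) :=
      h1.comp (f := fun a : ℝ => ((0 : ℝ), -(2 * a))) (by fun_prop)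
    fun_prop
  simp only [charBound]
  rw [lintegral_add_left hm, mul_add]
  congr 1
  · refine Eq.trans ?_ (lintegral_eq_two_mul_sub' _ 0).symm
    simp [uCoord]
  · have h := lintegral_strip_eq_u
      (H := fun τ x => ENNReal.ofReal (weight η (uCoord τ x) * (2 * (|F τ x| * M τ x))))
      (measurable_charBound_source (η := η) hF hM) T
    simp only [uCoord_sub] at h
    rw [← h, source, ← lintegral_const_mul' _ _ (by norm_num)]
    congr 1
    funext τ
    rw [← lintegral_const_mul' _ _ (by norm_num)]
    congr 1
    funext x
    rw [show weight η (uCoord τ x) * (2 * (|F τ x| * M τ x)) =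
      2 * (weight η (uCoord τ x) * (|F τ x| * M τ x)) by ring, ENNReal.ofReal_mul (by norm_num)]
    norm_num

theorem Transport.slicePart_le (h : Transport F M T) (hF : IsC 0 F) (hM : IsC 0 M) {t : ℝ}
    (ht : t ∈ Icc 0 T) : slicePart η F t ≤ slicePart η F 0 + 2 * source η F M T := by
  rw [← two_mul_lintegral_charBound hF hM, slicePart, lintegral_eq_two_mul_sub' _ t]
  refine mul_le_mul_right (lintegral_mono fun a => ?_) _
  simp only [uCoord_sub]
  exact h.le_charBound ht a

/-- On the segment u̲ = b one has u = τ - b, so τ labels the characteristics being crossed and the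
flux is at most the integral of the characteristic bounds over all labels. -/
theorem Transport.fluxPart_le (h : Transport F M T) (hF : IsC 0 F) (hM : IsC 0 M) {t : ℝ}
    (ht : t ∈ Icc 0 T) (b : ℝ) : fluxPart η F t b ≤ slicePart η F 0 + 2 * source η F M T := by
  calc fluxPart η F t b ≤ ∫⁻ τ in Icc 0 t, charBound η F M T (τ - b) := by
        refine setLIntegral_mono' measurableSet_Icc fun τ hτ => ?_
        have h1 := h.le_charBound' (η := η) (τ := τ) ⟨hτ.1, hτ.2.trans ht.2⟩ (2 * b - τ)
        refine h1.trans_eq ?_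
        congr 1
        simp only [uCoord]; ring
    _ ≤ ∫⁻ τ, charBound η F M T (τ - b) := setLIntegral_le_lintegral _ _
    _ = ∫⁻ τ, charBound η F M T τ := lintegral_sub_right_eq_self (fun y => charBound η F M T y) b
    _ ≤ 2 * ∫⁻ τ, charBound η F M T τ := by
        rw [two_mul]; exact le_self_add
    _ = _ := two_mul_lintegral_charBound hF hM

theorem measurable_slice_integrand (hF : IsC 0 F) :
    Measurable fun p : ℝ × ℝ => ENNReal.ofReal (weight η (uCoord p.1 p.2) * F p.1 p.2 ^ 2) := by
  have h1 := hF.continuous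
  have h3 := continuous_weight (η := η)
  have : Continuous fun p : ℝ × ℝ => uCoord p.1 p.2 := by unfold uCoord; fun_prop
  refine ENNReal.measurable_ofReal.comp (Continuous.measurable ?_)
  fun_prop

theorem uCoord_neg (t x : ℝ) : uCoord t (-x) = ubarCoord t x := by
  simp [uCoord, ubarCoord]

theorem sliceEnergy_eq {ψ : ℝ → ℝ → ℝ} (hψ : IsC 1 ψ) (t : ℝ) :
    sliceEnergy η ψ t = slicePart η (nullLbar ψ) t + slicePart η (refl (nullL ψ)) t := by
  have e : slicePart η (refl (nullL ψ)) t =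
      ∫⁻ x, ENNReal.ofReal (weight η (ubarCoord t x) * |nullL ψ t x| ^ 2) := by
    rw [slicePart, ← lintegral_neg_eq_self]
    simp [refl, uCoord_neg]
  have hm : Measurable fun x : ℝ =>
      ENNReal.ofReal (weight η (uCoord t x) * nullLbar ψ t x ^ 2) := by
    have h := (measurable_slice_integrand (η := η) hψ.nullLbar_zero).comp
      (measurable_prodMk_left (x := t))
    exact h
  rw [e, slicePart, ← lintegral_add_left hm, sliceEnergy]
  congr 1
  funext x
  rw [ENNReal.ofReal_add, sq_abs]
  · exact mul_nonneg (weight_nonneg _) (sq_nonneg _)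
  · exact mul_nonneg (weight_nonneg _) (sq_nonneg _)

/-- The flux of Lψ through u = a is, after reflection, a flux through u̲ = a. -/
theorem nullFlux_eq (ψ : ℝ → ℝ → ℝ) (t : ℝ) :
    nullFlux η ψ t =
      (⨆ b, fluxPart η (nullLbar ψ) t b) + ⨆ a, fluxPart η (refl (nullL ψ)) t a := by
  have e : ∀ a τ : ℝ, ubarCoord τ (τ - 2 * a) = uCoord τ (2 * a - τ) := fun a τ => by
    simp only [uCoord, ubarCoord]; ring
  simp only [nullFlux, fluxPart, refl, sq_abs, neg_sub, e]

/-- The weighted energy inequality, for a function whose null derivatives are transported with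
sources of size `M` and `M'`. -/
theorem energy_add_flux_le {ψ M M' : ℝ → ℝ → ℝ} (hψ : IsC 1 ψ) (hM : IsC 0 M) (hM' : IsC 0 M')
    (h : Transport (nullLbar ψ) M T) (h' : Transport (refl (nullL ψ)) M' T) {t : ℝ}
    (ht : t ∈ Icc 0 T) :
    sliceEnergy η ψ t + nullFlux η ψ t ≤ 2 * sliceEnergy η ψ 0 +
      4 * (source η (nullLbar ψ) M T + source η (refl (nullL ψ)) M' T) := by
  rw [sliceEnergy_eq hψ, sliceEnergy_eq hψ, nullFlux_eq]
  have h1 := h.slicePart_le (η := η) hψ.nullLbar_zero hM ht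
  have h2 := h'.slicePart_le (η := η) hψ.nullL_zero.refl hM' ht
  have h3 := iSup_le (h.fluxPart_le (η := η) hψ.nullLbar_zero hM ht)
  have h4 := iSup_le (h'.fluxPart_le (η := η) hψ.nullL_zero.refl hM' ht)
  refine (add_le_add (add_le_add h1 h2) (add_le_add h3 h4)).trans_eq ?_
  ring

end Transport

/-! ### The energy inequality for C² functions, and energy constants. -/

section EnergyConstant

variable {η T : ℝ} {ψ : ℝ → ℝ → ℝ}

theorem transport_nullLbar (hψ : IsC 2 ψ) {M : ℝ → ℝ → ℝ}
    (hM : ∀ t ∈ Icc 0 T, ∀ x, |box ψ t x| ≤ M t x) : Transport (nullLbar ψ) M T := by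
  intro a τ hτ
  have hc : Continuous fun r : ℝ => (r, r - 2 * a) := by fun_prop
  have h := (ofReal_sq_le_add_lintegral (f := fun r => nullLbar ψ r (r - 2 * a))
    (g := fun r => box ψ r (r - 2 * a)) hτ.1
    (hψ.nullLbar.continuous.comp hc).continuousOn (fun r _ => hasDerivAt_nullLbar_char hψ a r)
    (hψ.box.continuous.comp hc).continuousOn).1
  simp only [zero_sub] at h
  refine h.trans (add_le_add le_rfl ?_)
  -- The source is integrated over all of [0, T] rather than [0, τ], which makes the bound uniform
  -- in τ.
  refine (setLIntegral_mono' measurableSet_Icc fun r hr => ?_).trans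
    (lintegral_mono_set (Icc_subset_Icc_right hτ.2))
  refine ENNReal.ofReal_le_ofReal ?_
  have := hM r ⟨hr.1, hr.2.trans hτ.2⟩ (r - 2 * a)
  gcongr

theorem transport_refl_nullL (hψ : IsC 2 ψ) {M : ℝ → ℝ → ℝ}
    (hM : ∀ t ∈ Icc 0 T, ∀ x, |box ψ t x| ≤ M t x) :
    Transport (refl (nullL ψ)) (refl M) T := by
  have e : refl (nullL ψ) = nullLbar (refl ψ) := by
    funext t x; exact (nullLbar_refl ψ t x).symm
  rw [e]
  refine transport_nullLbar hψ.refl fun t ht x => ?_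
  rw [box_refl]
  exact hM t ht (-x)

theorem source_refl (F M : ℝ → ℝ → ℝ) :
    source η (refl F) (refl M) T =
      ∫⁻ τ in Icc 0 T, ∫⁻ x, ENNReal.ofReal (weight η (ubarCoord τ x) * (|F τ x| * M τ x)) := by
  rw [source]
  congr 1
  funext τ
  rw [← lintegral_neg_eq_self]
  simp [refl, uCoord_neg]

theorem isEnergyConstant_four : IsEnergyConstant η 4 := by
  intro ψ hψ t ht
  replace hψ : IsC 2 ψ := hψ
  have hM : IsC 0 (fun τ x => |box ψ τ x|) := contDiff_zero.2 (hψ.box.continuous.abs)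
  have h := energy_add_flux_le (η := η) (hψ.of_le (by norm_num)) hM hM.refl
    (transport_nullLbar hψ fun _ _ _ => le_rfl)
    (transport_refl_nullL hψ fun _ _ _ => le_rfl) (T := t) (t := t) ⟨ht, le_rfl⟩
  have e : source η (nullLbar ψ) (fun τ x => |box ψ τ x|) t +
      source η (refl (nullL ψ)) (refl fun τ x => |box ψ τ x|) t =
      ∫⁻ τ in Icc 0 t, ∫⁻ x : ℝ, ENNReal.ofReal
        ((weight η (uCoord τ x) * |nullLbar ψ τ x| + weight η (ubarCoord τ x) * |nullL ψ τ x|)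
          * |box ψ τ x|) := by
    have hm : Measurable fun p : ℝ × ℝ => ENNReal.ofReal
        (weight η (uCoord p.1 p.2) * (|nullLbar ψ p.1 p.2| * |box ψ p.1 p.2|)) := by
      have h1 := hψ.nullLbar.continuous
      have h2 := hψ.box.continuous
      have h3 := continuous_weight (η := η)
      have : Continuous fun p : ℝ × ℝ => uCoord p.1 p.2 := by unfold uCoord; fun_prop
      refine ENNReal.measurable_ofReal.comp (Continuous.measurable ?_)
      fun_prop
    have hm1 : ∀ τ : ℝ, Measurable fun x : ℝ => ENNReal.ofReal
        (weight η (uCoord τ x) * (|nullLbar ψ τ x| * |box ψ τ x|)) := fun τ => by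
      have h := hm.comp (measurable_prodMk_left (x := τ))
      exact h
    have hm2 : Measurable fun τ : ℝ => ∫⁻ x : ℝ, ENNReal.ofReal
        (weight η (uCoord τ x) * (|nullLbar ψ τ x| * |box ψ τ x|)) := hm.lintegral_prod_right'
    rw [source_refl, source, ← lintegral_add_left hm2]
    congr 1
    funext τ
    rw [← lintegral_add_left (hm1 τ)]
    congr 1
    funext x
    rw [← ENNReal.ofReal_add (mul_nonneg (weight_nonneg _) (by positivity))
      (mul_nonneg (weight_nonneg _) (by positivity)), add_mul, mul_assoc, mul_assoc]
  rw [e] at h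
  -- The factor 2 on the initial energy is enlarged to 4 so that one constant serves both terms.
  refine h.trans (add_le_add (mul_le_mul_left ?_ _) ?_)
  · rw [← ENNReal.ofReal_ofNat]; exact ENNReal.ofReal_le_ofReal (by norm_num)
  · rw [ENNReal.ofReal_ofNat]

/-- At t = 0 the source integral runs over a null set, leaving E ≤ C₀ E. A function with positive
finite initial energy then forces C₀ ≥ 1; t times a bump in x is one. -/
theorem IsEnergyConstant.one_le {C₀ : ℝ} (h : IsEnergyConstant η C₀) : 1 ≤ C₀ := by
  let g : ContDiffBump (0 : ℝ) := ⟨1, 2, by norm_num, by norm_num⟩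
  have hg : ContDiff ℝ 2 (g : ℝ → ℝ) := g.contDiff
  set ψ : ℝ → ℝ → ℝ := fun t x => t * g x with hψ
  have hC : IsC 2 ψ := contDiff_fst.mul (hg.comp contDiff_snd)
  have h0 := h ψ hC 0 le_rfl
  have e1 : ∀ x, dt ψ 0 x = g x := fun x => by
    have : HasDerivAt (fun τ => ψ τ x) (1 * g x) 0 := (hasDerivAt_id (0 : ℝ)).mul_const _
    exact this.deriv.trans (one_mul _)
  have e2 : ∀ x, dx ψ 0 x = 0 := fun x => by simp [dx, hψ]
  have e3 : sliceEnergy η ψ 0 = ∫⁻ x, ENNReal.ofReal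
      ((weight η (uCoord 0 x) + weight η (ubarCoord 0 x)) * g x ^ 2) := by
    simp [sliceEnergy, nullL, nullLbar, e1, e2, add_mul]
  have hcont : Continuous fun x =>
      (weight η (uCoord 0 x) + weight η (ubarCoord 0 x)) * g x ^ 2 := by
    have h3 := continuous_weight (η := η)
    have h4 := hg.continuous
    unfold uCoord ubarCoord
    fun_prop
  have hsupp : HasCompactSupport fun x =>
      (weight η (uCoord 0 x) + weight η (ubarCoord 0 x)) * g x ^ 2 := by
    have : HasCompactSupport fun x => g x ^ 2 := g.hasCompactSupport.comp_left (g := fun y => y ^ 2)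
      (by norm_num)
    exact this.mul_left
  have hnn : ∀ x, 0 ≤ (weight η (uCoord 0 x) + weight η (ubarCoord 0 x)) * g x ^ 2 := fun x =>
    mul_nonneg (add_nonneg (weight_nonneg _) (weight_nonneg _)) (sq_nonneg _)
  have hint := hcont.integrable_of_hasCompactSupport hsupp (μ := volume)
  have hpos : 0 < ∫ x, (weight η (uCoord 0 x) + weight η (ubarCoord 0 x)) * g x ^ 2 :=
    hcont.integral_pos_of_hasCompactSupport_nonneg_nonzero hsupp hnn (x := 0) (by
    have : g 0 = 1 := g.one_of_mem_closedBall (by simp; exact g.rIn_pos.le)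
    have h5 := weight_pos (η := η) (uCoord 0 0)
    have h6 := weight_pos (η := η) (ubarCoord 0 0)
    rw [this]
    positivity)
  rw [← ofReal_integral_eq_lintegral_ofReal hint (ae_of_all _ hnn)] at e3
  set I := ∫ x, (weight η (uCoord 0 x) + weight η (ubarCoord 0 x)) * g x ^ 2
  simp only [Icc_self, Measure.restrict_singleton, Real.volume_singleton, zero_smul,
    lintegral_zero_measure, mul_zero, add_zero] at h0
  have h1 := le_self_add.trans h0
  rw [e3] at h1
  by_contra! hlt
  have h2 : ENNReal.ofReal C₀ * ENNReal.ofReal I < ENNReal.ofReal I := by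
    rw [← ENNReal.ofReal_mul' hpos.le]
    exact (ENNReal.ofReal_lt_ofReal_iff hpos).2 (by nlinarith)
  exact absurd h1 (not_le.2 h2)

end EnergyConstant

/-! ### Transport for ∂ₓψ, where one derivative is missing. -/

section TransportDx

variable {T : ℝ} {ψ : ℝ → ℝ → ℝ}

/-- The wave operator cannot be applied to ∂ₓψ, which is only C¹. Instead the integrated identity
for L̲ψ along r ↦ (r, r + y) is differentiated in the label y under the integral sign. -/
theorem nullLbar_dx_eq_add_integral (hψ : IsC 2 ψ) {R' : ℝ → ℝ → ℝ}
    (hR : ∀ t ∈ Icc 0 T, ∀ x, HasDerivAt (fun y => box ψ t y) (R' t x) x)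
    (hc : ContinuousOn (fun p : ℝ × ℝ => R' p.1 p.2) (Icc 0 T ×ˢ univ)) {τ : ℝ}
    (hτ : τ ∈ Icc 0 T) (y : ℝ) :
    nullLbar (dx ψ) τ (τ + y) = nullLbar (dx ψ) 0 y + ∫ r in (0)..τ, R' r (r + y) := by
  have hbox : ∀ y, Continuous fun r => box ψ r (r + y) := fun y =>
    hψ.box.continuous.comp (by fun_prop : Continuous fun r : ℝ => (r, r + y))
  have hline : ∀ y, ContinuousOn (fun r => R' r (r + y)) (Icc 0 τ) := fun y =>
    hc.comp (f := fun r : ℝ => (r, r + y)) (by fun_prop)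
      fun r hr => ⟨⟨hr.1, hr.2.trans hτ.2⟩, mem_univ _⟩
  have hint : ∀ y, ∫ r in (0)..τ, box ψ r (r + y) = nullLbar ψ τ (τ + y) - nullLbar ψ 0 y := by
    intro y
    have h := intervalIntegral.integral_eq_sub_of_hasDerivAt (a := 0) (b := τ)
      (f := fun r => nullLbar ψ r (r + y)) (f' := fun r => box ψ r (r + y)) (fun r _ => ?_)
      ((hbox y).intervalIntegrable _ _)
    · simpa using h
    · have h := hasDerivAt_nullLbar_char hψ (-y / 2) r
      have e : ∀ r : ℝ, r - 2 * (-y / 2) = r + y := fun r => by ring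
      simpa only [e] using h
  -- This box contains every point (r, r + v) with r in [0, T] and |v - y| ≤ 1, so a constant
  -- dominates the derivative.
  have hcpt : IsCompact (Icc 0 T ×ˢ Icc (y - 1) (y + 1 + T)) := isCompact_Icc.prod isCompact_Icc
  obtain ⟨C, hC⟩ := hcpt.exists_bound_of_continuousOn (hc.mono (prod_mono le_rfl (subset_univ _)))
  have hsub : ∀ r ∈ uIoc 0 τ, r ∈ Icc 0 T := fun r hr => by
    rw [uIoc_of_le hτ.1] at hr
    exact ⟨hr.1.le, hr.2.trans hτ.2⟩
  have hD := intervalIntegral.hasDerivAt_integral_of_dominated_loc_of_deriv_le (μ := volume)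
    (a := 0) (b := τ) (F := fun y r => box ψ r (r + y)) (F' := fun y r => R' r (r + y)) (x₀ := y)
    (s := Icc (y - 1) (y + 1)) (bound := fun _ => C)
    (Icc_mem_nhds (by linarith) (by linarith))
    (Eventually.of_forall fun y => (hbox y).aestronglyMeasurable)
    ((hbox y).intervalIntegrable _ _)
    (by
      rw [uIoc_of_le hτ.1]
      exact ((hline y).mono Ioc_subset_Icc_self).aestronglyMeasurable measurableSet_Ioc)
    (ae_of_all _ fun r hr v hv => hC (r, r + v) ⟨hsub r hr, by
      have := hsub r hr
      constructor
      · show y - 1 ≤ r + v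
        linarith [this.1, hv.1]
      · show r + v ≤ y + 1 + T
        linarith [this.2, hv.2]⟩)
    intervalIntegrable_const
    (ae_of_all _ fun r hr v _ => by
      have h1 : HasDerivAt (fun v : ℝ => r + v) 1 v := (hasDerivAt_id v).const_add r
      exact ((hR r (hsub r hr) (r + v)).comp v h1).congr_deriv (mul_one _))
  have h2 : HasDerivAt (fun v => nullLbar ψ τ (τ + v) - nullLbar ψ 0 v)
      (nullLbar (dx ψ) τ (τ + y) - nullLbar (dx ψ) 0 y) y := by
    have h1 : HasDerivAt (fun v : ℝ => τ + v) 1 y := (hasDerivAt_id y).const_add τ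
    have h3 := (hψ.nullLbar.hasDerivAt_dx τ (τ + y)).comp y h1
    have h4 := hψ.nullLbar.hasDerivAt_dx 0 y
    rw [dx_nullLbar hψ] at h3 h4
    rw [mul_one] at h3
    exact h3.sub h4
  have h3 := hD.2
  simp only [hint] at h3
  linarith [h2.unique h3]

/-- If `□ψ` is continuously differentiable in `x` on the strip, then `L̲∂ₓψ` is transported with
source `∂ₓ□ψ`, although `∂ₓψ` is only of class `C¹`. -/
theorem transport_nullLbar_dx (hψ : IsC 2 ψ) {R' M : ℝ → ℝ → ℝ}
    (hR : ∀ t ∈ Icc 0 T, ∀ x, HasDerivAt (fun y => box ψ t y) (R' t x) x)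
    (hc : ContinuousOn (fun p : ℝ × ℝ => R' p.1 p.2) (Icc 0 T ×ˢ univ))
    (hM : ∀ t ∈ Icc 0 T, ∀ x, |R' t x| ≤ M t x) : Transport (nullLbar (dx ψ)) M T := by
  intro a τ hτ
  have e : ∀ r : ℝ, r + -(2 * a) = r - 2 * a := fun r => by ring
  have hf : ∀ r ∈ Icc 0 T, nullLbar (dx ψ) r (r - 2 * a) =
      nullLbar (dx ψ) 0 (-(2 * a)) + ∫ r in (0)..r, R' r (r - 2 * a) := fun r hr => by
    have h := nullLbar_dx_eq_add_integral hψ hR hc hr (-(2 * a))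
    simpa only [e] using h
  have hg : ContinuousOn (fun r => R' r (r - 2 * a)) (Icc 0 T) :=
    hc.comp (f := fun r : ℝ => (r, r - 2 * a)) (by fun_prop) fun r hr => ⟨hr, mem_univ _⟩
  have hcont : Continuous fun r => nullLbar (dx ψ) r (r - 2 * a) :=
    hψ.dx.nullLbar_zero.continuous.comp (by fun_prop : Continuous fun r : ℝ => (r, r - 2 * a))
  -- The function R' is continuous only on the closed strip, so two-sided derivatives are taken at
  -- interior times.
  have hd : ∀ r ∈ Ioo 0 τ, HasDerivAt (fun r => nullLbar (dx ψ) r (r - 2 * a))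
      (R' r (r - 2 * a)) r := by
    intro r hr
    have hr' : r ∈ Ioo 0 T := ⟨hr.1, hr.2.trans_le hτ.2⟩
    have hg' := hg.mono Ioo_subset_Icc_self
    have h1 : HasDerivAt (fun v => nullLbar (dx ψ) 0 (-(2 * a)) +
        ∫ r in (0)..v, R' r (r - 2 * a)) (R' r (r - 2 * a)) r := by
      refine (intervalIntegral.integral_hasDerivAt_right ?_ ?_ ?_).const_add _
      · exact (hg.mono (Icc_subset_Icc_right hr'.2.le)).intervalIntegrable_of_Icc hr'.1.le
      · exact hg'.stronglyMeasurableAtFilter isOpen_Ioo r hr'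
      · exact hg'.continuousAt (Ioo_mem_nhds hr'.1 hr'.2)
    refine h1.congr_of_eventuallyEq ?_
    filter_upwards [Ioo_mem_nhds hr'.1 hr'.2] with v hv
    exact hf v (Ioo_subset_Icc_self hv)
  have h := (ofReal_sq_le_add_lintegral hτ.1 hcont.continuousOn hd
    (hg.mono (Icc_subset_Icc_right hτ.2))).1
  simp only [zero_sub] at h
  refine h.trans (add_le_add le_rfl ?_)
  refine (setLIntegral_mono' measurableSet_Icc fun r hr => ?_).trans
    (lintegral_mono_set (Icc_subset_Icc_right hτ.2))
  refine ENNReal.ofReal_le_ofReal ?_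
  have := hM r ⟨hr.1, hr.2.trans hτ.2⟩ (r - 2 * a)
  gcongr

theorem Transport.neg {F M : ℝ → ℝ → ℝ} (h : Transport F M T) :
    Transport (fun t x => -F t x) M T := by
  intro a τ hτ
  simpa using h a τ hτ

/-- Reflection changes the sign of ∂ₓ, which squares do not see. -/
theorem transport_refl_nullL_dx (hψ : IsC 2 ψ) {R' M : ℝ → ℝ → ℝ}
    (hR : ∀ t ∈ Icc 0 T, ∀ x, HasDerivAt (fun y => box ψ t y) (R' t x) x)
    (hc : ContinuousOn (fun p : ℝ × ℝ => R' p.1 p.2) (Icc 0 T ×ˢ univ))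
    (hM : ∀ t ∈ Icc 0 T, ∀ x, |R' t x| ≤ M t x) :
    Transport (refl (nullL (dx ψ))) (refl M) T := by
  have e : refl (nullL (dx ψ)) = fun t x => -nullLbar (dx (refl ψ)) t x := by
    funext t x; rw [nullLbar_dx_refl, neg_neg]; rfl
  rw [e]
  refine (transport_nullLbar_dx (R' := fun t x => -R' t (-x)) hψ.refl ?_ ?_ ?_).neg
  · intro t ht x
    simp only [box_refl]
    exact ((hR t ht (-x)).comp x (hasDerivAt_neg x)).congr_deriv (by ring)
  · refine ContinuousOn.neg ?_
    exact hc.comp (f := fun p : ℝ × ℝ => (p.1, -p.2)) (by fun_prop) fun p hp => ⟨hp.1, mem_univ _⟩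
  · intro t ht x
    rw [abs_neg]
    exact hM t ht (-x)

end TransportDx

/-! ### Pointwise bounds for c(W) Q₀(f, g) and its x-derivative. -/

section NullTerms

variable {T : ℝ} {f g W : ℝ → ℝ → ℝ} {c : ℝ → ℝ}

theorem hasDerivAt_Q0 (hf : IsC 2 f) (hg : IsC 2 g) (t x : ℝ) :
    HasDerivAt (fun y => Q0 f g t y) (Q0 (dx f) g t x + Q0 f (dx g) t x) x := by
  have h := ((hf.dt.hasDerivAt_dx t x).mul (hg.dt.hasDerivAt_dx t x)).neg.add
    ((hf.dx.hasDerivAt_dx t x).mul (hg.dx.hasDerivAt_dx t x))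
  refine h.congr_deriv ?_
  simp only [Q0, dt_dx_comm hf, dt_dx_comm hg]
  ring

theorem isC_Q0 (hf : IsC 1 f) (hg : IsC 1 g) : IsC 0 (Q0 f g) := by
  have h1 := hf.dt_zero.continuous
  have h2 := hf.dx_zero.continuous
  have h3 := hg.dt_zero.continuous
  have h4 := hg.dx_zero.continuous
  refine contDiff_zero.2 ?_
  unfold Q0
  fun_prop

/-- The `x`-derivative of `c(W) Q₀(f, g)`. -/
noncomputable def nullTermDx (c : ℝ → ℝ) (W f g : ℝ → ℝ → ℝ) : ℝ → ℝ → ℝ := fun t x =>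
  deriv c (W t x) * dx W t x * Q0 f g t x +
    c (W t x) * (Q0 (dx f) g t x + Q0 f (dx g) t x)

theorem hasDerivAt_nullTerm (hc : ContDiffOn ℝ 1 c (Ioi 0)) (hW : IsC 2 W) (hf : IsC 2 f)
    (hg : IsC 2 g) {t x : ℝ} (hpos : 0 < W t x) :
    HasDerivAt (fun y => c (W t y) * Q0 f g t y) (nullTermDx c W f g t x) x := by
  have h1 : HasDerivAt c (deriv c (W t x)) (W t x) :=
    ((hc.contDiffAt (Ioi_mem_nhds hpos)).differentiableAt (by norm_num)).hasDerivAt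
  exact (h1.comp x ((hW.of_le (by norm_num)).hasDerivAt_dx t x)).mul (hasDerivAt_Q0 hf hg t x)

theorem continuousOn_nullTermDx (hc : ContDiffOn ℝ 1 c (Ioi 0)) (hW : IsC 2 W) (hf : IsC 2 f)
    (hg : IsC 2 g) {S : Set (ℝ × ℝ)} (hpos : ∀ p ∈ S, 0 < W p.1 p.2) :
    ContinuousOn (fun p : ℝ × ℝ => nullTermDx c W f g p.1 p.2) S := by
  have h1 : ContinuousOn (fun p : ℝ × ℝ => c (W p.1 p.2)) S :=
    hc.continuousOn.comp hW.continuous.continuousOn hpos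
  have h2 : ContinuousOn (fun p : ℝ × ℝ => deriv c (W p.1 p.2)) S :=
    (hc.continuousOn_deriv_of_isOpen isOpen_Ioi le_rfl).comp hW.continuous.continuousOn hpos
  have h3 := hW.dx.continuous.continuousOn (s := S)
  have h1f : IsC 1 f := hf.of_le (by norm_num)
  have h1g : IsC 1 g := hg.of_le (by norm_num)
  have h4 := (isC_Q0 h1f h1g).continuous.continuousOn (s := S)
  have h5 := (isC_Q0 hf.dx h1g).continuous.continuousOn (s := S)
  have h6 := (isC_Q0 h1f hg.dx).continuous.continuousOn (s := S)
  exact ((h2.mul h3).mul h4).add (h1.mul (h5.add h6))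

/-- Bounds for the null derivatives of `f` and of `∂ₓf` at a point. -/
structure NullBound (f : ℝ → ℝ → ℝ) (t x P Q P₁ Q₁ : ℝ) : Prop where
  lbar : |nullLbar f t x| ≤ P
  l : |nullL f t x| ≤ Q
  lbar_dx : |nullLbar (dx f) t x| ≤ P₁
  l_dx : |nullL (dx f) t x| ≤ Q₁

theorem abs_Q0_le {t x P Q P' Q' : ℝ} (h1 : |nullLbar f t x| ≤ P) (h2 : |nullL f t x| ≤ Q)
    (h3 : |nullLbar g t x| ≤ P') (h4 : |nullL g t x| ≤ Q') :
    |Q0 f g t x| ≤ (Q * P' + P * Q') / 2 := by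
  rw [Q0_eq, abs_div, abs_neg, abs_two]
  gcongr
  refine (abs_add_le _ _).trans ?_
  rw [abs_mul, abs_mul]
  have := (abs_nonneg _).trans h1
  have := (abs_nonneg _).trans h2
  gcongr

variable {t x P Q P₁ Q₁ K : ℝ}

theorem abs_nullTerm_le (hc : |c (W t x)| ≤ K) (hf : NullBound f t x P Q P₁ Q₁)
    (hg : NullBound g t x P Q P₁ Q₁) : |c (W t x) * Q0 f g t x| ≤ K * (P * Q) := by
  rw [abs_mul]
  have h := abs_Q0_le hf.lbar hf.l hg.lbar hg.l
  have := (abs_nonneg _).trans hc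
  have e : (Q * P + P * Q) / 2 = P * Q := by ring
  rw [e] at h
  gcongr

theorem abs_nullTermDx_le (hc : |c (W t x)| ≤ K) (hc' : |deriv c (W t x)| ≤ K)
    (hW : NullBound W t x P Q P₁ Q₁) (hf : NullBound f t x P Q P₁ Q₁)
    (hg : NullBound g t x P Q P₁ Q₁) (hPQ : P + Q ≤ 2) (hQ : Q ≤ Q₁) :
    |nullTermDx c W f g t x| ≤ 2 * K * (P * Q₁ + P₁ * Q) := by
  have hK := (abs_nonneg _).trans hc
  have hP0 := (abs_nonneg _).trans hf.lbar
  have hQ0 := (abs_nonneg _).trans hf.l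
  have hP1 := (abs_nonneg _).trans hf.lbar_dx
  -- The derivative falling on the coefficient gives a cubic term; since ∂ₓW = (LW - L̲W)/2 and P +
  -- Q ≤ 2, it reduces to the quadratic one.
  have hWx : |dx W t x| ≤ 1 := by
    have e : dx W t x = (nullL W t x - nullLbar W t x) / 2 := by simp [nullL, nullLbar]
    have h := abs_sub (nullL W t x) (nullLbar W t x)
    rw [e, abs_div, abs_two]
    linarith [hW.lbar, hW.l]
  have h1 : |Q0 f g t x| ≤ P * Q := by
    have h := abs_Q0_le hf.lbar hf.l hg.lbar hg.l
    linarith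
  have h2 := abs_Q0_le hf.lbar_dx hf.l_dx hg.lbar hg.l
  have h3 := abs_Q0_le hf.lbar hf.l hg.lbar_dx hg.l_dx
  have h4 : P * Q ≤ P * Q₁ := by gcongr
  have h5 : 0 ≤ P₁ * Q := by positivity
  calc |nullTermDx c W f g t x|
      ≤ |deriv c (W t x)| * |dx W t x| * |Q0 f g t x| +
        |c (W t x)| * |Q0 (dx f) g t x + Q0 f (dx g) t x| := by
        unfold nullTermDx
        refine (abs_add_le _ _).trans_eq ?_
        simp only [abs_mul]
    _ ≤ K * 1 * (P * Q) + K * (P * Q₁ + P₁ * Q) := by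
        gcongr
        refine (abs_add_le _ _).trans ?_
        linarith
    _ ≤ 2 * K * (P * Q₁ + P₁ * Q) := by nlinarith

end NullTerms

/-! ### Trilinear space-time estimates for the sources. -/

section Sources

variable {η B T : ℝ} {P P₁ Q Q₁ : ℝ → ℝ → ℝ}

/-- The functions `P ≤ P₁` satisfy the decay and flux bounds of size `B` of first and second
derivatives of a solution in the direction `L̲`. -/
structure Controlled (η B T : ℝ) (P P₁ : ℝ → ℝ → ℝ) : Prop where
  cont : IsC 0 P
  cont₁ : IsC 0 P₁
  nonneg : ∀ t x, 0 ≤ P t x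
  le : ∀ t x, P t x ≤ P₁ t x
  sup : ∀ t ∈ Icc 0 T, ∀ x, P t x ≤ B * rho η (uCoord t x)
  flux : ∀ b, fluxPart η P₁ T b ≤ ENNReal.ofReal (B ^ 2)

theorem ubarCoord_sub (τ b : ℝ) : ubarCoord τ (2 * b - τ) = b := by simp [ubarCoord]

theorem integral_rho_nonneg : 0 ≤ ∫ u, rho η u := integral_nonneg fun u => (rho_pos u).le

theorem lintegral_rho (hη : 0 < η) :
    ∫⁻ u, ENNReal.ofReal (rho η u) = ENNReal.ofReal (∫ u, rho η u) :=
  (ofReal_integral_eq_lintegral_ofReal (integrable_rho hη) (ae_of_all _ fun u => (rho_pos u).le)).symm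

@[fun_prop]
theorem continuous_uCoord : Continuous fun p : ℝ × ℝ => uCoord p.1 p.2 := by
  unfold uCoord; fun_prop

@[fun_prop]
theorem continuous_ubarCoord : Continuous fun p : ℝ × ℝ => ubarCoord p.1 p.2 := by
  unfold ubarCoord; fun_prop

/-- The integral of `φ(u) P₁²` with the integrable weight `φ(u̲)^(-1/2)`, by flux bounds. -/
theorem lintegral_rho_mul_sq_le (hη : 0 < η) (h : Controlled η B T P P₁) :
    ∫⁻ τ in Icc 0 T, ∫⁻ x, ENNReal.ofReal (rho η (ubarCoord τ x)) *
      ENNReal.ofReal (weight η (uCoord τ x) * P₁ τ x ^ 2) ≤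
      ENNReal.ofReal (2 * (∫ u, rho η u) * B ^ 2) := by
  have hm1 : Measurable fun p : ℝ × ℝ => ENNReal.ofReal (rho η (ubarCoord p.1 p.2)) :=
    ENNReal.measurable_ofReal.comp (continuous_rho.comp continuous_ubarCoord).measurable
  have hm : Measurable fun p : ℝ × ℝ => ENNReal.ofReal (rho η (ubarCoord p.1 p.2)) *
      ENNReal.ofReal (weight η (uCoord p.1 p.2) * P₁ p.1 p.2 ^ 2) :=
    hm1.mul (measurable_slice_integrand h.cont₁)
  have e := lintegral_strip_eq_ubar (H := fun τ x => ENNReal.ofReal (rho η (ubarCoord τ x)) *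
      ENNReal.ofReal (weight η (uCoord τ x) * P₁ τ x ^ 2)) hm T
  rw [e]
  have h2 : ∀ b, ∫⁻ τ in Icc 0 T, ENNReal.ofReal (rho η (ubarCoord τ (2 * b - τ))) *
      ENNReal.ofReal (weight η (uCoord τ (2 * b - τ)) * P₁ τ (2 * b - τ) ^ 2) ≤
      ENNReal.ofReal (rho η b) * ENNReal.ofReal (B ^ 2) := by
    intro b
    simp only [ubarCoord_sub]
    rw [lintegral_const_mul' _ _ ENNReal.ofReal_ne_top]
    exact mul_le_mul_right (h.flux b) _
  refine (mul_le_mul_right (lintegral_mono h2) 2).trans_eq ?_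
  rw [lintegral_mul_const' _ _ ENNReal.ofReal_ne_top, lintegral_rho hη,
    ENNReal.ofReal_mul (mul_nonneg (by norm_num) integral_rho_nonneg), ENNReal.ofReal_mul (by norm_num), ENNReal.ofReal_ofNat,
    mul_assoc]

theorem source_mono {F F' M M' : ℝ → ℝ → ℝ}
    (hF : ∀ t ∈ Icc 0 T, ∀ x, |F t x| ≤ |F' t x|)
    (hM : ∀ t ∈ Icc 0 T, ∀ x, M t x ≤ M' t x) (hM0 : ∀ t ∈ Icc 0 T, ∀ x, 0 ≤ M t x) :
    source η F M T ≤ source η F' M' T := by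
  refine setLIntegral_mono' measurableSet_Icc fun τ hτ => lintegral_mono fun x => ?_
  refine ENNReal.ofReal_le_ofReal (mul_le_mul_of_nonneg_left ?_ (weight_nonneg _))
  exact mul_le_mul (hF τ hτ x) (hM τ hτ x) (hM0 τ hτ x) (abs_nonneg _)

theorem measurable_source_integrand {F M : ℝ → ℝ → ℝ} (hF : IsC 0 F) (hM : IsC 0 M) :
    Measurable fun p : ℝ × ℝ => ENNReal.ofReal
      (weight η (uCoord p.1 p.2) * (|F p.1 p.2| * M p.1 p.2)) := by
  have h1 := hF.continuous
  have h2 := hM.continuous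
  have h3 := continuous_weight (η := η)
  refine ENNReal.measurable_ofReal.comp (Continuous.measurable ?_)
  fun_prop

theorem source_add {F M M' : ℝ → ℝ → ℝ} (hF : IsC 0 F) (hM : IsC 0 M)
    (h0 : ∀ t x, 0 ≤ M t x) (h0' : ∀ t x, 0 ≤ M' t x) :
    source η F (fun t x => M t x + M' t x) T = source η F M T + source η F M' T := by
  have hm := measurable_source_integrand (η := η) hF hM
  have hm1 : ∀ τ : ℝ, Measurable fun x : ℝ => ENNReal.ofReal
      (weight η (uCoord τ x) * (|F τ x| * M τ x)) := fun τ => by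
    have h := hm.comp (measurable_prodMk_left (x := τ))
    exact h
  have hm2 : Measurable fun τ : ℝ => ∫⁻ x : ℝ, ENNReal.ofReal
      (weight η (uCoord τ x) * (|F τ x| * M τ x)) := hm.lintegral_prod_right'
  rw [source, source, source, ← lintegral_add_left hm2]
  congr 1
  funext τ
  rw [← lintegral_add_left (hm1 τ)]
  congr 1
  funext x
  rw [← ENNReal.ofReal_add (mul_nonneg (weight_nonneg _) (mul_nonneg (abs_nonneg _) (h0 _ _)))
      (mul_nonneg (weight_nonneg _) (mul_nonneg (abs_nonneg _) (h0' _ _)))]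
  ring_nf

theorem source_const_mul {F M : ℝ → ℝ → ℝ} {K : ℝ} (hK : 0 ≤ K) :
    source η F (fun t x => K * M t x) T = ENNReal.ofReal K * source η F M T := by
  rw [source, source, ← lintegral_const_mul' _ _ ENNReal.ofReal_ne_top]
  congr 1
  funext τ
  rw [← lintegral_const_mul' _ _ ENNReal.ofReal_ne_top]
  congr 1
  funext x
  rw [← ENNReal.ofReal_mul hK]
  ring_nf

/-- The source in which the second derivative is in the direction `L̲`. -/
theorem source_top_mul_base_le (hη : 0 < η) (hB : 0 ≤ B) (h : Controlled η B T P P₁)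
    (h' : Controlled η B T (refl Q) (refl Q₁)) :
    source η P₁ (fun t x => P₁ t x * Q t x) T ≤
      ENNReal.ofReal (2 * (∫ u, rho η u) * B ^ 3) := by
  have h2 : source η P₁ (fun t x => P₁ t x * Q t x) T ≤ ENNReal.ofReal B *
      ∫⁻ τ in Icc 0 T, ∫⁻ x, ENNReal.ofReal (rho η (ubarCoord τ x)) *
        ENNReal.ofReal (weight η (uCoord τ x) * P₁ τ x ^ 2) := by
    rw [← lintegral_const_mul' _ _ ENNReal.ofReal_ne_top]
    refine setLIntegral_mono' measurableSet_Icc fun τ hτ => ?_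
    rw [← lintegral_const_mul' _ _ ENNReal.ofReal_ne_top]
    refine lintegral_mono fun x => ?_
    have hr := rho_pos (η := η) (ubarCoord τ x)
    have hw := weight_nonneg (η := η) (uCoord τ x)
    rw [← ENNReal.ofReal_mul hr.le, ← ENNReal.ofReal_mul hB]
    refine ENNReal.ofReal_le_ofReal ?_
    -- The L-derivative decays in u̲, the variable that labels the flux segments of P₁.
    have h3 : Q τ x ≤ B * rho η (ubarCoord τ x) := by
      simpa [refl, uCoord_neg] using h'.sup τ hτ (-x)
    have h4 : 0 ≤ P₁ τ x := (h.nonneg τ x).trans (h.le τ x)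
    rw [abs_of_nonneg h4]
    calc weight η (uCoord τ x) * (P₁ τ x * (P₁ τ x * Q τ x))
        = weight η (uCoord τ x) * P₁ τ x ^ 2 * Q τ x := by ring
      _ ≤ weight η (uCoord τ x) * P₁ τ x ^ 2 * (B * rho η (ubarCoord τ x)) := by gcongr
      _ = _ := by ring
  refine (h2.trans (mul_le_mul_right (lintegral_rho_mul_sq_le hη h) _)).trans_eq ?_
  rw [← ENNReal.ofReal_mul hB]
  ring_nf

/-- The source in which the second derivative is in the direction `L`. The first derivative in the
direction `L̲` is controlled along each integral curve of `L`, with a square integrable bound. -/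
theorem source_base_mul_top_le (hη : 0 < η) (hB : 0 < B) (h : Controlled η B T P P₁)
    (h' : Controlled η B T (refl Q) (refl Q₁)) {N : ℝ → ℝ≥0∞} (hN : Measurable N)
    (hPN : ∀ t ∈ Icc 0 T, ∀ x,
      ENNReal.ofReal (weight η (uCoord t x) * P t x ^ 2) ≤ N (uCoord t x))
    {n : ℝ} (hn : 0 ≤ n) (hNint : ∫⁻ a, N a ≤ ENNReal.ofReal (n * B ^ 2)) :
    source η P₁ (fun t x => P t x * Q₁ t x) T ≤
      ENNReal.ofReal (((∫ u, rho η u) + n) * B ^ 3) := by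
  have hc1 : IsC 0 Q₁ := by simpa using h'.cont₁.refl
  have hm1 : Measurable fun p : ℝ × ℝ => ENNReal.ofReal (rho η (ubarCoord p.1 p.2)) *
      ENNReal.ofReal (weight η (uCoord p.1 p.2) * P₁ p.1 p.2 ^ 2) :=
    (ENNReal.measurable_ofReal.comp (continuous_rho.comp continuous_ubarCoord).measurable).mul
      (measurable_slice_integrand h.cont₁)
  have hm2 : Measurable fun p : ℝ × ℝ => ENNReal.ofReal (weight η (ubarCoord p.1 p.2) *
      Q₁ p.1 p.2 ^ 2) := by
    have h1 := hc1.continuous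
    have h3 := continuous_weight (η := η)
    refine ENNReal.measurable_ofReal.comp (Continuous.measurable ?_)
    fun_prop
  have hm3 : Measurable fun p : ℝ × ℝ => N (uCoord p.1 p.2) * ENNReal.ofReal
      (weight η (ubarCoord p.1 p.2) * Q₁ p.1 p.2 ^ 2) :=
    (hN.comp continuous_uCoord.measurable).mul hm2
  have hB2 : 0 ≤ B / 2 := by positivity
  have hB3 : 0 ≤ (2 * B)⁻¹ := by positivity
  -- Weighted AM–GM separates the flux of P₁ through u̲ = b from the flux of Q₁ through u = a. The
  -- weights B/2 and 1/(2B) make both halves of order B³.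
  have key : source η P₁ (fun t x => P t x * Q₁ t x) T ≤ ENNReal.ofReal (B / 2) *
      (∫⁻ τ in Icc 0 T, ∫⁻ x, ENNReal.ofReal (rho η (ubarCoord τ x)) *
        ENNReal.ofReal (weight η (uCoord τ x) * P₁ τ x ^ 2)) +
      ENNReal.ofReal (2 * B)⁻¹ * (∫⁻ τ in Icc 0 T, ∫⁻ x, N (uCoord τ x) *
        ENNReal.ofReal (weight η (ubarCoord τ x) * Q₁ τ x ^ 2)) := by
    have hm1' : ∀ τ, Measurable fun x : ℝ => ENNReal.ofReal (B / 2) *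
        (ENNReal.ofReal (rho η (ubarCoord τ x)) *
        ENNReal.ofReal (weight η (uCoord τ x) * P₁ τ x ^ 2)) := fun τ => by
      have := hm1.comp (measurable_prodMk_left (x := τ))
      exact Measurable.const_mul this _
    have hm1'' : Measurable fun τ => ∫⁻ x : ℝ, ENNReal.ofReal (B / 2) *
        (ENNReal.ofReal (rho η (ubarCoord τ x)) *
        ENNReal.ofReal (weight η (uCoord τ x) * P₁ τ x ^ 2)) :=
      (hm1.const_mul (ENNReal.ofReal (B / 2))).lintegral_prod_right'
    rw [← lintegral_const_mul' _ _ ENNReal.ofReal_ne_top,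
      ← lintegral_const_mul' _ _ ENNReal.ofReal_ne_top]
    simp_rw [← lintegral_const_mul' _ _ (ENNReal.ofReal_ne_top (r := B / 2)),
      ← lintegral_const_mul' _ _ (ENNReal.ofReal_ne_top (r := (2 * B)⁻¹))]
    rw [← lintegral_add_left hm1'']
    refine setLIntegral_mono' measurableSet_Icc fun τ hτ => ?_
    rw [← lintegral_add_left (hm1' τ)]
    refine lintegral_mono fun x => ?_
    have hr := rho_pos (η := η) (ubarCoord τ x)
    have hw := weight_nonneg (η := η) (uCoord τ x)
    have hw' := weight_nonneg (η := η) (ubarCoord τ x)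
    have hP0 := h.nonneg τ x
    have hP1 : 0 ≤ P₁ τ x := (h.nonneg τ x).trans (h.le τ x)
    refine le_trans ?_ (add_le_add le_rfl (mul_le_mul_right
      (mul_le_mul_left (hPN τ hτ x) (ENNReal.ofReal (weight η (ubarCoord τ x) * Q₁ τ x ^ 2))) _))
    rw [← ENNReal.ofReal_mul hr.le, ← ENNReal.ofReal_mul hB2,
      ← ENNReal.ofReal_mul (by positivity), ← ENNReal.ofReal_mul hB3,
      ← ENNReal.ofReal_add (by positivity) (by positivity)]
    refine ENNReal.ofReal_le_ofReal ?_
    rw [abs_of_nonneg hP1]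
    set r := rho η (ubarCoord τ x)
    set w := weight η (uCoord τ x)
    set w' := weight η (ubarCoord τ x)
    have hrw : 1 ≤ r * w' := inv_rho_le_weight hη _
    have e1 : P₁ τ x * (P τ x * Q₁ τ x) ≤
        B / 2 * (r * P₁ τ x ^ 2) + (2 * B)⁻¹ * (P τ x ^ 2 * (w' * Q₁ τ x ^ 2)) := by
      -- AM–GM after multiplication by 2Br; the missing weight is inserted through 1 ≤ r w'.
      have h5 : r * (2 * B) * (P₁ τ x * (P τ x * Q₁ τ x)) ≤
          (B * r * P₁ τ x) ^ 2 + (P τ x * Q₁ τ x) ^ 2 * (r * w') := by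
        have h6 : (P τ x * Q₁ τ x) ^ 2 ≤ (P τ x * Q₁ τ x) ^ 2 * (r * w') :=
          le_mul_of_one_le_right (sq_nonneg _) hrw
        nlinarith [sq_nonneg (B * r * P₁ τ x - P τ x * Q₁ τ x)]
      have h7 : 0 < r * (2 * B) := by positivity
      refine le_of_mul_le_mul_left (h5.trans_eq ?_) h7
      field_simp
    calc w * (P₁ τ x * (P τ x * Q₁ τ x)) ≤ w * (B / 2 * (r * P₁ τ x ^ 2) +
          (2 * B)⁻¹ * (P τ x ^ 2 * (w' * Q₁ τ x ^ 2))) := by gcongr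
      _ = _ := by ring
  have hI1 := lintegral_rho_mul_sq_le hη h
  have hI2 : ∫⁻ τ in Icc 0 T, ∫⁻ x, N (uCoord τ x) *
      ENNReal.ofReal (weight η (ubarCoord τ x) * Q₁ τ x ^ 2) ≤
      ENNReal.ofReal (2 * (n * B ^ 2) * B ^ 2) := by
    have e := lintegral_strip_eq_u (H := fun τ x => N (uCoord τ x) *
      ENNReal.ofReal (weight η (ubarCoord τ x) * Q₁ τ x ^ 2)) hm3 T
    rw [e]
    have h2 : ∀ a, ∫⁻ τ in Icc 0 T, N (uCoord τ (τ - 2 * a)) *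
        ENNReal.ofReal (weight η (ubarCoord τ (τ - 2 * a)) * Q₁ τ (τ - 2 * a) ^ 2) ≤
        -- On u = a the majorant N is constant and leaves the integral, so the flux of Q₁ remains.
        N a * ENNReal.ofReal (B ^ 2) := by
      intro a
      have hm4 : Measurable fun τ : ℝ =>
          ENNReal.ofReal (weight η (ubarCoord τ (τ - 2 * a)) * Q₁ τ (τ - 2 * a) ^ 2) := by
        have := hm2.comp (by fun_prop : Measurable fun τ : ℝ => (τ, τ - 2 * a))
        exact this
      simp only [uCoord_sub]
      rw [lintegral_const_mul _ hm4]
      refine mul_le_mul_right (le_trans (le_of_eq ?_) (h'.flux a)) _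
      rw [fluxPart]
      congr 1
      funext τ
      have e1 : ubarCoord τ (τ - 2 * a) = uCoord τ (2 * a - τ) := by
        simp only [uCoord, ubarCoord]; ring
      rw [e1, refl, neg_sub]
    refine (mul_le_mul_right (lintegral_mono h2) 2).trans ?_
    rw [lintegral_mul_const' _ _ ENNReal.ofReal_ne_top,
      ENNReal.ofReal_mul (by positivity), ENNReal.ofReal_mul (by norm_num), ENNReal.ofReal_ofNat,
      mul_assoc]
    gcongr
  refine (key.trans (add_le_add (mul_le_mul_right hI1 _) (mul_le_mul_right hI2 _))).trans_eq ?_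
  have hJ := integral_rho_nonneg (η := η)
  rw [← ENNReal.ofReal_mul hB2, ← ENNReal.ofReal_mul hB3,
    ← ENNReal.ofReal_add (by positivity) (by positivity)]
  congr 1
  field_simp

end Sources

/-! ### Consequences of the bootstrap assumptions: decay, fluxes and smallness. -/

section APriori

variable {η A T k : ℝ} {ψ z s : ℝ → ℝ → ℝ}

/-- Energy and flux bounds of size `A` for the `L̲`-derivatives of `ψ` and `∂ₓψ`. -/
structure PartBound (η A T : ℝ) (ψ : ℝ → ℝ → ℝ) : Prop where
  slice : ∀ t ∈ Icc 0 T, slicePart η (nullLbar ψ) t ≤ ENNReal.ofReal (A ^ 2)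
  slice_dx : ∀ t ∈ Icc 0 T, slicePart η (nullLbar (dx ψ)) t ≤ ENNReal.ofReal (A ^ 2)
  flux : ∀ b, fluxPart η (nullLbar ψ) T b ≤ ENNReal.ofReal (A ^ 2)
  flux_dx : ∀ b, fluxPart η (nullLbar (dx ψ)) T b ≤ ENNReal.ofReal (A ^ 2)

theorem refl_nullL (ψ : ℝ → ℝ → ℝ) : refl (nullL ψ) = nullLbar (refl ψ) := by
  funext t x; exact (nullLbar_refl ψ t x).symm

theorem nullLbar_dx_refl_eq (ψ : ℝ → ℝ → ℝ) :
    nullLbar (dx (refl ψ)) = fun t x => -refl (nullL (dx ψ)) t x := by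
  funext t x; exact nullLbar_dx_refl ψ t x

theorem slicePart_neg (F : ℝ → ℝ → ℝ) (t : ℝ) :
    slicePart η (fun t x => -F t x) t = slicePart η F t := by simp [slicePart]

theorem fluxPart_neg (F : ℝ → ℝ → ℝ) (T b : ℝ) :
    fluxPart η (fun t x => -F t x) T b = fluxPart η F T b := by simp [fluxPart]

/-- All terms are nonnegative, so each is bounded by the total; the fluxes are read off at the final
time T. -/
theorem partBound_of_total (hψ : IsC 2 ψ) (hT : 0 ≤ T)
    (h : ∀ t ∈ Icc 0 T, totalEnergy η ψ t + totalFlux η ψ t ≤ ENNReal.ofReal (A ^ 2)) :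
    PartBound η A T ψ ∧ PartBound η A T (refl ψ) := by
  have h1 : IsC 1 ψ := hψ.of_le (by norm_num)
  simp only [totalEnergy, totalFlux, sliceEnergy_eq h1, sliceEnergy_eq hψ.dx, nullFlux_eq] at h
  have hTm : T ∈ Icc 0 T := ⟨hT, le_rfl⟩
  refine ⟨⟨fun t ht => le_trans ?_ (h t ht), fun t ht => le_trans ?_ (h t ht),
    fun b => le_trans ?_ (h T hTm), fun b => le_trans ?_ (h T hTm)⟩,
    ⟨fun t ht => le_trans ?_ (h t ht), fun t ht => le_trans ?_ (h t ht),
    fun b => le_trans ?_ (h T hTm), fun b => le_trans ?_ (h T hTm)⟩⟩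
  · exact le_add_right (le_add_right (le_add_right le_rfl))
  · exact le_add_right (le_add_left (le_add_right le_rfl))
  · exact le_add_left (le_add_right (le_add_right (le_iSup (fluxPart η (nullLbar ψ) T) b)))
  · exact le_add_left (le_add_left (le_add_right (le_iSup (fluxPart η (nullLbar (dx ψ)) T) b)))
  · rw [← refl_nullL]
    exact le_add_right (le_add_right (le_add_left le_rfl))
  · rw [nullLbar_dx_refl_eq, slicePart_neg]
    exact le_add_right (le_add_left (le_add_left le_rfl))
  · rw [← refl_nullL]
    exact le_add_left (le_add_right (le_add_left (le_iSup (fluxPart η (refl (nullL ψ)) T) b)))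
  · rw [nullLbar_dx_refl_eq, fluxPart_neg]
    exact le_add_left (le_add_left (le_add_left (le_iSup (fluxPart η (refl (nullL (dx ψ))) T) b)))

/-- The weighted Sobolev inequality on a time slice. -/
theorem PartBound.abs_nullLbar_le (hη : 0 < η) (hη' : η < 1) (hA : 0 ≤ A) (hψ : IsC 2 ψ)
    (h : PartBound η A T ψ) {t : ℝ} (ht : t ∈ Icc 0 T) (x : ℝ) :
    |nullLbar ψ t x| ≤ 6 * A * rho η (uCoord t x) := by
  refine abs_le_mul_rho (by positivity) ?_
  set f : ℝ → ℝ := fun y => nullLbar ψ t y with hf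
  set g : ℝ → ℝ := fun y => nullLbar (dx ψ) t y with hg
  have hfc : Continuous f := hψ.nullLbar.continuous.comp (by fun_prop : Continuous fun y : ℝ => (t, y))
  have hgc : Continuous g :=
    hψ.dx.nullLbar_zero.continuous.comp (by fun_prop : Continuous fun y : ℝ => (t, y))
  have hd : ∀ y, HasDerivAt f (g y) y := fun y => by
    have h1 := hψ.nullLbar.hasDerivAt_dx t y
    rwa [dx_nullLbar hψ] at h1
  set w : ℝ → ℝ := fun y => weight η (uCoord t y) with hw
  have hwc : Continuous w := by
    have : Continuous fun y : ℝ => uCoord t y := by unfold uCoord; fun_prop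
    exact continuous_weight.comp this
  have hw0 : ∀ y, 0 ≤ w y := fun y => weight_nonneg _
  have hwx : ∀ y ∈ Icc x (x + 1), w x ≤ 9 * w y := fun y hy => by
    refine weight_le_of_abs_sub_le hη hη' ?_
    simp only [uCoord]
    rw [abs_le]
    constructor <;> linarith [hy.1, hy.2]
  -- The value at x is compared with every y in a unit interval and then averaged over y; on that
  -- interval u varies by at most 1/2.
  have hpt : ∀ y ∈ Icc x (x + 1), ENNReal.ofReal (f x ^ 2) ≤ ENNReal.ofReal (f y ^ 2) +
      ∫⁻ r in Icc x (x + 1), ENNReal.ofReal (f r ^ 2 + g r ^ 2) := by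
    intro y hy
    refine (ofReal_sq_le_add_lintegral hy.1 hfc.continuousOn (fun r _ => hd r)
      hgc.continuousOn).2.trans (add_le_add le_rfl ?_)
    refine (lintegral_mono_set (Icc_subset_Icc_right hy.2)).trans (lintegral_mono fun r => ?_)
    refine ENNReal.ofReal_le_ofReal ?_
    nlinarith [sq_nonneg (|f r| - |g r|), sq_abs (f r), sq_abs (g r)]
  have hvol : volume (Icc x (x + 1)) = 1 := by simp
  have h1 : ENNReal.ofReal (f x ^ 2) ≤
      ∫⁻ y in Icc x (x + 1), ENNReal.ofReal (2 * f y ^ 2 + g y ^ 2) := by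
    calc ENNReal.ofReal (f x ^ 2) = ∫⁻ _ in Icc x (x + 1), ENNReal.ofReal (f x ^ 2) := by
          rw [setLIntegral_const, hvol, mul_one]
      _ ≤ ∫⁻ y in Icc x (x + 1), (ENNReal.ofReal (f y ^ 2) +
          ∫⁻ r in Icc x (x + 1), ENNReal.ofReal (f r ^ 2 + g r ^ 2)) :=
          setLIntegral_mono' measurableSet_Icc hpt
      _ = (∫⁻ y in Icc x (x + 1), ENNReal.ofReal (f y ^ 2)) +
          ∫⁻ r in Icc x (x + 1), ENNReal.ofReal (f r ^ 2 + g r ^ 2) := by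
          rw [lintegral_add_right _ measurable_const, setLIntegral_const, hvol, mul_one]
      _ = _ := by
          have hm : Measurable fun y => ENNReal.ofReal (f y ^ 2) :=
            ENNReal.measurable_ofReal.comp (hfc.pow 2).measurable
          rw [← lintegral_add_left hm]
          congr 1
          funext y
          rw [← ENNReal.ofReal_add (sq_nonneg _) (by positivity)]
          ring_nf
  have h2 : ENNReal.ofReal (w x * f x ^ 2) ≤
      18 * slicePart η (nullLbar ψ) t + 9 * slicePart η (nullLbar (dx ψ)) t := by
    have hm : Measurable fun y => ENNReal.ofReal (w y * f y ^ 2) :=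
      ENNReal.measurable_ofReal.comp (hwc.mul (hfc.pow 2)).measurable
    calc ENNReal.ofReal (w x * f x ^ 2)
        ≤ ENNReal.ofReal (w x) * ∫⁻ y in Icc x (x + 1), ENNReal.ofReal (2 * f y ^ 2 + g y ^ 2) := by
          rw [ENNReal.ofReal_mul (hw0 x)]
          exact mul_le_mul_right h1 _
      _ = ∫⁻ y in Icc x (x + 1), ENNReal.ofReal (w x * (2 * f y ^ 2 + g y ^ 2)) := by
          rw [← lintegral_const_mul' _ _ ENNReal.ofReal_ne_top]
          simp only [← ENNReal.ofReal_mul (hw0 x)]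
      _ ≤ ∫⁻ y in Icc x (x + 1), (18 * ENNReal.ofReal (w y * f y ^ 2) +
            9 * ENNReal.ofReal (w y * g y ^ 2)) := by
          refine setLIntegral_mono' measurableSet_Icc fun y hy => ?_
          rw [← ENNReal.ofReal_ofNat 18, ← ENNReal.ofReal_ofNat 9, ← ENNReal.ofReal_mul (by norm_num),
            ← ENNReal.ofReal_mul (by norm_num), ← ENNReal.ofReal_add
              (mul_nonneg (by norm_num) (mul_nonneg (hw0 y) (sq_nonneg _)))
              (mul_nonneg (by norm_num) (mul_nonneg (hw0 y) (sq_nonneg _)))]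
          refine ENNReal.ofReal_le_ofReal ?_
          have := hwx y hy
          calc w x * (2 * f y ^ 2 + g y ^ 2) ≤ 9 * w y * (2 * f y ^ 2 + g y ^ 2) := by gcongr
            _ = _ := by ring
      _ ≤ ∫⁻ y, (18 * ENNReal.ofReal (w y * f y ^ 2) + 9 * ENNReal.ofReal (w y * g y ^ 2)) :=
          setLIntegral_le_lintegral _ _
      _ = _ := by
          rw [lintegral_add_left (hm.const_mul _), lintegral_const_mul' _ _ (by norm_num),
            lintegral_const_mul' _ _ (by norm_num)]
          rfl
  have h3 := h2.trans (add_le_add (mul_le_mul_right (h.slice t ht) 18)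
    (mul_le_mul_right (h.slice_dx t ht) 9))
  rw [← ENNReal.ofReal_ofNat 18, ← ENNReal.ofReal_ofNat 9, ← ENNReal.ofReal_mul (by norm_num),
    ← ENNReal.ofReal_mul (by norm_num), ← ENNReal.ofReal_add (by positivity) (by positivity),
    ENNReal.ofReal_le_ofReal_iff (by positivity)] at h3
  refine h3.trans ?_
  -- The constants add up to 18 + 9 = 27 ≤ 6².
  nlinarith [sq_nonneg A]

/-- The size of the first derivatives in the direction `L̲`: a term `k φ(u)⁻¹` for the soliton, and
the perturbation `(z, s)`. -/
noncomputable def baseBar (η k : ℝ) (z s : ℝ → ℝ → ℝ) : ℝ → ℝ → ℝ := fun t x =>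
  k * rho η (uCoord t x) ^ 2 + |nullLbar z t x| + |nullLbar s t x|

/-- The size of the first and second derivatives in the direction `L̲`. -/
noncomputable def topBar (η k : ℝ) (z s : ℝ → ℝ → ℝ) : ℝ → ℝ → ℝ := fun t x =>
  baseBar η k z s t x + |nullLbar (dx z) t x| + |nullLbar (dx s) t x|

/-- The common bound for the sizes of first and second derivatives. -/
noncomputable def ctrl (η k A : ℝ) : ℝ := 12 * (1 + ∫ u, rho η u) * (k + A)

theorem isC_baseBar (hz : IsC 2 z) (hs : IsC 2 s) : IsC 0 (baseBar η k z s) := by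
  have h1 := hz.nullLbar.continuous
  have h2 := hs.nullLbar.continuous
  have h3 := continuous_rho (η := η)
  refine contDiff_zero.2 ?_
  unfold baseBar
  fun_prop

theorem isC_topBar (hz : IsC 2 z) (hs : IsC 2 s) : IsC 0 (topBar η k z s) := by
  have h0 := (isC_baseBar (η := η) (k := k) hz hs).continuous
  have h1 := hz.dx.nullLbar_zero.continuous
  have h2 := hs.dx.nullLbar_zero.continuous
  refine contDiff_zero.2 ?_
  unfold topBar
  fun_prop

/-- With φ ρ² = 1 the integrand is k² ρ² ≤ k² ρ, which is integrable in u; k ρ² is the size of the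
soliton's null derivatives. -/
theorem lintegral_soliton_flux_le (hη : 0 < η) (b : ℝ) :
    ∫⁻ τ in Icc 0 T, ENNReal.ofReal (weight η (uCoord τ (2 * b - τ)) *
      (k * rho η (uCoord τ (2 * b - τ)) ^ 2) ^ 2) ≤ ENNReal.ofReal (k ^ 2 * ∫ u, rho η u) := by
  have e : ∀ τ : ℝ, uCoord τ (2 * b - τ) = τ - b := fun τ => by simp only [uCoord]; ring
  simp only [e]
  calc _ ≤ ∫⁻ τ, ENNReal.ofReal (weight η (τ - b) * (k * rho η (τ - b) ^ 2) ^ 2) :=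
        setLIntegral_le_lintegral _ _
    _ = ∫⁻ τ, ENNReal.ofReal (weight η τ * (k * rho η τ ^ 2) ^ 2) :=
        lintegral_sub_right_eq_self
          (fun τ => ENNReal.ofReal (weight η τ * (k * rho η τ ^ 2) ^ 2)) b
    _ ≤ ∫⁻ τ, ENNReal.ofReal (k ^ 2) * ENNReal.ofReal (rho η τ) := by
        refine lintegral_mono fun τ => ?_
        rw [← ENNReal.ofReal_mul (sq_nonneg _)]
        refine ENNReal.ofReal_le_ofReal ?_
        have h1 := rho_pos (η := η) τ
        have h2 := rho_le_one hη τ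
        have h3 : rho η τ ^ 2 ≤ rho η τ := by nlinarith
        calc weight η τ * (k * rho η τ ^ 2) ^ 2
            = k ^ 2 * (rho η τ ^ 2 * weight η τ) * rho η τ ^ 2 := by ring
          _ ≤ k ^ 2 * rho η τ := by
            rw [rho_sq_mul_weight, mul_one]; gcongr
    _ = _ := by
        rw [lintegral_const_mul' _ _ ENNReal.ofReal_ne_top, lintegral_rho hη,
          ENNReal.ofReal_mul (sq_nonneg _)]

theorem ctrl_nonneg (hk : 0 ≤ k) (hA : 0 ≤ A) : 0 ≤ ctrl η k A := by
  have := integral_rho_nonneg (η := η)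
  unfold ctrl
  positivity

/-- The pointwise budget: k from the soliton and 6A from each of z and s. -/
theorem le_ctrl (hk : 0 ≤ k) (hA : 0 ≤ A) : k + 12 * A ≤ ctrl η k A := by
  have := integral_rho_nonneg (η := η)
  unfold ctrl
  nlinarith [mul_nonneg this hk, mul_nonneg this hA]

/-- The flux budget: a square of five summands costs a factor 5, with one soliton term and four of
size A². -/
theorem sq_le_ctrl (hk : 0 ≤ k) (hA : 0 ≤ A) :
    5 * (k ^ 2 * ∫ u, rho η u) + 20 * A ^ 2 ≤ ctrl η k A ^ 2 := by
  have hJ := integral_rho_nonneg (η := η)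
  unfold ctrl
  set J := ∫ u, rho η u
  have h1 : k ^ 2 + A ^ 2 ≤ (k + A) ^ 2 := by nlinarith [mul_nonneg hk hA]
  have h2 : 1 + J ≤ (1 + J) ^ 2 := by nlinarith
  calc 5 * (k ^ 2 * J) + 20 * A ^ 2 ≤ 144 * ((1 + J) * (k ^ 2 + A ^ 2)) := by
        nlinarith [mul_nonneg hJ (sq_nonneg k), mul_nonneg hJ (sq_nonneg A), sq_nonneg k,
          sq_nonneg A]
    _ ≤ 144 * ((1 + J) ^ 2 * (k + A) ^ 2) := by gcongr
    _ = _ := by ring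

theorem controlled_baseBar (hη : 0 < η) (hη' : η < 1) (hk : 0 ≤ k) (hA : 0 ≤ A) (hz : IsC 2 z)
    (hs : IsC 2 s) (hbz : PartBound η A T z) (hbs : PartBound η A T s) :
    Controlled η (ctrl η k A) T (baseBar η k z s) (topBar η k z s) where
  cont := isC_baseBar hz hs
  cont₁ := isC_topBar hz hs
  nonneg t x := by
    unfold baseBar
    positivity
  le t x := by
    unfold topBar
    linarith [abs_nonneg (nullLbar (dx z) t x), abs_nonneg (nullLbar (dx s) t x)]
  sup t ht x := by
    have h1 := hbz.abs_nullLbar_le hη hη' hA hz ht x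
    have h2 := hbs.abs_nullLbar_le hη hη' hA hs ht x
    have h3 := rho_pos (η := η) (uCoord t x)
    have h4 := rho_le_one hη (uCoord t x)
    have h5 : rho η (uCoord t x) ^ 2 ≤ rho η (uCoord t x) := by nlinarith
    calc baseBar η k z s t x ≤ (k + 12 * A) * rho η (uCoord t x) := by
          unfold baseBar
          nlinarith [mul_le_mul_of_nonneg_left h5 hk]
      _ ≤ _ := mul_le_mul_of_nonneg_right (le_ctrl hk hA) h3.le
  flux b := by
    have hm : ∀ {F : ℝ → ℝ → ℝ}, IsC 0 F → Measurable fun τ : ℝ => 5 * ENNReal.ofReal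
        (weight η (uCoord τ (2 * b - τ)) * F τ (2 * b - τ) ^ 2) := fun hF => by
      have h := (measurable_slice_integrand (η := η) hF).comp
        (by fun_prop : Measurable fun τ : ℝ => (τ, 2 * b - τ))
      exact Measurable.const_mul h _
    have hsol : IsC 0 fun t x => k * rho η (uCoord t x) ^ 2 := by
      have h3 := continuous_rho (η := η)
      refine contDiff_zero.2 ?_
      fun_prop
    have hpt : fluxPart η (topBar η k z s) T b ≤ ∫⁻ τ in Icc 0 T,
        (5 * ENNReal.ofReal (weight η (uCoord τ (2 * b - τ)) *
          (k * rho η (uCoord τ (2 * b - τ)) ^ 2) ^ 2) +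
        (5 * ENNReal.ofReal (weight η (uCoord τ (2 * b - τ)) * nullLbar z τ (2 * b - τ) ^ 2) +
        (5 * ENNReal.ofReal (weight η (uCoord τ (2 * b - τ)) * nullLbar s τ (2 * b - τ) ^ 2) +
        (5 * ENNReal.ofReal (weight η (uCoord τ (2 * b - τ)) * nullLbar (dx z) τ (2 * b - τ) ^ 2) +
        5 * ENNReal.ofReal
          (weight η (uCoord τ (2 * b - τ)) * nullLbar (dx s) τ (2 * b - τ) ^ 2))))) := by
      refine lintegral_mono fun τ => ?_
      generalize 2 * b - τ = x
      have hw := weight_nonneg (η := η) (uCoord τ x)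
      simp only [← ENNReal.ofReal_ofNat 5, ← ENNReal.ofReal_mul (Nat.ofNat_nonneg 5)]
      rw [← ENNReal.ofReal_add (by positivity) (by positivity),
        ← ENNReal.ofReal_add (by positivity) (by positivity),
        ← ENNReal.ofReal_add (by positivity) (by positivity),
        ← ENNReal.ofReal_add (by positivity) (by positivity)]
      refine ENNReal.ofReal_le_ofReal ?_
      unfold topBar baseBar
      rw [← sq_abs (nullLbar z τ x), ← sq_abs (nullLbar s τ x), ← sq_abs (nullLbar (dx z) τ x),
        ← sq_abs (nullLbar (dx s) τ x)]
      generalize k * rho η (uCoord τ x) ^ 2 = a1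
      generalize |nullLbar z τ x| = a2
      generalize |nullLbar s τ x| = a3
      generalize |nullLbar (dx z) τ x| = a4
      generalize |nullLbar (dx s) τ x| = a5
      have h5 : (a1 + a2 + a3 + a4 + a5) ^ 2 ≤
          5 * (a1 ^ 2 + a2 ^ 2 + a3 ^ 2 + a4 ^ 2 + a5 ^ 2) := by
        nlinarith [sq_nonneg (a1 - a2), sq_nonneg (a1 - a3), sq_nonneg (a1 - a4),
          sq_nonneg (a1 - a5), sq_nonneg (a2 - a3), sq_nonneg (a2 - a4), sq_nonneg (a2 - a5),
          sq_nonneg (a3 - a4), sq_nonneg (a3 - a5), sq_nonneg (a4 - a5)]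
      refine (mul_le_mul_of_nonneg_left h5 hw).trans_eq ?_
      ring
    rw [lintegral_add_left (hm hsol), lintegral_add_left (hm (hz.nullLbar.of_le (by norm_num))),
      lintegral_add_left (hm (hs.nullLbar.of_le (by norm_num))), lintegral_add_left (hm hz.dx.nullLbar_zero),
      lintegral_const_mul' _ _ (by norm_num), lintegral_const_mul' _ _ (by norm_num),
      lintegral_const_mul' _ _ (by norm_num), lintegral_const_mul' _ _ (by norm_num),
      lintegral_const_mul' _ _ (by norm_num)] at hpt
    have h6 := hpt.trans (add_le_add (mul_le_mul_right (lintegral_soliton_flux_le hη b) 5)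
      (add_le_add (mul_le_mul_right (hbz.flux b) 5) (add_le_add (mul_le_mul_right (hbs.flux b) 5)
        (add_le_add (mul_le_mul_right (hbz.flux_dx b) 5) (mul_le_mul_right (hbs.flux_dx b) 5)))))
    refine h6.trans ?_
    have hJ := integral_rho_nonneg (η := η)
    simp only [← ENNReal.ofReal_ofNat 5, ← ENNReal.ofReal_mul (Nat.ofNat_nonneg 5)]
    rw [← ENNReal.ofReal_add (by positivity) (by positivity),
        ← ENNReal.ofReal_add (by positivity) (by positivity),
        ← ENNReal.ofReal_add (by positivity) (by positivity),
        ← ENNReal.ofReal_add (by positivity) (by positivity)]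
    refine ENNReal.ofReal_le_ofReal (le_trans (le_of_eq ?_) (sq_le_ctrl (η := η) hk hA))
    ring

/-- A perturbation with compactly supported initial position is small. -/
theorem abs_le_of_partBound (hη : 0 < η) (hη' : η < 1) (hA : 0 ≤ A) (hT : 0 ≤ T) (hz : IsC 2 z)
    (h0 : HasCompactSupport (z 0)) (hb : PartBound η A T z) (hb' : PartBound η A T (refl z))
    {t : ℝ} (ht : t ∈ Icc 0 T) (x : ℝ) : |z t x| ≤ 20 * A * ∫ u, rho η u := by
  have hJ := integral_rho_nonneg (η := η)
  have hr := integrable_rho hη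
  have h1z : IsC 1 z := hz.of_le (by norm_num)
  -- Descend to time 0 along L̲, where u̲ is constant and u = τ - (x + t)/2 runs at unit speed, so
  -- the decay of L̲z is integrable.
  have e1 : |z t x - z 0 (x + t)| ≤ 6 * A * ∫ u, rho η u := by
    have hd : ∀ τ, HasDerivAt (fun τ => z τ (x + t - τ)) (nullLbar z τ (x + t - τ)) τ := fun τ => by
      have := h1z.hasDerivAt_curve (hasDerivAt_id τ) ((hasDerivAt_id τ).const_sub (x + t))
      refine this.congr_deriv ?_
      simp only [nullLbar, id]; ring
    have hc : Continuous fun τ => nullLbar z τ (x + t - τ) :=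
      hz.nullLbar.continuous.comp (by fun_prop : Continuous fun τ : ℝ => (τ, x + t - τ))
    have hi := intervalIntegral.integral_eq_sub_of_hasDerivAt (a := 0) (b := t)
      (fun τ _ => hd τ) (hc.intervalIntegrable _ _)
    simp only [add_sub_cancel_right, sub_zero] at hi
    rw [← hi]
    have hr1 : Integrable fun τ : ℝ => 6 * A * rho η (τ - (x + t) / 2) :=
      (hr.comp_sub_right ((x + t) / 2)).const_mul _
    rw [← Real.norm_eq_abs]
    calc ‖∫ τ in (0)..t, nullLbar z τ (x + t - τ)‖
        ≤ ∫ τ in (0)..t, 6 * A * rho η (τ - (x + t) / 2) := by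
          refine intervalIntegral.norm_integral_le_of_norm_le ht.1 (ae_of_all _ fun τ hτ => ?_)
            hr1.intervalIntegrable
          have h2 := hb.abs_nullLbar_le hη hη' hA hz (t := τ) ⟨hτ.1.le, hτ.2.trans ht.2⟩ (x + t - τ)
          have e : uCoord τ (x + t - τ) = τ - (x + t) / 2 := by simp only [uCoord]; ring
          rwa [e] at h2
      _ ≤ ∫ τ, 6 * A * rho η (τ - (x + t) / 2) := by
          rw [intervalIntegral.integral_of_le ht.1]
          exact setIntegral_le_integral hr1 (ae_of_all _ fun τ =>
            mul_nonneg (by positivity) (rho_pos _).le)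
      _ = 6 * A * ∫ u, rho η u := by
          rw [integral_const_mul, integral_sub_right_eq_self (fun u => rho η u)]
  have e2 : ∀ y, |z 0 y| ≤ 12 * A * ∫ u, rho η u := by
    intro y
    have hm0 : (0 : ℝ) ∈ Icc 0 T := ⟨le_rfl, hT⟩
    -- At t = 0 one has u = -r/2 and u̲ = r/2, so both null derivatives decay at the same rate.
    have hdx : ∀ r, |dx z 0 r| ≤ 6 * A * rho η (2⁻¹ * r) := fun r => by
      have h2 := hb.abs_nullLbar_le hη hη' hA hz hm0 r
      have h3 := hb'.abs_nullLbar_le hη hη' hA hz.refl hm0 (-r)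
      rw [nullLbar_refl, neg_neg] at h3
      have e3 : uCoord 0 r = -(2⁻¹ * r) := by simp only [uCoord]; ring
      have e4 : uCoord 0 (-r) = 2⁻¹ * r := by simp only [uCoord]; ring
      rw [e3, rho_neg] at h2
      rw [e4] at h3
      have e : dx z 0 r = (nullL z 0 r - nullLbar z 0 r) / 2 := by simp [nullL, nullLbar]
      have h4 := abs_sub (nullL z 0 r) (nullLbar z 0 r)
      rw [e, abs_div, abs_two]
      linarith
    have hr1 : Integrable fun r : ℝ => 6 * A * rho η (2⁻¹ * r) :=
      (hr.comp_mul_left' (by norm_num)).const_mul _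
    obtain ⟨R, hR⟩ := h0.isCompact.isBounded.subset_closedBall 0
    -- A point to the right of y and outside the support of the initial position.
    set Y := max y (R + 1) with hY
    have hzY : z 0 Y = 0 := by
      by_contra hne
      have h5 := hR (subset_tsupport _ hne)
      rw [Metric.mem_closedBall, dist_zero_right, Real.norm_eq_abs] at h5
      linarith [le_abs_self Y, le_max_right y (R + 1)]
    have hc : Continuous fun r => dx z 0 r :=
      hz.dx.continuous.comp (by fun_prop : Continuous fun r : ℝ => ((0 : ℝ), r))
    have hi := intervalIntegral.integral_eq_sub_of_hasDerivAt (a := y) (b := Y)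
      (fun r _ => h1z.hasDerivAt_dx 0 r) (hc.intervalIntegrable _ _)
    rw [hzY, zero_sub] at hi
    rw [← abs_neg, ← hi, ← Real.norm_eq_abs]
    have hyY : y ≤ Y := le_max_left _ _
    calc ‖∫ r in y..Y, dx z 0 r‖ ≤ ∫ r in y..Y, 6 * A * rho η (2⁻¹ * r) :=
          intervalIntegral.norm_integral_le_of_norm_le hyY (ae_of_all _ fun r _ => hdx r)
            hr1.intervalIntegrable
      _ ≤ ∫ r, 6 * A * rho η (2⁻¹ * r) := by
          rw [intervalIntegral.integral_of_le hyY]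
          exact setIntegral_le_integral hr1 (ae_of_all _ fun τ =>
            mul_nonneg (by positivity) (rho_pos _).le)
      _ = 12 * A * ∫ u, rho η u := by
          rw [integral_const_mul, Measure.integral_comp_mul_left (rho η)]
          simp
          ring
  have h6 := abs_sub_abs_le_abs_sub (z t x) (z 0 (x + t))
  have h7 := e2 (x + t)
  have h8 : 0 ≤ A * ∫ u, rho η u := mul_nonneg hA hJ
  linarith

end APriori

/-! ### Square integrable characteristic bounds and the closed energy estimate. -/

section Closing

variable {η A B T k K : ℝ} {ψ z s : ℝ → ℝ → ℝ}

theorem measurable_charBound {F M : ℝ → ℝ → ℝ} (hF : IsC 0 F) (hM : IsC 0 M) :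
    Measurable (charBound η F M T) := by
  have h1 := hF.continuous
  have h2 := hM.continuous
  have h3 := continuous_weight (η := η)
  have hm : Measurable fun a : ℝ => ENNReal.ofReal (weight η a * F 0 (-(2 * a)) ^ 2) := by
    refine ENNReal.measurable_ofReal.comp (Continuous.measurable ?_)
    have : Continuous fun a : ℝ => F 0 (-(2 * a)) :=
      h1.comp (f := fun a : ℝ => ((0 : ℝ), -(2 * a))) (by fun_prop)
    fun_prop
  refine hm.add ?_
  have hm2 : Measurable fun p : ℝ × ℝ => ENNReal.ofReal
      (weight η p.1 * (2 * (|F p.2 (p.2 - 2 * p.1)| * M p.2 (p.2 - 2 * p.1)))) := by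
    refine ENNReal.measurable_ofReal.comp (Continuous.measurable ?_)
    have h4 : Continuous fun p : ℝ × ℝ => F p.2 (p.2 - 2 * p.1) :=
      h1.comp (f := fun p : ℝ × ℝ => (p.2, p.2 - 2 * p.1)) (by fun_prop)
    have h5 : Continuous fun p : ℝ × ℝ => M p.2 (p.2 - 2 * p.1) :=
      h2.comp (f := fun p : ℝ × ℝ => (p.2, p.2 - 2 * p.1)) (by fun_prop)
    fun_prop
  exact hm2.lintegral_prod_right'

/-- The constant in the square integrable bound for first derivatives. -/
noncomputable def charConst (η K : ℝ) : ℝ := 9 + 24 * (K * ∫ u, rho η u)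

theorem charConst_nonneg (hK : 0 ≤ K) : 0 ≤ charConst η K := by
  have := integral_rho_nonneg (η := η)
  unfold charConst
  positivity

variable {Q Q₁ : ℝ → ℝ → ℝ}

/-- For first derivatives the source contains only P Q, and |L̲ψ| ≤ P ≤ P₁ reduces it to the easier
trilinear integral. Thus the majorant is obtained without circularity. -/
theorem lintegral_charBound_le (hη : 0 < η) (hB : 0 ≤ B) (hB1 : B ≤ 1) (hA : A ^ 2 ≤ B ^ 2)
    (hK : 0 ≤ K) {P P₁ : ℝ → ℝ → ℝ} (h : Controlled η B T P P₁)
    (h' : Controlled η B T (refl Q) (refl Q₁)) (hψ : IsC 2 ψ) (hT : 0 ≤ T)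
    (hb : PartBound η A T ψ) (hP : ∀ t x, |nullLbar ψ t x| ≤ P t x) :
    ∫⁻ a, charBound η (nullLbar ψ) (fun t x => K * (P t x * Q t x)) T a ≤
      ENNReal.ofReal ((1 + 4 * (K * ∫ u, rho η u)) * B ^ 2) := by
  have hJ := integral_rho_nonneg (η := η)
  have hQc : IsC 0 Q := by simpa using h'.cont.refl
  have hM : IsC 0 fun t x => K * (P t x * Q t x) := by
    have h1 := h.cont.continuous
    have h2 := hQc.continuous
    refine contDiff_zero.2 ?_
    fun_prop
  have hQ0 : ∀ t x, 0 ≤ Q t x := fun t x => by simpa [refl] using h'.nonneg t (-x)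
  have h1 : source η (nullLbar ψ) (fun t x => K * (P t x * Q t x)) T ≤
      ENNReal.ofReal (K * (2 * (∫ u, rho η u) * B ^ 3)) := by
    rw [ENNReal.ofReal_mul hK]
    refine le_trans ?_ (mul_le_mul_right (source_top_mul_base_le hη hB h h') _)
    rw [← source_const_mul hK]
    refine source_mono (fun t _ x => ?_) (fun t _ x => ?_) (fun t _ x => ?_)
    · exact ((hP t x).trans (h.le t x)).trans (le_abs_self _)
    · have := h.le t x
      have := hQ0 t x
      gcongr
    · have := h.nonneg t x
      have := hQ0 t x
      positivity
  have h2 := two_mul_lintegral_charBound (η := η) (T := T) (hψ.nullLbar.of_le (by norm_num)) hM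
  calc _ ≤ 2 * ∫⁻ a, charBound η (nullLbar ψ) (fun t x => K * (P t x * Q t x)) T a := by
        rw [two_mul]; exact le_self_add
    _ ≤ ENNReal.ofReal (A ^ 2) + 2 * ENNReal.ofReal (K * (2 * (∫ u, rho η u) * B ^ 3)) := by
        rw [h2]
        exact add_le_add (hb.slice 0 ⟨le_rfl, hT⟩) (mul_le_mul_right h1 2)
    _ = ENNReal.ofReal (A ^ 2 + 2 * (K * (2 * (∫ u, rho η u) * B ^ 3))) := by
        rw [← ENNReal.ofReal_ofNat 2, ← ENNReal.ofReal_mul (by norm_num),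
          ← ENNReal.ofReal_add (by positivity) (by positivity)]
    _ ≤ _ := by
        refine ENNReal.ofReal_le_ofReal ?_
        have h3 : B ^ 3 ≤ B ^ 2 := pow_le_pow_of_le_one hB hB1 (by norm_num)
        have h4 : 0 ≤ K * ∫ u, rho η u := mul_nonneg hK hJ
        nlinarith [mul_le_mul_of_nonneg_left h3 h4]

/-- The first derivatives in the direction `L̲` are bounded along each integral curve of `L`, with a
square integrable bound. -/
theorem exists_charBound (hη : 0 < η) (hk : 0 ≤ k) (hA : 0 ≤ A) (hB1 : ctrl η k A ≤ 1)
    (hK : 0 ≤ K) (hz : IsC 2 z) (hs : IsC 2 s) (hT : 0 ≤ T)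
    (hbz : PartBound η A T z) (hbs : PartBound η A T s)
    (h : Controlled η (ctrl η k A) T (baseBar η k z s) (topBar η k z s))
    (h' : Controlled η (ctrl η k A) T (refl Q) (refl Q₁))
    (htz : Transport (nullLbar z) (fun t x => K * (baseBar η k z s t x * Q t x)) T)
    (hts : Transport (nullLbar s) (fun t x => K * (baseBar η k z s t x * Q t x)) T) :
    ∃ N : ℝ → ℝ≥0∞, Measurable N ∧ (∀ t ∈ Icc 0 T, ∀ x,
      ENNReal.ofReal (weight η (uCoord t x) * baseBar η k z s t x ^ 2) ≤ N (uCoord t x)) ∧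
      ∫⁻ a, N a ≤ ENNReal.ofReal (charConst η K * ctrl η k A ^ 2) := by
  have hJ := integral_rho_nonneg (η := η)
  have hB := ctrl_nonneg (η := η) hk hA
  have hsq := sq_le_ctrl (η := η) hk hA
  have hQc : IsC 0 Q := by simpa using h'.cont.refl
  have hM : IsC 0 fun t x => K * (baseBar η k z s t x * Q t x) := by
    have h1 := h.cont.continuous
    have h2 := hQc.continuous
    refine contDiff_zero.2 ?_
    fun_prop
  set M : ℝ → ℝ → ℝ := fun t x => K * (baseBar η k z s t x * Q t x)
  have hm0 : Measurable fun a => 3 * ENNReal.ofReal (k ^ 2 * rho η a ^ 2) := by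
    refine (ENNReal.measurable_ofReal.comp (Continuous.measurable ?_)).const_mul _
    have := continuous_rho (η := η)
    fun_prop
  have hmz : Measurable fun a => 3 * charBound η (nullLbar z) M T a :=
    (measurable_charBound (hz.nullLbar.of_le (by norm_num)) hM).const_mul _
  have hms : Measurable fun a => 3 * charBound η (nullLbar s) M T a :=
    (measurable_charBound (hs.nullLbar.of_le (by norm_num)) hM).const_mul _
  -- The factor 3 is from the square of a three-term sum. Its integral is at most 3 + 2 · 3(1 + 4KJ)
  -- = 9 + 24KJ times the squared control constant, J being the integral of ρ.
  refine ⟨fun a => 3 * ENNReal.ofReal (k ^ 2 * rho η a ^ 2) +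
    (3 * charBound η (nullLbar z) M T a + 3 * charBound η (nullLbar s) M T a),
    hm0.add (hmz.add hms), fun t ht x => ?_, ?_⟩
  · refine le_trans ?_ (add_le_add le_rfl (add_le_add
      (mul_le_mul_right (htz.le_charBound' ht x) 3) (mul_le_mul_right (hts.le_charBound' ht x) 3)))
    have hw := weight_nonneg (η := η) (uCoord t x)
    simp only [← ENNReal.ofReal_ofNat 3, ← ENNReal.ofReal_mul (Nat.ofNat_nonneg 3)]
    rw [← ENNReal.ofReal_add (by positivity) (by positivity),
        ← ENNReal.ofReal_add (by positivity) (by positivity)]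
    refine ENNReal.ofReal_le_ofReal ?_
    have e : k ^ 2 * rho η (uCoord t x) ^ 2 =
        weight η (uCoord t x) * (k * rho η (uCoord t x) ^ 2) ^ 2 := by
      calc k ^ 2 * rho η (uCoord t x) ^ 2 =
          k ^ 2 * rho η (uCoord t x) ^ 2 * (rho η (uCoord t x) ^ 2 * weight η (uCoord t x)) := by
            rw [rho_sq_mul_weight, mul_one]
        _ = _ := by ring
    rw [e]
    unfold baseBar
    rw [← sq_abs (nullLbar z t x), ← sq_abs (nullLbar s t x)]
    generalize k * rho η (uCoord t x) ^ 2 = a1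
    generalize |nullLbar z t x| = a2
    generalize |nullLbar s t x| = a3
    have h5 : (a1 + a2 + a3) ^ 2 ≤ 3 * (a1 ^ 2 + a2 ^ 2 + a3 ^ 2) := by
      nlinarith [sq_nonneg (a1 - a2), sq_nonneg (a1 - a3), sq_nonneg (a2 - a3)]
    refine (mul_le_mul_of_nonneg_left h5 hw).trans_eq ?_
    ring
  · have hA2 : A ^ 2 ≤ ctrl η k A ^ 2 := by nlinarith [mul_nonneg (sq_nonneg k) hJ, sq_nonneg A]
    have hPz : ∀ t x, |nullLbar z t x| ≤ baseBar η k z s t x := fun t x => by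
      have : 0 ≤ k * rho η (uCoord t x) ^ 2 := by positivity
      unfold baseBar
      linarith [abs_nonneg (nullLbar s t x)]
    have hPs : ∀ t x, |nullLbar s t x| ≤ baseBar η k z s t x := fun t x => by
      have : 0 ≤ k * rho η (uCoord t x) ^ 2 := by positivity
      unfold baseBar
      linarith [abs_nonneg (nullLbar z t x)]
    have h1 := lintegral_charBound_le hη hB hB1 hA2 hK h h' hz hT hbz hPz
    have h2 := lintegral_charBound_le hη hB hB1 hA2 hK h h' hs hT hbs hPs
    have h3 : ∫⁻ a, ENNReal.ofReal (k ^ 2 * rho η a ^ 2) ≤ ENNReal.ofReal (ctrl η k A ^ 2) := by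
      calc _ ≤ ∫⁻ a, ENNReal.ofReal (k ^ 2) * ENNReal.ofReal (rho η a) := by
            refine lintegral_mono fun a => ?_
            rw [← ENNReal.ofReal_mul (sq_nonneg _)]
            refine ENNReal.ofReal_le_ofReal (mul_le_mul_of_nonneg_left ?_ (sq_nonneg _))
            nlinarith [rho_pos (η := η) a, rho_le_one hη a]
        _ = ENNReal.ofReal (k ^ 2 * ∫ u, rho η u) := by
            rw [lintegral_const_mul' _ _ ENNReal.ofReal_ne_top, lintegral_rho hη,
              ENNReal.ofReal_mul (sq_nonneg _)]
        _ ≤ _ := ENNReal.ofReal_le_ofReal (by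
            nlinarith [mul_nonneg (sq_nonneg k) hJ, sq_nonneg A])
    rw [lintegral_add_left hm0, lintegral_add_left hmz, lintegral_const_mul' _ _ (by norm_num),
      lintegral_const_mul' _ _ (by norm_num), lintegral_const_mul' _ _ (by norm_num)]
    refine (add_le_add (mul_le_mul_right h3 3) (add_le_add (mul_le_mul_right h1 3)
      (mul_le_mul_right h2 3))).trans_eq ?_
    simp only [← ENNReal.ofReal_ofNat 3, ← ENNReal.ofReal_mul (Nat.ofNat_nonneg 3)]
    rw [← ENNReal.ofReal_add (by positivity) (by positivity),
        ← ENNReal.ofReal_add (by positivity) (by positivity)]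
    congr 1
    unfold charConst
    ring

/-- `□ψ` is bounded by `M₀`, and it has a continuous `x`-derivative bounded by `M` in the strip. -/
structure BoxBound (ψ M₀ M : ℝ → ℝ → ℝ) (T : ℝ) : Prop where
  base : ∀ t ∈ Icc 0 T, ∀ x, |box ψ t x| ≤ M₀ t x
  top : ∃ R' : ℝ → ℝ → ℝ, (∀ t ∈ Icc 0 T, ∀ x, HasDerivAt (fun y => box ψ t y) (R' t x) x) ∧
    ContinuousOn (fun p : ℝ × ℝ => R' p.1 p.2) (Icc 0 T ×ˢ univ) ∧
    ∀ t ∈ Icc 0 T, ∀ x, |R' t x| ≤ M t x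

/-- The size of the first derivatives in the direction `L`. -/
noncomputable def base (η k : ℝ) (z s : ℝ → ℝ → ℝ) : ℝ → ℝ → ℝ :=
  refl (baseBar η k (refl z) (refl s))

/-- The size of the first and second derivatives in the direction `L`. -/
noncomputable def top (η k : ℝ) (z s : ℝ → ℝ → ℝ) : ℝ → ℝ → ℝ :=
  refl (topBar η k (refl z) (refl s))

/-- The bound for the nonlinearity. -/
noncomputable def nonlin₀ (η k K : ℝ) (z s : ℝ → ℝ → ℝ) : ℝ → ℝ → ℝ := fun t x =>
  K * (baseBar η k z s t x * base η k z s t x)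

/-- The bound for the `x`-derivative of the nonlinearity. -/
noncomputable def nonlin (η k K : ℝ) (z s : ℝ → ℝ → ℝ) : ℝ → ℝ → ℝ := fun t x =>
  K * (baseBar η k z s t x * top η k z s t x + topBar η k z s t x * base η k z s t x)

/-- The bound is symmetric in L and L̲, so the L-estimates for (z, s) are the L̲-estimates for the
reflected pair. -/
theorem refl_nonlin₀ : refl (nonlin₀ η k K z s) = nonlin₀ η k K (refl z) (refl s) := by
  funext t x
  change nonlin₀ η k K z s t (-x) = _
  simp only [nonlin₀, base, refl_refl]
  simp only [refl, neg_neg]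
  ring

theorem refl_nonlin : refl (nonlin η k K z s) = nonlin η k K (refl z) (refl s) := by
  funext t x
  change nonlin η k K z s t (-x) = _
  simp only [nonlin, base, top, refl_refl]
  simp only [refl, neg_neg]
  ring

/-- The cubic estimate. The multiplier `topBar` dominates the L̲-derivatives of z, s, ∂ₓz and ∂ₓs at
once, so one bound serves all four energy identities. -/
theorem source_nonlin_le (hη : 0 < η) (hη' : η < 1) (hk : 0 ≤ k) (hA : 0 ≤ A)
    (hB0 : 0 < ctrl η k A) (hB1 : ctrl η k A ≤ 1)
    (hK : 0 ≤ K) (hz : IsC 2 z) (hs : IsC 2 s) (hT : 0 ≤ T)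
    (hbz : PartBound η A T z) (hbs : PartBound η A T s)
    (hbz' : PartBound η A T (refl z)) (hbs' : PartBound η A T (refl s))
    (htz : Transport (nullLbar z) (nonlin₀ η k K z s) T)
    (hts : Transport (nullLbar s) (nonlin₀ η k K z s) T) :
    source η (topBar η k z s) (nonlin η k K z s) T ≤
      ENNReal.ofReal (K * ((3 * (∫ u, rho η u) + charConst η K) * ctrl η k A ^ 3)) := by
  have hJ := integral_rho_nonneg (η := η)
  have hn := charConst_nonneg (η := η) hK
  have h := controlled_baseBar hη hη' hk hA hz hs hbz hbs
  have h' : Controlled η (ctrl η k A) T (refl (base η k z s)) (refl (top η k z s)) := by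
    simpa [base, top] using controlled_baseBar hη hη' hk hA hz.refl hs.refl hbz' hbs'
  obtain ⟨N, hN, hPN, hNint⟩ := exists_charBound hη hk hA hB1 hK hz hs hT hbz hbs h h' htz hts
  have h1 := source_base_mul_top_le hη hB0 h h' hN hPN hn hNint
  have h2 := source_top_mul_base_le hη hB0.le h h'
  have hb0 : ∀ t x, 0 ≤ base η k z s t x := fun t x => by simpa [refl] using h'.nonneg t (-x)
  have ht0 : ∀ t x, 0 ≤ top η k z s t x := fun t x =>
    (hb0 t x).trans (by simpa [refl] using h'.le t (-x))
  have hc : IsC 0 fun t x => baseBar η k z s t x * top η k z s t x := by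
    have h3 := h.cont.continuous
    have h4 : Continuous fun p : ℝ × ℝ => top η k z s p.1 p.2 := by
      have := h'.cont₁.refl.continuous
      simpa using this
    refine contDiff_zero.2 ?_
    fun_prop
  have e : source η (topBar η k z s) (nonlin η k K z s) T = ENNReal.ofReal K *
      (source η (topBar η k z s) (fun t x => baseBar η k z s t x * top η k z s t x) T +
        source η (topBar η k z s) (fun t x => topBar η k z s t x * base η k z s t x) T) := by
    rw [← source_add h.cont₁ hc (fun t x => mul_nonneg (h.nonneg t x) (ht0 t x))
      (fun t x => mul_nonneg ((h.nonneg t x).trans (h.le t x)) (hb0 t x)), ← source_const_mul hK]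
    rfl
  rw [e, ENNReal.ofReal_mul hK]
  refine mul_le_mul_right ((add_le_add h1 h2).trans_eq ?_) _
  rw [← ENNReal.ofReal_add (by positivity) (by positivity)]
  ring_nf

theorem abs_le_topBar (hk : 0 ≤ k) (t x : ℝ) :
    (|nullLbar z t x| ≤ |topBar η k z s t x| ∧ |nullLbar (dx z) t x| ≤ |topBar η k z s t x|) ∧
    (|nullLbar s t x| ≤ |topBar η k z s t x| ∧ |nullLbar (dx s) t x| ≤ |topBar η k z s t x|) := by
  have h0 : 0 ≤ k * rho η (uCoord t x) ^ 2 := by positivity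
  have h1 := abs_nonneg (nullLbar z t x)
  have h2 := abs_nonneg (nullLbar s t x)
  have h3 := abs_nonneg (nullLbar (dx z) t x)
  have h4 := abs_nonneg (nullLbar (dx s) t x)
  have h5 := le_abs_self (topBar η k z s t x)
  have h6 : topBar η k z s t x = k * rho η (uCoord t x) ^ 2 + |nullLbar z t x| + |nullLbar s t x|
    + |nullLbar (dx z) t x| + |nullLbar (dx s) t x| := rfl
  refine ⟨⟨?_, ?_⟩, ?_, ?_⟩ <;> linarith

/-- The energy estimate for one component of the perturbation. -/
theorem total_le_of_source_le (hψ : IsC 2 ψ) {M₀ M G G' : ℝ → ℝ → ℝ} {S : ℝ≥0∞} (hM : IsC 0 M)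
    (hMM : ∀ t x, M₀ t x ≤ M t x) (hM0 : ∀ t x, 0 ≤ M t x) (hbox : BoxBound ψ M₀ M T)
    (hG : ∀ t x, |nullLbar ψ t x| ≤ |G t x| ∧ |nullLbar (dx ψ) t x| ≤ |G t x|)
    (hG' : ∀ t x, |nullLbar (refl ψ) t x| ≤ |G' t x| ∧ |nullLbar (dx (refl ψ)) t x| ≤ |G' t x|)
    (hS : source η G M T ≤ S) (hS' : source η G' (refl M) T ≤ S) {t : ℝ} (ht : t ∈ Icc 0 T) :
    totalEnergy η ψ t + totalFlux η ψ t ≤ 2 * totalEnergy η ψ 0 + 16 * S := by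
  obtain ⟨R', hR, hRc, hRM⟩ := hbox.top
  have hb : ∀ t ∈ Icc 0 T, ∀ x, |box ψ t x| ≤ M t x := fun t ht x =>
    (hbox.base t ht x).trans (hMM t x)
  have h1 := energy_add_flux_le (η := η) (hψ.of_le (by norm_num)) hM hM.refl
    (transport_nullLbar hψ hb) (transport_refl_nullL hψ hb) ht
  have h2 := energy_add_flux_le (η := η) hψ.dx hM hM.refl
    (transport_nullLbar_dx hψ hR hRc hRM) (transport_refl_nullL_dx hψ hR hRc hRM) ht
  have s1 : source η (nullLbar ψ) M T ≤ S :=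
    (source_mono (fun t _ x => (hG t x).1) (fun _ _ _ => le_rfl) (fun t _ x => hM0 t x)).trans hS
  have s2 : source η (nullLbar (dx ψ)) M T ≤ S :=
    (source_mono (fun t _ x => (hG t x).2) (fun _ _ _ => le_rfl) (fun t _ x => hM0 t x)).trans hS
  have s3 : source η (refl (nullL ψ)) (refl M) T ≤ S :=
    (source_mono (fun t _ x => by rw [refl_nullL]; exact (hG' t x).1) (fun _ _ _ => le_rfl)
      (fun t _ x => hM0 t (-x))).trans hS'
  have s4 : source η (refl (nullL (dx ψ))) (refl M) T ≤ S :=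
    (source_mono (fun t _ x => by
      have := (hG' t x).2
      rwa [nullLbar_dx_refl_eq, abs_neg] at this) (fun _ _ _ => le_rfl)
      (fun t _ x => hM0 t (-x))).trans hS'
  calc totalEnergy η ψ t + totalFlux η ψ t
      = (sliceEnergy η ψ t + nullFlux η ψ t) +
        (sliceEnergy η (dx ψ) t + nullFlux η (dx ψ) t) := by
        unfold totalEnergy totalFlux; ring
    _ ≤ (2 * sliceEnergy η ψ 0 + 4 * (S + S)) + (2 * sliceEnergy η (dx ψ) 0 + 4 * (S + S)) :=
        add_le_add (h1.trans (add_le_add le_rfl (mul_le_mul_right (add_le_add s1 s3) 4)))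
          (h2.trans (add_le_add le_rfl (mul_le_mul_right (add_le_add s2 s4) 4)))
    _ = _ := by unfold totalEnergy; ring

/-- The energy estimate for a perturbation whose nonlinearity has null structure. -/
theorem total_le (hη : 0 < η) (hη' : η < 1) (hk : 0 ≤ k) (hA : 0 ≤ A)
    (hB0 : 0 < ctrl η k A) (hB1 : ctrl η k A ≤ 1)
    (hK : 0 ≤ K) (hz : IsC 2 z) (hs : IsC 2 s) (hT : 0 ≤ T)
    (hbz : PartBound η A T z) (hbs : PartBound η A T s)
    (hbz' : PartBound η A T (refl z)) (hbs' : PartBound η A T (refl s))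
    (hboxz : BoxBound z (nonlin₀ η k K z s) (nonlin η k K z s) T)
    (hboxs : BoxBound s (nonlin₀ η k K z s) (nonlin η k K z s) T) {t : ℝ} (ht : t ∈ Icc 0 T) :
    totalEnergy η z t + totalFlux η z t ≤ 2 * totalEnergy η z 0 + 16 * ENNReal.ofReal
      (K * ((3 * (∫ u, rho η u) + charConst η K) * ctrl η k A ^ 3)) ∧
    totalEnergy η s t + totalFlux η s t ≤ 2 * totalEnergy η s 0 + 16 * ENNReal.ofReal
      (K * ((3 * (∫ u, rho η u) + charConst η K) * ctrl η k A ^ 3)) := by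
  have h := controlled_baseBar hη hη' hk hA hz hs hbz hbs
  have h' : Controlled η (ctrl η k A) T (refl (base η k z s)) (refl (top η k z s)) := by
    simpa [base, top] using controlled_baseBar hη hη' hk hA hz.refl hs.refl hbz' hbs'
  have hb0 : ∀ t x, 0 ≤ base η k z s t x := fun t x => by simpa [refl] using h'.nonneg t (-x)
  have hbt : ∀ t x, base η k z s t x ≤ top η k z s t x := fun t x => by
    simpa [refl] using h'.le t (-x)
  have ht0 : ∀ t x, 0 ≤ topBar η k z s t x := fun t x => (h.nonneg t x).trans (h.le t x)
  have hMM : ∀ t x, nonlin₀ η k K z s t x ≤ nonlin η k K z s t x := fun t x => by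
    refine mul_le_mul_of_nonneg_left ?_ hK
    have h1 := mul_le_mul_of_nonneg_left (hbt t x) (h.nonneg t x)
    have h2 := mul_nonneg (ht0 t x) (hb0 t x)
    linarith
  have hM0 : ∀ t x, 0 ≤ nonlin η k K z s t x := fun t x =>
    (mul_nonneg hK (mul_nonneg (h.nonneg t x) (hb0 t x))).trans (hMM t x)
  have hM : IsC 0 (nonlin η k K z s) := by
    have h1 := h.cont.continuous
    have h2 := h.cont₁.continuous
    have h3 : Continuous fun p : ℝ × ℝ => base η k z s p.1 p.2 := by
      have := h'.cont.refl.continuous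
      simpa using this
    have h4 : Continuous fun p : ℝ × ℝ => top η k z s p.1 p.2 := by
      have := h'.cont₁.refl.continuous
      simpa using this
    refine contDiff_zero.2 ?_
    unfold nonlin
    fun_prop
  have hS := source_nonlin_le hη hη' hk hA hB0 hB1 hK hz hs hT hbz hbs hbz' hbs'
    (transport_nullLbar hz hboxz.base) (transport_nullLbar hs hboxs.base)
  -- The same estimate for the reflected pair controls the sources of the L-derivatives.
  have hS' := source_nonlin_le hη hη' hk hA hB0 hB1 hK hz.refl hs.refl hT hbz' hbs'
    (by simpa using hbz) (by simpa using hbs)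
    (by rw [← refl_nullL, ← refl_nonlin₀]; exact transport_refl_nullL hz hboxz.base)
    (by rw [← refl_nullL, ← refl_nonlin₀]; exact transport_refl_nullL hs hboxs.base)
  rw [← refl_nonlin] at hS'
  exact ⟨total_le_of_source_le hz hM hMM hM0 hboxz (fun t x => (abs_le_topBar hk t x).1)
      (fun t x => (abs_le_topBar hk t x).1) hS hS' ht,
    total_le_of_source_le hs hM hMM hM0 hboxs (fun t x => (abs_le_topBar hk t x).2)
      (fun t x => (abs_le_topBar hk t x).2) hS hS' ht⟩

end Closing

/-! ### Smoothness, positivity and localization of the soliton. -/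

section Soliton

variable {η lam μ ε : ℝ} {θ σ : ℝ → ℝ}

/-- Compact support beats any weight; y/2 matches the halved null coordinates. -/
theorem exists_abs_le_mul_rho_sq {g : ℝ → ℝ} (hg : Continuous g) (hs : HasCompactSupport g) :
    ∃ m, 0 ≤ m ∧ ∀ y, |g y| ≤ m * rho η (y / 2) ^ 2 := by
  have hc : Continuous fun y => g y * weight η (y / 2) := by
    have := continuous_weight (η := η)
    fun_prop
  obtain ⟨C, hC⟩ := hc.bounded_above_of_compact_support hs.mul_right
  refine ⟨C, (norm_nonneg _).trans (hC 0), fun y => ?_⟩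
  have h1 := hC y
  have h2 := rho_sq_mul_weight (η := η) (y / 2)
  rw [Real.norm_eq_abs, abs_mul, abs_of_nonneg (weight_nonneg (η := η) _)] at h1
  calc |g y| = |g y| * weight η (y / 2) * rho η (y / 2) ^ 2 := by
        rw [mul_assoc, mul_comm (weight η _), h2, mul_one]
    _ ≤ C * rho η (y / 2) ^ 2 := mul_le_mul_of_nonneg_right h1 (sq_nonneg _)

theorem hasDerivAt_gam1 (hθ : ContDiff ℝ 2 θ) {p q : ℝ → ℝ} {p' q' r : ℝ}
    (hp : HasDerivAt p p' r) (hq : HasDerivAt q q' r) :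
    HasDerivAt (fun r => gam1 lam ε θ (p r) (q r)) (ε * deriv θ (q r + p r) * (q' + p')) r := by
  have h1 : HasDerivAt θ (deriv θ (q r + p r)) (q r + p r) :=
    (hθ.differentiable (by norm_num) _).hasDerivAt
  have h2 := ((h1.comp r (hq.add hp)).const_mul ε).const_add lam
  exact h2.congr_deriv (by ring)

theorem hasDerivAt_gam2 (hσ : ContDiff ℝ 2 σ) {p q : ℝ → ℝ} {p' q' r : ℝ}
    (hp : HasDerivAt p p' r) (hq : HasDerivAt q q' r) :
    HasDerivAt (fun r => gam2 ε σ (p r) (q r)) (ε * deriv σ (q r - p r) * (q' - p')) r := by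
  have h1 : HasDerivAt σ (deriv σ (q r - p r)) (q r - p r) :=
    (hσ.differentiable (by norm_num) _).hasDerivAt
  have h2 := (h1.comp r (hq.sub hp)).const_mul ε
  exact h2.congr_deriv (by ring)

/-- A function of the two travelling waves `γ₁` and `γ₂`. -/
def seedComp (lam ε : ℝ) (θ σ : ℝ → ℝ) (H : ℝ × ℝ → ℝ) (t x : ℝ) : ℝ :=
  H (gam1 lam ε θ t x, gam2 ε σ t x)

variable {H : ℝ × ℝ → ℝ} {U : Set (ℝ × ℝ)}

theorem isC_seedComp (hθ : ContDiff ℝ 2 θ) (hσ : ContDiff ℝ 2 σ) (hU : IsOpen U)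
    (hH : ContDiffOn ℝ 2 H U) (hmem : ∀ t x, (gam1 lam ε θ t x, gam2 ε σ t x) ∈ U) :
    IsC 2 (seedComp lam ε θ σ H) := by
  have hg : ContDiff ℝ 2 fun p : ℝ × ℝ => (gam1 lam ε θ p.1 p.2, gam2 ε σ p.1 p.2) := by
    unfold gam1 gam2
    exact (contDiff_const.add (contDiff_const.mul (hθ.comp (contDiff_snd.add contDiff_fst)))).prodMk
      (contDiff_const.mul (hσ.comp (contDiff_snd.sub contDiff_fst)))
  refine contDiff_iff_contDiffAt.2 fun p => ?_
  exact (hH.contDiffAt (hU.mem_nhds (hmem p.1 p.2))).comp p hg.contDiffAt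

/-- L annihilates γ₂ and L̲ annihilates γ₁, so each null derivative carries the compactly supported
profile of a single wave. -/
theorem null_seedComp (hθ : ContDiff ℝ 2 θ) (hσ : ContDiff ℝ 2 σ) (hU : IsOpen U)
    (hH : ContDiffOn ℝ 2 H U) (hmem : ∀ t x, (gam1 lam ε θ t x, gam2 ε σ t x) ∈ U) (t x : ℝ) :
    nullL (seedComp lam ε θ σ H) t x = 2 * ε * deriv θ (x + t) *
      fderiv ℝ H (gam1 lam ε θ t x, gam2 ε σ t x) (1, 0) ∧
    nullLbar (seedComp lam ε θ σ H) t x = -(2 * ε * deriv σ (x - t) *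
      fderiv ℝ H (gam1 lam ε θ t x, gam2 ε σ t x) (0, 1)) := by
  have hd : HasFDerivAt H (fderiv ℝ H (gam1 lam ε θ t x, gam2 ε σ t x))
      (gam1 lam ε θ t x, gam2 ε σ t x) :=
    ((hH.contDiffAt (hU.mem_nhds (hmem t x))).differentiableAt (by norm_num)).hasFDerivAt
  have e : ∀ (ℓ : ℝ × ℝ →L[ℝ] ℝ) (a b : ℝ), ℓ (a, b) = a * ℓ (1, 0) + b * ℓ (0, 1) :=
    fun ℓ a b => by
      rw [← smul_eq_mul, ← smul_eq_mul, ← map_smul, ← map_smul, ← map_add]; simp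
  have h1 : dt (seedComp lam ε θ σ H) t x = _ :=
    (hd.comp_hasDerivAt t ((hasDerivAt_gam1 hθ (hasDerivAt_id t) (hasDerivAt_const t x)).prodMk
      (hasDerivAt_gam2 hσ (hasDerivAt_id t) (hasDerivAt_const t x)))).deriv
  have h2 : dx (seedComp lam ε θ σ H) t x = _ :=
    (hd.comp_hasDerivAt x ((hasDerivAt_gam1 hθ (hasDerivAt_const x t) (hasDerivAt_id x)).prodMk
      (hasDerivAt_gam2 hσ (hasDerivAt_const x t) (hasDerivAt_id x)))).deriv
  rw [e] at h1 h2
  simp only [id] at h1 h2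
  rw [nullL, nullLbar, h1, h2]
  constructor <;> ring

theorem hasDerivAt_fderiv_seed (hθ : ContDiff ℝ 2 θ) (hσ : ContDiff ℝ 2 σ) (hU : IsOpen U)
    (hH : ContDiffOn ℝ 2 H U) (hmem : ∀ t x, (gam1 lam ε θ t x, gam2 ε σ t x) ∈ U) (t x : ℝ)
    (v : ℝ × ℝ) :
    HasDerivAt (fun y => fderiv ℝ H (gam1 lam ε θ t y, gam2 ε σ t y) v)
      (fderiv ℝ (fderiv ℝ H) (gam1 lam ε θ t x, gam2 ε σ t x)
        (ε * deriv θ (x + t), ε * deriv σ (x - t)) v) x := by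
  have hd : HasFDerivAt (fderiv ℝ H)
      (fderiv ℝ (fderiv ℝ H) (gam1 lam ε θ t x, gam2 ε σ t x))
      (gam1 lam ε θ t x, gam2 ε σ t x) :=
    (((hH.contDiffAt (hU.mem_nhds (hmem t x))).fderiv_right (m := 1) (by norm_num)).differentiableAt
      (by norm_num)).hasFDerivAt
  have h1 := hd.comp_hasDerivAt x
    ((hasDerivAt_gam1 hθ (hasDerivAt_const x t) (hasDerivAt_id x)).prodMk
      (hasDerivAt_gam2 hσ (hasDerivAt_const x t) (hasDerivAt_id x)))
  have h2 := h1.clm_apply (hasDerivAt_const x v)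
  refine h2.congr_deriv ?_
  rw [map_zero, add_zero]
  simp only [id, add_zero, sub_zero, mul_one]

/-- Travelling wave seeds of size `ε` have null derivatives of size `ε`, localized in the
corresponding null coordinate. -/
theorem nullBound_seedComp (hη : 0 < η) (hθ : ContDiff ℝ 2 θ) (hσ : ContDiff ℝ 2 σ) (hU : IsOpen U)
    (hH : ContDiffOn ℝ 2 H U) (hmem : ∀ t x, (gam1 lam ε θ t x, gam2 ε σ t x) ∈ U)
    {C m : ℝ} (hC0 : 0 ≤ C) (hm : 0 ≤ m) (hε : 0 ≤ ε) (hε1 : ε ≤ 1)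
    (hC : ∀ t x, ‖fderiv ℝ H (gam1 lam ε θ t x, gam2 ε σ t x)‖ ≤ C)
    (hC2 : ∀ t x, ‖fderiv ℝ (fderiv ℝ H) (gam1 lam ε θ t x, gam2 ε σ t x)‖ ≤ C)
    (hθ1 : ∀ y, |deriv θ y| ≤ m * rho η (y / 2) ^ 2)
    (hθ2 : ∀ y, |deriv (deriv θ) y| ≤ m * rho η (y / 2) ^ 2)
    (hσ1 : ∀ y, |deriv σ y| ≤ m * rho η (y / 2) ^ 2)
    (hσ2 : ∀ y, |deriv (deriv σ) y| ≤ m * rho η (y / 2) ^ 2) (t x : ℝ) :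
    NullBound (seedComp lam ε θ σ H) t x
      (ε * (2 * C * m * (m + 1)) * rho η (uCoord t x) ^ 2)
      (ε * (2 * C * m * (m + 1)) * rho η (ubarCoord t x) ^ 2)
      (ε * (2 * C * m * (m + 1)) * rho η (uCoord t x) ^ 2)
      (ε * (2 * C * m * (m + 1)) * rho η (ubarCoord t x) ^ 2) := by
  have hf := isC_seedComp hθ hσ hU hH hmem
  have hr : ∀ y, rho η y ^ 2 ≤ 1 := fun y => by
    nlinarith [rho_pos (η := η) y, rho_le_one hη y]
  have hle : ∀ {g : ℝ → ℝ}, (∀ y, |g y| ≤ m * rho η (y / 2) ^ 2) → ∀ y, |g y| ≤ m := fun hg y =>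
    (hg y).trans (by nlinarith [hr (y / 2)])
  have eu : rho η ((x - t) / 2) = rho η (uCoord t x) := by
    rw [← rho_neg]; congr 1; simp only [uCoord]; ring
  have eub : rho η ((x + t) / 2) = rho η (ubarCoord t x) := by
    congr 1; simp only [ubarCoord]; ring
  have happ : ∀ v : ℝ × ℝ, ‖v‖ ≤ 1 → |fderiv ℝ H (gam1 lam ε θ t x, gam2 ε σ t x) v| ≤ C :=
    fun v hv => (ContinuousLinearMap.le_opNorm _ v).trans
      ((mul_le_mul (hC t x) hv (norm_nonneg _) hC0).trans_eq (mul_one C))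
  have happ2 : ∀ v : ℝ × ℝ, ‖v‖ ≤ 1 → |fderiv ℝ (fderiv ℝ H) (gam1 lam ε θ t x, gam2 ε σ t x)
      (ε * deriv θ (x + t), ε * deriv σ (x - t)) v| ≤ C * m := fun v hv => by
    have hw : ‖((ε * deriv θ (x + t), ε * deriv σ (x - t)) : ℝ × ℝ)‖ ≤ m := by
      refine norm_prod_le_iff.2 ⟨?_, ?_⟩
      · rw [Real.norm_eq_abs, abs_mul, abs_of_nonneg hε]
        have := hle hθ1 (x + t)
        nlinarith [abs_nonneg (deriv θ (x + t))]
      · rw [Real.norm_eq_abs, abs_mul, abs_of_nonneg hε]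
        have := hle hσ1 (x - t)
        nlinarith [abs_nonneg (deriv σ (x - t))]
    have h1 := ContinuousLinearMap.le_opNorm₂
      (fderiv ℝ (fderiv ℝ H) (gam1 lam ε θ t x, gam2 ε σ t x))
      (ε * deriv θ (x + t), ε * deriv σ (x - t)) v
    refine h1.trans ?_
    calc _ ≤ C * m * 1 := by
          have := hC2 t x
          gcongr
      _ = C * m := mul_one _
  have n1 : ‖((1 : ℝ), (0 : ℝ))‖ ≤ 1 := by simp [Prod.norm_def]
  have n2 : ‖((0 : ℝ), (1 : ℝ))‖ ≤ 1 := by simp [Prod.norm_def]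
  have hdd : ∀ {g : ℝ → ℝ}, ContDiff ℝ 2 g → ∀ y, HasDerivAt (deriv g) (deriv (deriv g) y) y :=
    fun {g} hg y => by
      have : ContDiff ℝ 1 (deriv g) := ((contDiff_succ_iff_deriv (n := 1)).1 hg).2.2
      exact (this.differentiable (by norm_num) y).hasDerivAt
  have b1 : ∀ {a c w : ℝ}, |a| ≤ m * w → |c| ≤ C → 0 ≤ w →
      |2 * ε * a * c| ≤ ε * (2 * C * m * (m + 1)) * w := fun {a c w} ha hc hw => by
    rw [abs_mul, abs_mul, abs_mul, abs_two, abs_of_nonneg hε]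
    calc 2 * ε * |a| * |c| ≤ 2 * ε * (m * w) * C := by gcongr
      _ = ε * (2 * C * m * 1) * w := by ring
      _ ≤ ε * (2 * C * m * (m + 1)) * w := by gcongr; linarith
  -- Source of the constant 2Cm(m + 1): ∂ₓ hits either the profile, costing C, or the derivative of
  -- H, costing Cm because the seed gradient has norm at most m when ε ≤ 1.
  have b2 : ∀ {a a' c c' w : ℝ}, |a| ≤ m * w → |a'| ≤ m * w → |c| ≤ C → |c'| ≤ C * m → 0 ≤ w →
      |2 * ε * a' * c + 2 * ε * a * c'| ≤ ε * (2 * C * m * (m + 1)) * w :=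
    fun {a a' c c' w} ha ha' hc hc' hw => by
    refine (abs_add_le _ _).trans ?_
    simp only [abs_mul, abs_two, abs_of_nonneg hε]
    calc 2 * ε * |a'| * |c| + 2 * ε * |a| * |c'|
        ≤ 2 * ε * (m * w) * C + 2 * ε * (m * w) * (C * m) := by gcongr
      _ = _ := by ring
  have hL := fun y => (null_seedComp hθ hσ hU hH hmem t y).1
  have hLb := fun y => (null_seedComp hθ hσ hU hH hmem t y).2
  refine ⟨?_, ?_, ?_, ?_⟩
  · rw [hLb, abs_neg, ← eu]
    exact b1 (hσ1 _) (happ _ n2) (sq_nonneg _)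
  · rw [hL, ← eub]
    exact b1 (hθ1 _) (happ _ n1) (sq_nonneg _)
  · have hs : HasDerivAt (fun y => deriv σ (y - t)) (deriv (deriv σ) (x - t)) x := by
      simpa using (hdd hσ (x - t)).comp_sub_const x t
    have hD := ((hs.const_mul (2 * ε)).mul
      (hasDerivAt_fderiv_seed hθ hσ hU hH hmem t x (0, 1))).neg
    have e : nullLbar (dx (seedComp lam ε θ σ H)) t x = _ :=
      (dx_nullLbar hf t x).symm.trans ((congrArg (fun g => deriv g x) (funext hLb)).trans hD.deriv)
    rw [e, abs_neg, ← eu]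
    exact b2 (hσ1 _) (hσ2 _) (happ _ n2) (happ2 _ n2) (sq_nonneg _)
  · have hs : HasDerivAt (fun y => deriv θ (y + t)) (deriv (deriv θ) (x + t)) x := by
      simpa using (hdd hθ (x + t)).comp_add_const x t
    have hD := (hs.const_mul (2 * ε)).mul
      (hasDerivAt_fderiv_seed hθ hσ hU hH hmem t x (1, 0))
    have e : nullL (dx (seedComp lam ε θ σ H)) t x = _ :=
      (dx_nullL hf t x).symm.trans ((congrArg (fun g => deriv g x) (funext hL)).trans hD.deriv)
    rw [e, ← eub]
    exact b2 (hθ1 _) (hθ2 _) (happ _ n1) (happ2 _ n1) (sq_nonneg _)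

theorem contDiff_tanh {n : WithTop ℕ∞} : ContDiff ℝ n Real.tanh := by
  have e : Real.tanh = fun x => Real.sinh x / Real.cosh x := funext Real.tanh_eq_sinh_div_cosh
  rw [e]
  exact Real.contDiff_sinh.div Real.contDiff_cosh fun x => (Real.cosh_pos x).ne'

/-- The hyperbolic cosine of the field `B`, as a function of `(γ₁, γ₂)`. -/
noncomputable def coshB (μ : ℝ) (p : ℝ × ℝ) : ℝ :=
  |solV μ| * Real.cosh (p.1 + p.2) -
    1 / √(solC μ) * Real.tanh (solBeta μ * p.1 + (solBeta μ)⁻¹ * p.2) * Real.sinh (p.1 + p.2)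

/-- The field `D` as a function of `(γ₁, γ₂)`. -/
noncomputable def seedD (μ : ℝ) (p : ℝ × ℝ) : ℝ :=
  Real.pi / 4 - 1 / 2 * Real.arctan
    (Real.cosh (solBeta μ * p.1 + (solBeta μ)⁻¹ * p.2) * Real.cosh (p.1 + p.2)
      * (Real.tanh (solBeta μ * p.1 + (solBeta μ)⁻¹ * p.2)
        + solV μ * √(solC μ) * Real.tanh (p.1 + p.2)))

theorem solB_eq : solB lam μ ε θ σ = seedComp lam ε θ σ (fun p => Real.arcosh (coshB μ p)) := rfl

theorem solD_eq : solD lam μ ε θ σ = seedComp lam ε θ σ (seedD μ) := rfl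

theorem contDiff_coshB {n : WithTop ℕ∞} : ContDiff ℝ n (coshB μ) := by
  have h1 : ContDiff ℝ n fun p : ℝ × ℝ => p.1 + p.2 := contDiff_fst.add contDiff_snd
  have h2 : ContDiff ℝ n fun p : ℝ × ℝ => solBeta μ * p.1 + (solBeta μ)⁻¹ * p.2 :=
    (contDiff_const.mul contDiff_fst).add (contDiff_const.mul contDiff_snd)
  exact (contDiff_const.mul (Real.contDiff_cosh.comp h1)).sub
    ((contDiff_const.mul (contDiff_tanh.comp h2)).mul (Real.contDiff_sinh.comp h1))

theorem contDiff_seedD {n : WithTop ℕ∞} : ContDiff ℝ n (seedD μ) := by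
  have h1 : ContDiff ℝ n fun p : ℝ × ℝ => p.1 + p.2 := contDiff_fst.add contDiff_snd
  have h2 : ContDiff ℝ n fun p : ℝ × ℝ => solBeta μ * p.1 + (solBeta μ)⁻¹ * p.2 :=
    (contDiff_const.mul contDiff_fst).add (contDiff_const.mul contDiff_snd)
  exact contDiff_const.sub (contDiff_const.mul (Real.contDiff_arctan.comp
    (((Real.contDiff_cosh.comp h2).mul (Real.contDiff_cosh.comp h1)).mul
      ((contDiff_tanh.comp h2).add (contDiff_const.mul (contDiff_tanh.comp h1))))))

/-- With a = |v| and b = 1/√c one has a² - b² = 1, hence a cosh γ - b sinh γ ≥ 1. For γ > 0 the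
inequality tanh ω < 1 makes the value strictly larger, so arcosh is smooth there and B > 0. -/
theorem one_lt_coshB (hμ : 0 < μ) (hμ1 : μ < 1) {p : ℝ × ℝ} (hp : 0 < p.1 + p.2) :
    1 < coshB μ p := by
  have hμ2 : 0 < 1 - μ ^ 2 := by nlinarith
  have ha : |solV μ| = (μ ^ 2 + 1) / (2 * μ) := by
    rw [solV, abs_neg, abs_of_pos (by positivity)]
  have hb : 1 / √(solC μ) = (1 - μ ^ 2) / (2 * μ) := by
    have e : 2 * μ / (μ ^ 2 - 1) = -(2 * μ / (1 - μ ^ 2)) := by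
      rw [← neg_sub (1 : ℝ), div_neg]
    rw [solC, Real.sqrt_sq_eq_abs, e, abs_neg, abs_of_pos (by positivity), one_div_div]
  rw [coshB, ha, hb]
  set a := (μ ^ 2 + 1) / (2 * μ) with hadef
  set b := (1 - μ ^ 2) / (2 * μ) with hbdef
  have hb0 : 0 < b := by positivity
  have hab : b < a := by
    rw [hadef, hbdef]
    gcongr
    nlinarith
  have h1 : a ^ 2 - b ^ 2 = 1 := by
    rw [hadef, hbdef]; field_simp; ring
  have hS : 0 < Real.sinh (p.1 + p.2) := Real.sinh_pos_iff.2 hp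
  have hCS := Real.cosh_sq (p.1 + p.2)
  have hC := Real.cosh_pos (p.1 + p.2)
  have hSC := Real.sinh_lt_cosh (p.1 + p.2)
  have hτ := Real.tanh_lt_one (solBeta μ * p.1 + (solBeta μ)⁻¹ * p.2)
  set S := Real.sinh (p.1 + p.2)
  set C := Real.cosh (p.1 + p.2)
  set τ := Real.tanh (solBeta μ * p.1 + (solBeta μ)⁻¹ * p.2)
  have h2 : 0 < a * C - b * S := by nlinarith [mul_pos hb0 hS]
  have h3 : 1 ≤ a * C - b * S := by
    have h4 : (a * C - b * S) ^ 2 = 1 + (a * S - b * C) ^ 2 := by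
      have : (a * C - b * S) ^ 2 - (a * S - b * C) ^ 2 = (a ^ 2 - b ^ 2) * (C ^ 2 - S ^ 2) := by ring
      rw [h1, hCS] at this
      linarith
    nlinarith [sq_nonneg (a * S - b * C)]
  nlinarith [mul_pos (mul_pos hb0 hS) (sub_pos.2 hτ)]

theorem exists_norm_fderiv_le {E F : Type*} [NormedAddCommGroup E] [NormedSpace ℝ E]
    [NormedAddCommGroup F] [NormedSpace ℝ F] {f : E → F} {U S : Set E} (hU : IsOpen U)
    (hf : ContDiffOn ℝ 1 f U) (hS : IsCompact S) (hSU : S ⊆ U) :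
    ∃ C, ∀ p ∈ S, ‖fderiv ℝ f p‖ ≤ C :=
  hS.exists_bound_of_continuousOn ((hf.continuousOn_fderiv_of_isOpen hU le_rfl).mono hSU)

/-- For small `ε`, the soliton is smooth, `B` takes values in a fixed compact interval of positive
numbers, and the null derivatives of `B` and `D` are small and localized. -/
theorem exists_soliton_bound (hη : 0 < η) (hlam : 0 < lam) (hμ : 0 < μ) (hμ1 : μ < 1)
    (hθ : ContDiff ℝ 2 θ) (hθs : HasCompactSupport θ) (hσ : ContDiff ℝ 2 σ)
    (hσs : HasCompactSupport σ) :
    ∃ ε₀ k b₀ b₁ : ℝ, 0 < ε₀ ∧ 0 ≤ k ∧ 0 < b₀ ∧ ∀ ε, 0 < ε → ε < ε₀ →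
      IsC 2 (solB lam μ ε θ σ) ∧ IsC 2 (solD lam μ ε θ σ) ∧
      (∀ t x, solB lam μ ε θ σ t x ∈ Icc b₀ b₁) ∧
      ∀ t x, NullBound (solB lam μ ε θ σ) t x
          (ε * k * rho η (uCoord t x) ^ 2) (ε * k * rho η (ubarCoord t x) ^ 2)
          (ε * k * rho η (uCoord t x) ^ 2) (ε * k * rho η (ubarCoord t x) ^ 2) ∧
        NullBound (solD lam μ ε θ σ) t x
          (ε * k * rho η (uCoord t x) ^ 2) (ε * k * rho η (ubarCoord t x) ^ 2)
          (ε * k * rho η (uCoord t x) ^ 2) (ε * k * rho η (ubarCoord t x) ^ 2) := by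
  have hd1 : ∀ {g : ℝ → ℝ}, ContDiff ℝ 2 g → ContDiff ℝ 1 (deriv g) := fun hg =>
    ((contDiff_succ_iff_deriv (n := 1)).1 hg).2.2
  obtain ⟨m0, hm0, hθ0⟩ := exists_abs_le_mul_rho_sq (η := η) hθ.continuous hθs
  obtain ⟨m1, hm1, hθ1⟩ := exists_abs_le_mul_rho_sq (η := η) (hd1 hθ).continuous hθs.deriv
  obtain ⟨m2, hm2, hθ2⟩ := exists_abs_le_mul_rho_sq (η := η)
    ((hd1 hθ).continuous_deriv le_rfl) hθs.deriv.deriv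
  obtain ⟨m3, hm3, hσ0⟩ := exists_abs_le_mul_rho_sq (η := η) hσ.continuous hσs
  obtain ⟨m4, hm4, hσ1⟩ := exists_abs_le_mul_rho_sq (η := η) (hd1 hσ).continuous hσs.deriv
  obtain ⟨m5, hm5, hσ2⟩ := exists_abs_le_mul_rho_sq (η := η)
    ((hd1 hσ).continuous_deriv le_rfl) hσs.deriv.deriv
  set m := m0 + m1 + m2 + m3 + m4 + m5 with hm
  have hm' : 0 ≤ m := by positivity
  have up : ∀ {g : ℝ → ℝ} {m' : ℝ}, (∀ y, |g y| ≤ m' * rho η (y / 2) ^ 2) → m' ≤ m →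
      ∀ y, |g y| ≤ m * rho η (y / 2) ^ 2 := fun hg h y =>
    (hg y).trans (mul_le_mul_of_nonneg_right h (sq_nonneg _))
  have hr : ∀ y, rho η y ^ 2 ≤ 1 := fun y => by
    nlinarith [rho_pos (η := η) y, rho_le_one hη y]
  have hθm : ∀ y, |θ y| ≤ m := fun y => (up hθ0 (by linarith) y).trans (by nlinarith [hr (y / 2)])
  have hσm : ∀ y, |σ y| ≤ m := fun y => (up hσ0 (by linarith) y).trans (by nlinarith [hr (y / 2)])
  set U : Set (ℝ × ℝ) := {p | 0 < p.1 + p.2} with hUdef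
  have hU : IsOpen U := isOpen_lt continuous_const (by fun_prop)
  -- A compact set independent of ε that contains all values of (γ₁, γ₂) for small ε; on it γ ≥ λ/4,
  -- so bounds for B, D and their derivatives are uniform.
  set Kc : Set (ℝ × ℝ) := Icc (lam / 2) (3 * lam / 2) ×ˢ Icc (-(lam / 4)) (lam / 4) with hKc
  have hKcpt : IsCompact Kc := isCompact_Icc.prod isCompact_Icc
  have hKU : Kc ⊆ U := fun p hp => by
    have h1 := hp.1.1
    have h2 := hp.2.1
    show 0 < p.1 + p.2
    linarith
  have hHB : ContDiffOn ℝ 2 (fun p => Real.arcosh (coshB μ p)) U :=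
    Real.contDiffOn_arcosh.comp contDiff_coshB.contDiffOn fun p hp => one_lt_coshB hμ hμ1 hp
  have hHD : ContDiffOn ℝ 2 (seedD μ) U := contDiff_seedD.contDiffOn
  have hne : Kc.Nonempty := ⟨(lam, 0), ⟨by constructor <;> linarith, by constructor <;> simp <;> linarith⟩⟩
  have hcB : ContinuousOn (fun p => Real.arcosh (coshB μ p)) Kc := hHB.continuousOn.mono hKU
  obtain ⟨p0, hp0, hmin⟩ := hKcpt.exists_isMinOn hne hcB
  obtain ⟨p1, hp1, hmax⟩ := hKcpt.exists_isMaxOn hne hcB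
  have hbd : ∀ {H : ℝ × ℝ → ℝ}, ContDiffOn ℝ 2 H U → ∃ C, ∀ p ∈ Kc, ‖fderiv ℝ H p‖ ≤ C ∧
      ‖fderiv ℝ (fderiv ℝ H) p‖ ≤ C := fun {H} hH => by
    obtain ⟨C1, hC1⟩ := exists_norm_fderiv_le hU (hH.of_le (by norm_num)) hKcpt hKU
    obtain ⟨C2, hC2⟩ := exists_norm_fderiv_le hU (hH.fderiv_of_isOpen hU (m := 1) (by norm_num))
      hKcpt hKU
    exact ⟨max C1 C2, fun p hp => ⟨(hC1 p hp).trans (le_max_left _ _),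
      (hC2 p hp).trans (le_max_right _ _)⟩⟩
  obtain ⟨CB, hCB⟩ := hbd hHB
  obtain ⟨CD, hCD⟩ := hbd hHD
  set C := max CB CD with hC
  have hC0 : 0 ≤ C := (norm_nonneg _).trans ((hCB p0 hp0).1.trans (le_max_left _ _))
  refine ⟨min 1 (lam / 4 / (m + 1)), 2 * C * m * (m + 1), Real.arcosh (coshB μ p0),
    Real.arcosh (coshB μ p1), by positivity, by positivity,
    Real.arcosh_pos (one_lt_coshB hμ hμ1 (hKU hp0)), fun ε hε hε0 => ?_⟩
  have hε1 : ε ≤ 1 := hε0.le.trans (min_le_left _ _)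
  have hεm : ε * (m + 1) ≤ lam / 4 := by
    have := hε0.le.trans (min_le_right _ _)
    rwa [le_div_iff₀ (by positivity)] at this
  have hsm : ∀ {g : ℝ → ℝ}, (∀ y, |g y| ≤ m) → ∀ y, |ε * g y| ≤ lam / 4 := fun hg y => by
    rw [abs_mul, abs_of_pos hε]
    nlinarith [hg y]
  have hmem : ∀ t x, (gam1 lam ε θ t x, gam2 ε σ t x) ∈ Kc := fun t x => by
    have h1 := abs_le.1 (hsm hθm (x + t))
    have h2 := abs_le.1 (hsm hσm (x - t))
    simp only [hKc, gam1, gam2, mem_prod, mem_Icc]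
    refine ⟨⟨?_, ?_⟩, ?_, ?_⟩ <;> linarith [h1.1, h1.2, h2.1, h2.2]
  have hmemU : ∀ t x, (gam1 lam ε θ t x, gam2 ε σ t x) ∈ U := fun t x => hKU (hmem t x)
  rw [solB_eq, solD_eq]
  refine ⟨isC_seedComp hθ hσ hU hHB hmemU, isC_seedComp hθ hσ hU hHD hmemU,
    fun t x => ⟨hmin (hmem t x), hmax (hmem t x)⟩, fun t x => ⟨?_, ?_⟩⟩
  · exact nullBound_seedComp hη hθ hσ hU hHB hmemU hC0 hm' hε.le hε1
      (fun t x => (hCB _ (hmem t x)).1.trans (le_max_left _ _))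
      (fun t x => (hCB _ (hmem t x)).2.trans (le_max_left _ _))
      (up hθ1 (by linarith)) (up hθ2 (by linarith)) (up hσ1 (by linarith)) (up hσ2 (by linarith)) t x
  · exact nullBound_seedComp hη hθ hσ hU hHD hmemU hC0 hm' hε.le hε1
      (fun t x => (hCD _ (hmem t x)).1.trans (le_max_right _ _))
      (fun t x => (hCD _ (hmem t x)).2.trans (le_max_right _ _))
      (up hθ1 (by linarith)) (up hθ2 (by linarith)) (up hσ1 (by linarith)) (up hσ2 (by linarith)) t x

end Soliton

/-! ### Null structure of the perturbation equations. -/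

section Assembly

variable {η T k : ℝ} {ψ z s f g : ℝ → ℝ → ℝ}

theorem NullBound.mono {t x P Q P₁ Q₁ P' Q' P₁' Q₁' : ℝ} (h : NullBound f t x P Q P₁ Q₁)
    (h1 : P ≤ P') (h2 : Q ≤ Q') (h3 : P₁ ≤ P₁') (h4 : Q₁ ≤ Q₁') :
    NullBound f t x P' Q' P₁' Q₁' :=
  ⟨h.lbar.trans h1, h.l.trans h2, h.lbar_dx.trans h3, h.l_dx.trans h4⟩

theorem dt_add (hf : IsC 1 f) (hg : IsC 1 g) (t x : ℝ) :
    dt (fun t x => f t x + g t x) t x = dt f t x + dt g t x :=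
  ((hf.hasDerivAt_dt t x).add (hg.hasDerivAt_dt t x)).deriv

theorem dx_add (hf : IsC 1 f) (hg : IsC 1 g) (t x : ℝ) :
    dx (fun t x => f t x + g t x) t x = dx f t x + dx g t x :=
  ((hf.hasDerivAt_dx t x).add (hg.hasDerivAt_dx t x)).deriv

theorem nullBound_add {t x P Q P₁ Q₁ : ℝ} (hf : IsC 2 f) (hg : IsC 2 g)
    (h : NullBound f t x P Q P₁ Q₁) :
    NullBound (fun t x => f t x + g t x) t x (P + |nullLbar g t x|) (Q + |nullL g t x|)
      (P₁ + |nullLbar (dx g) t x|) (Q₁ + |nullL (dx g) t x|) := by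
  have hf1 : IsC 1 f := hf.of_le (by norm_num)
  have hg1 : IsC 1 g := hg.of_le (by norm_num)
  have e : dx (fun t x => f t x + g t x) = fun t x => dx f t x + dx g t x := by
    funext t x; exact dx_add hf1 hg1 t x
  have key : ∀ {f g : ℝ → ℝ → ℝ}, IsC 1 f → IsC 1 g →
      nullLbar (fun t x => f t x + g t x) t x = nullLbar f t x + nullLbar g t x ∧
      nullL (fun t x => f t x + g t x) t x = nullL f t x + nullL g t x := fun hf hg => by
    simp only [nullL, nullLbar, dt_add hf hg, dx_add hf hg]
    constructor <;> ring
  refine ⟨?_, ?_, ?_, ?_⟩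
  · rw [(key hf1 hg1).1]
    exact (abs_add_le _ _).trans (add_le_add h.lbar le_rfl)
  · rw [(key hf1 hg1).2]
    exact (abs_add_le _ _).trans (add_le_add h.l le_rfl)
  · rw [e, (key hf.dx hg.dx).1]
    exact (abs_add_le _ _).trans (add_le_add h.lbar_dx le_rfl)
  · rw [e, (key hf.dx hg.dx).2]
    exact (abs_add_le _ _).trans (add_le_add h.l_dx le_rfl)

theorem base_apply (t x : ℝ) : base η k z s t x =
    k * rho η (ubarCoord t x) ^ 2 + |nullL z t x| + |nullL s t x| := by
  change k * rho η (uCoord t (-x)) ^ 2 + |nullLbar (refl z) t (-x)| + |nullLbar (refl s) t (-x)| = _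
  simp only [nullLbar_refl, uCoord_neg, neg_neg]

theorem top_apply (t x : ℝ) : top η k z s t x =
    base η k z s t x + |nullL (dx z) t x| + |nullL (dx s) t x| := by
  change base η k z s t x + |nullLbar (dx (refl z)) t (-x)| + |nullLbar (dx (refl s)) t (-x)| = _
  simp [nullLbar_dx_refl]

/-- A difference of two null forms with coefficients satisfies the bounds of the nonlinearity. -/
theorem boxBound_of_null {c : ℝ → ℝ} {W₁ f₁ g₁ W₂ f₂ g₂ P Q P₁ Q₁ : ℝ → ℝ → ℝ} {l h K : ℝ}
    (hc : ContDiffOn ℝ 1 c (Ioi 0)) (hl : 0 < l)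
    (hK : ∀ y ∈ Icc l h, |c y| ≤ K ∧ |deriv c y| ≤ K)
    (cW₁ : IsC 2 W₁) (cf₁ : IsC 2 f₁) (cg₁ : IsC 2 g₁)
    (cW₂ : IsC 2 W₂) (cf₂ : IsC 2 f₂) (cg₂ : IsC 2 g₂)
    (hW₁ : ∀ t ∈ Icc 0 T, ∀ x, W₁ t x ∈ Icc l h) (hW₂ : ∀ t ∈ Icc 0 T, ∀ x, W₂ t x ∈ Icc l h)
    (bW₁ : ∀ t x, NullBound W₁ t x (P t x) (Q t x) (P₁ t x) (Q₁ t x))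
    (bf₁ : ∀ t x, NullBound f₁ t x (P t x) (Q t x) (P₁ t x) (Q₁ t x))
    (bg₁ : ∀ t x, NullBound g₁ t x (P t x) (Q t x) (P₁ t x) (Q₁ t x))
    (bW₂ : ∀ t x, NullBound W₂ t x (P t x) (Q t x) (P₁ t x) (Q₁ t x))
    (bf₂ : ∀ t x, NullBound f₂ t x (P t x) (Q t x) (P₁ t x) (Q₁ t x))
    (bg₂ : ∀ t x, NullBound g₂ t x (P t x) (Q t x) (P₁ t x) (Q₁ t x))
    (hPQ : ∀ t ∈ Icc 0 T, ∀ x, P t x + Q t x ≤ 2) (hQ : ∀ t x, Q t x ≤ Q₁ t x)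
    (heq : ∀ t ∈ Icc 0 T, ∀ x,
      box ψ t x = c (W₁ t x) * Q0 f₁ g₁ t x - c (W₂ t x) * Q0 f₂ g₂ t x) :
    BoxBound ψ (fun t x => 4 * K * (P t x * Q t x))
      (fun t x => 4 * K * (P t x * Q₁ t x + P₁ t x * Q t x)) T where
  base t ht x := by
    rw [heq t ht x]
    have hK0 := (abs_nonneg _).trans (hK _ (hW₁ t ht x)).1
    have hP0 := (abs_nonneg _).trans (bf₁ t x).lbar
    have hQ0 := (abs_nonneg _).trans (bf₁ t x).l
    have h1 := abs_nullTerm_le (hK _ (hW₁ t ht x)).1 (bf₁ t x) (bg₁ t x)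
    have h2 := abs_nullTerm_le (hK _ (hW₂ t ht x)).1 (bf₂ t x) (bg₂ t x)
    have h3 := mul_nonneg hK0 (mul_nonneg hP0 hQ0)
    refine (abs_sub _ _).trans ?_
    linarith
  top := by
    have hpos₁ : ∀ p ∈ Icc 0 T ×ˢ (univ : Set ℝ), 0 < W₁ p.1 p.2 := fun p hp =>
      hl.trans_le (hW₁ p.1 hp.1 p.2).1
    have hpos₂ : ∀ p ∈ Icc 0 T ×ˢ (univ : Set ℝ), 0 < W₂ p.1 p.2 := fun p hp =>
      hl.trans_le (hW₂ p.1 hp.1 p.2).1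
    refine ⟨fun t x => nullTermDx c W₁ f₁ g₁ t x - nullTermDx c W₂ f₂ g₂ t x,
      fun t ht x => ?_, ?_, fun t ht x => ?_⟩
    · have e : (fun y => box ψ t y) =
          fun y => c (W₁ t y) * Q0 f₁ g₁ t y - c (W₂ t y) * Q0 f₂ g₂ t y := funext (heq t ht)
      rw [e]
      exact (hasDerivAt_nullTerm hc cW₁ cf₁ cg₁ (hpos₁ (t, x) ⟨ht, mem_univ _⟩)).sub
        (hasDerivAt_nullTerm hc cW₂ cf₂ cg₂ (hpos₂ (t, x) ⟨ht, mem_univ _⟩))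
    · exact (continuousOn_nullTermDx hc cW₁ cf₁ cg₁ hpos₁).sub
        (continuousOn_nullTermDx hc cW₂ cf₂ cg₂ hpos₂)
    · have h1 := abs_nullTermDx_le (hK _ (hW₁ t ht x)).1 (hK _ (hW₁ t ht x)).2 (bW₁ t x) (bf₁ t x)
        (bg₁ t x) (hPQ t ht x) (hQ t x)
      have h2 := abs_nullTermDx_le (hK _ (hW₂ t ht x)).1 (hK _ (hW₂ t ht x)).2 (bW₂ t x) (bf₂ t x)
        (bg₂ t x) (hPQ t ht x) (hQ t x)
      refine (abs_sub _ _).trans ?_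
      linarith

theorem contDiffOn_angCoef : ContDiffOn ℝ 2 angCoef (Ioi 0) := by
  have h1 : ContDiff ℝ 2 fun y : ℝ => Real.sinh (2 * y) :=
    Real.contDiff_sinh.comp (contDiff_const.mul contDiff_id)
  exact h1.contDiffOn.div (Real.contDiff_sinh.pow 2).contDiffOn fun y hy =>
    pow_ne_zero 2 (Real.sinh_pos_iff.2 hy).ne'

theorem contDiff_two_mul_sinh : ContDiff ℝ 2 fun y : ℝ => 2 * Real.sinh (2 * y) :=
  contDiff_const.mul (Real.contDiff_sinh.comp (contDiff_const.mul contDiff_id))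

theorem exists_abs_and_deriv_le {c : ℝ → ℝ} (hc : ContDiffOn ℝ 1 c (Ioi 0)) {l : ℝ} (hl : 0 < l)
    (h : ℝ) : ∃ K, ∀ y ∈ Icc l h, |c y| ≤ K ∧ |deriv c y| ≤ K := by
  have hsub : Icc l h ⊆ Ioi 0 := fun y hy => hl.trans_le hy.1
  obtain ⟨K1, h1⟩ := isCompact_Icc.exists_bound_of_continuousOn (hc.continuousOn.mono hsub)
  obtain ⟨K2, h2⟩ := isCompact_Icc.exists_bound_of_continuousOn
    ((hc.continuousOn_deriv_of_isOpen isOpen_Ioi le_rfl).mono hsub)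
  exact ⟨max K1 K2, fun y hy => ⟨(h1 y hy).trans (le_max_left _ _),
    (h2 y hy).trans (le_max_right _ _)⟩⟩

/-- The null structure of the equations for the perturbation of a soliton. -/
theorem boxBound_of_isPerturbation {B D : ℝ → ℝ → ℝ} {A l h K : ℝ} (hη : 0 < η) (hη' : η < 1)
    (hk : 0 ≤ k) (hA : 0 ≤ A) (hB1 : ctrl η k A ≤ 1) (hl : 0 < l)
    (hK : ∀ y ∈ Icc l h, |angCoef y| ≤ K ∧ |deriv angCoef y| ≤ K)
    (hK' : ∀ y ∈ Icc l h, |2 * Real.sinh (2 * y)| ≤ K ∧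
      |deriv (fun y => 2 * Real.sinh (2 * y)) y| ≤ K)
    (hz : IsC 2 z) (hs : IsC 2 s) (cB : IsC 2 B) (cD : IsC 2 D)
    (hbz : PartBound η A T z) (hbs : PartBound η A T s)
    (hbz' : PartBound η A T (refl z)) (hbs' : PartBound η A T (refl s))
    (bB : ∀ t x, NullBound B t x
      (k * rho η (uCoord t x) ^ 2) (k * rho η (ubarCoord t x) ^ 2)
      (k * rho η (uCoord t x) ^ 2) (k * rho η (ubarCoord t x) ^ 2))
    (bD : ∀ t x, NullBound D t x
      (k * rho η (uCoord t x) ^ 2) (k * rho η (ubarCoord t x) ^ 2)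
      (k * rho η (uCoord t x) ^ 2) (k * rho η (ubarCoord t x) ^ 2))
    (hBm : ∀ t ∈ Icc 0 T, ∀ x, B t x ∈ Icc l h)
    (hWm : ∀ t ∈ Icc 0 T, ∀ x, B t x + z t x ∈ Icc l h) (hp : IsPerturbation B D T z s) :
    BoxBound z (nonlin₀ η k (4 * K) z s) (nonlin η k (4 * K) z s) T ∧
      BoxBound s (nonlin₀ η k (4 * K) z s) (nonlin η k (4 * K) z s) T := by
  have hctl := controlled_baseBar hη hη' hk hA hz hs hbz hbs
  have hctl' := controlled_baseBar hη hη' hk hA hz.refl hs.refl hbz' hbs'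
  have hr : ∀ u, rho η u ≤ 1 := rho_le_one hη
  have hr0 : ∀ u, 0 < rho η u := rho_pos
  have hB0 := ctrl_nonneg (η := η) hk hA
  -- Each summand is at most the control constant, which is at most 1.
  have hPQ : ∀ t ∈ Icc 0 T, ∀ x, baseBar η k z s t x + base η k z s t x ≤ 2 := fun t ht x => by
    have h1 := hctl.sup t ht x
    have h2 : base η k z s t x ≤ _ := hctl'.sup t ht (-x)
    nlinarith [hr (uCoord t x), hr (uCoord t (-x)), hr0 (uCoord t x), hr0 (uCoord t (-x))]
  have hQ : ∀ t x, base η k z s t x ≤ top η k z s t x := fun t x => hctl'.le t (-x)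
  have i1 : ∀ t x, k * rho η (uCoord t x) ^ 2 + |nullLbar z t x| + |nullLbar s t x| =
    baseBar η k z s t x := fun _ _ => rfl
  have i2 : ∀ t x, topBar η k z s t x =
    baseBar η k z s t x + |nullLbar (dx z) t x| + |nullLbar (dx s) t x| := fun _ _ => rfl
  have nB : ∀ {f : ℝ → ℝ → ℝ}, (∀ t x, NullBound f t x
      (k * rho η (uCoord t x) ^ 2) (k * rho η (ubarCoord t x) ^ 2)
      (k * rho η (uCoord t x) ^ 2) (k * rho η (ubarCoord t x) ^ 2)) → ∀ t x, NullBound f t x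
      (baseBar η k z s t x) (base η k z s t x) (topBar η k z s t x) (top η k z s t x) :=
    fun hf t x => by
      have h1 := abs_nonneg (nullLbar z t x)
      have h2 := abs_nonneg (nullLbar s t x)
      have h3 := abs_nonneg (nullLbar (dx z) t x)
      have h4 := abs_nonneg (nullLbar (dx s) t x)
      have h5 := abs_nonneg (nullL z t x)
      have h6 := abs_nonneg (nullL s t x)
      have h7 := abs_nonneg (nullL (dx z) t x)
      have h8 := abs_nonneg (nullL (dx s) t x)
      refine (hf t x).mono ?_ ?_ ?_ ?_
      all_goals simp only [top_apply, base_apply, i2, ← i1]; linarith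
  have nW : ∀ t x, NullBound (fun t x => B t x + z t x) t x
      (baseBar η k z s t x) (base η k z s t x) (topBar η k z s t x) (top η k z s t x) :=
    fun t x => by
      have h1 := abs_nonneg (nullLbar z t x)
      have h2 := abs_nonneg (nullLbar s t x)
      have h4 := abs_nonneg (nullLbar (dx s) t x)
      have h5 := abs_nonneg (nullL z t x)
      have h6 := abs_nonneg (nullL s t x)
      have h8 := abs_nonneg (nullL (dx s) t x)
      refine (nullBound_add cB hz (bB t x)).mono ?_ ?_ ?_ ?_
      all_goals simp only [top_apply, base_apply, i2, ← i1]; linarith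
  have nY : ∀ t x, NullBound (fun t x => D t x + s t x) t x
      (baseBar η k z s t x) (base η k z s t x) (topBar η k z s t x) (top η k z s t x) :=
    fun t x => by
      have h1 := abs_nonneg (nullLbar z t x)
      have h2 := abs_nonneg (nullLbar s t x)
      have h3 := abs_nonneg (nullLbar (dx z) t x)
      have h5 := abs_nonneg (nullL z t x)
      have h6 := abs_nonneg (nullL s t x)
      have h7 := abs_nonneg (nullL (dx z) t x)
      refine (nullBound_add cD hs (bD t x)).mono ?_ ?_ ?_ ?_
      all_goals simp only [top_apply, base_apply, i2, ← i1]; linarith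
  have hz1 : IsC 1 z := hz.of_le (by norm_num)
  have hs1 : IsC 1 s := hs.of_le (by norm_num)
  have hB' : IsC 1 B := cB.of_le (by norm_num)
  have hD' : IsC 1 D := cD.of_le (by norm_num)
  constructor
  -- By bilinearity the bracket of null forms is Q₀(D + s, D + s); for s below it is Q₀(D + s, B +
  -- z).
  · refine boxBound_of_null (c := fun y => 2 * Real.sinh (2 * y)) (W₁ := B) (f₁ := D) (g₁ := D)
      (W₂ := fun t x => B t x + z t x) (f₂ := fun t x => D t x + s t x)
      (g₂ := fun t x => D t x + s t x) (contDiff_two_mul_sinh.of_le (by norm_num)).contDiffOn hl hK'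
      cB cD cD (cB.add hz) (cD.add hs) (cD.add hs) hBm hWm (nB bB) (nB bD) (nB bD) nW nY nY
      hPQ hQ fun t ht x => ?_
    rw [(hp t ht x).1]
    simp only [Q0, dt_add hD' hs1, dx_add hD' hs1]
    ring
  · refine boxBound_of_null (c := angCoef) (W₁ := fun t x => B t x + z t x)
      (f₁ := fun t x => D t x + s t x) (g₁ := fun t x => B t x + z t x) (W₂ := B) (f₂ := D)
      (g₂ := B) (contDiffOn_angCoef.of_le (by norm_num)) hl hK
      (cB.add hz) (cD.add hs) (cB.add hz) cB cD cB hWm hBm nW nY nW (nB bB) (nB bD) (nB bB)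
      hPQ hQ fun t ht x => ?_
    rw [(hp t ht x).2]
    simp only [Q0, dt_add hD' hs1, dx_add hD' hs1, dt_add hB' hz1, dx_add hB' hz1]
    ring

theorem supNorm_le {C : ℝ} (h : ∀ t ∈ Icc 0 T, ∀ x, |z t x| ≤ C) :
    supNorm z T ≤ ENNReal.ofReal C := by
  refine iSup₂_le fun t ht => ?_
  rw [eLpNorm_exponent_top]
  exact eLpNormEssSup_le_of_ae_bound (ae_of_all _ fun x => h t ht x)

end Assembly

end PCF

/-! ### Choice of constants and closure of the bootstrap. -/

/-- Bootstrap for perturbations of the nonsingular soliton of the principal chiral field model.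
The functions `z`, `s` are of class `C²` up to the boundary of the strip `[0, T] × ℝ`, written as
restrictions of `C²` functions of the plane; the system is only imposed on the strip. -/
theorem theorem4p1 (η : ℝ) (hη₀ : 0 < η) (hη₁ : η < 1 / 3) :
    (∃ C₀ : ℝ, 0 < C₀ ∧ PCF.IsEnergyConstant η C₀) ∧
    ∀ C₀ : ℝ, 0 < C₀ → PCF.IsEnergyConstant η C₀ →
    ∀ C₁ : ℝ, 0 < C₁ →
    ∀ lam μ : ℝ, 0 < lam → 0 < μ → μ < 1 →
    ∀ θ σ : ℝ → ℝ, ContDiff ℝ 2 θ → HasCompactSupport θ →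
      ContDiff ℝ 2 σ → HasCompactSupport σ →
    ∃ ε₀ : ℝ, 0 < ε₀ ∧ ∃ δ₀ : ℝ, 0 < δ₀ ∧
    ∀ T : ℝ, 0 < T → ∀ δ : ℝ, 0 < δ → δ ≤ δ₀ →
    ∀ ε : ℝ, 0 < ε → ε < ε₀ → ε < δ →
    ∀ z s : ℝ → ℝ → ℝ,
      ContDiff ℝ 2 (fun p : ℝ × ℝ => z p.1 p.2) →
      ContDiff ℝ 2 (fun p : ℝ × ℝ => s p.1 p.2) →
      PCF.IsPerturbation (PCF.solB lam μ ε θ σ) (PCF.solD lam μ ε θ σ) T z s →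
      HasCompactSupport (z 0) →
      PCF.totalEnergy η z 0 + PCF.totalEnergy η s 0 ≤ ENNReal.ofReal (C₁ * δ ^ 2) →
      (∀ t ∈ Set.Icc 0 T, PCF.totalEnergy η z t + PCF.totalFlux η z t ≤
        ENNReal.ofReal (6 * C₁ * C₀ * δ ^ 2)) →
      (∀ t ∈ Set.Icc 0 T, PCF.totalEnergy η s t + PCF.totalFlux η s t ≤
        ENNReal.ofReal (6 * C₁ * C₀ * δ ^ 2)) →
      PCF.supNorm z T ≤ ENNReal.ofReal (lam / 2) →
      (∀ t ∈ Set.Icc 0 T, PCF.totalEnergy η z t + PCF.totalFlux η z t ≤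
        ENNReal.ofReal (11 / 2 * C₁ * C₀ * δ ^ 2)) ∧
      (∀ t ∈ Set.Icc 0 T, PCF.totalEnergy η s t + PCF.totalFlux η s t ≤
        ENNReal.ofReal (11 / 2 * C₁ * C₀ * δ ^ 2)) ∧
      PCF.supNorm z T < ENNReal.ofReal (lam / 2) := by
  have hη' : η < 1 := by linarith
  refine ⟨⟨4, by norm_num, PCF.isEnergyConstant_four⟩, ?_⟩
  intro C₀ hC₀ hEC C₁ hC₁ lam μ hlam hμ hμ1 θ σ hθ hθs hσ hσs
  have hC₀1 : 1 ≤ C₀ := hEC.one_le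
  obtain ⟨ε₀, k, b₀, b₁, hε₀, hk, hb₀, hsol⟩ :=
    PCF.exists_soliton_bound (η := η) hη₀ hlam hμ hμ1 hθ hθs hσ hσs
  obtain ⟨K₁, hK₁⟩ := PCF.exists_abs_and_deriv_le
    (PCF.contDiffOn_angCoef.of_le (by norm_num)) (half_pos hb₀) (b₁ + b₀ / 2)
  obtain ⟨K₂, hK₂⟩ := PCF.exists_abs_and_deriv_le
    (PCF.contDiff_two_mul_sinh.of_le (by norm_num)).contDiffOn (half_pos hb₀) (b₁ + b₀ / 2)
  set K := max (max K₁ K₂) 0 with hKdef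
  have hK0 : 0 ≤ 4 * K := mul_nonneg (by norm_num) (le_max_right _ _)
  have hK1 : K₁ ≤ K := (le_max_left _ _).trans (le_max_left _ _)
  have hK2 : K₂ ≤ K := (le_max_right _ _).trans (le_max_left _ _)
  have hJ := PCF.integral_rho_nonneg (η := η)
  have hn := PCF.charConst_nonneg (η := η) hK0
  set J := ∫ u, PCF.rho η u with hJdef
  -- Chosen so that the bootstrap bound 6C₁C₀δ² is the square of A = aδ.
  set a := √(6 * C₁ * C₀) with ha
  have ha0 : 0 < a := Real.sqrt_pos.2 (by positivity)
  have ha2 : a ^ 2 = 6 * C₁ * C₀ := Real.sq_sqrt (by positivity)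
  set B₀ := PCF.ctrl η k a with hB₀def
  have hB₀ : 0 < B₀ := by
    have : B₀ = 12 * (1 + J) * (k + a) := rfl
    rw [this]; positivity
  set S := 4 * K * ((3 * J + PCF.charConst η (4 * K)) * B₀ ^ 3) with hSdef
  have hS : 0 ≤ S := by positivity
  -- δ ≤ 1/X yields four smallness conditions at once: control constant at most 1, |z| ≤ b₀/2 to
  -- keep B + z away from 0, |z| ≤ λ/4, and cubic error at most 3C₁δ².
  set X := 1 + B₀ + 20 * a * J / (b₀ / 2) + 20 * a * J / (lam / 4) + 16 * S / (3 * C₁) with hX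
  have hX1 : 0 < X := by positivity
  refine ⟨ε₀, hε₀, 1 / X, by positivity, ?_⟩
  intro T hT δ hδ hδ₀ ε hε hεε₀ hεδ z s hz hs hp hz0 hinit hbz hbs _
  replace hz : PCF.IsC 2 z := hz
  replace hs : PCF.IsC 2 s := hs
  have hδX : δ * X ≤ 1 := (le_div_iff₀ hX1).1 hδ₀
  have small : ∀ {y c : ℝ}, 0 < c → y / c ≤ X → δ * y ≤ c := fun {y c} hc h => by
    have h1 : δ * (y / c) ≤ 1 := (mul_le_mul_of_nonneg_left h hδ.le).trans hδX
    rw [← mul_div_assoc, div_le_one hc] at h1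
    exact h1
  have p1 : 0 ≤ 20 * a * J / (b₀ / 2) := by positivity
  have p2 : 0 ≤ 20 * a * J / (lam / 4) := by positivity
  have p3 : 0 ≤ 16 * S / (3 * C₁) := by positivity
  have s1 : δ * B₀ ≤ 1 := small one_pos (by rw [div_one, hX]; linarith)
  have s2 : δ * (20 * a * J) ≤ b₀ / 2 := small (by positivity) (by rw [hX]; linarith)
  have s3 : δ * (20 * a * J) ≤ lam / 4 := small (by positivity) (by rw [hX]; linarith)
  have s4 : δ * (16 * S) ≤ 3 * C₁ := small (by positivity) (by rw [hX]; linarith)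
  have hA0 : 0 ≤ a * δ := by positivity
  have hA2 : 6 * C₁ * C₀ * δ ^ 2 = (a * δ) ^ 2 := by rw [mul_pow, ha2]
  rw [hA2] at hbz hbs
  obtain ⟨pz, pz'⟩ := PCF.partBound_of_total hz hT.le hbz
  obtain ⟨ps, ps'⟩ := PCF.partBound_of_total hs hT.le hbs
  obtain ⟨cB, cD, hBm, hNB⟩ := hsol ε hε hεε₀
  have hεk : 0 ≤ ε * k := by positivity
  -- Here ε < δ enters: the control constant is linear in the soliton and perturbation sizes, so it
  -- is O(δ).
  have hctrl : PCF.ctrl η (ε * k) (a * δ) ≤ δ * B₀ := by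
    have e1 : PCF.ctrl η (ε * k) (a * δ) = 12 * (1 + J) * (ε * k + a * δ) := rfl
    have e2 : δ * B₀ = 12 * (1 + J) * (δ * k + a * δ) := by
      have : B₀ = 12 * (1 + J) * (k + a) := rfl
      rw [this]; ring
    rw [e1, e2]
    gcongr
  have hctrl0 : 0 < PCF.ctrl η (ε * k) (a * δ) := by
    have e1 : PCF.ctrl η (ε * k) (a * δ) = 12 * (1 + J) * (ε * k + a * δ) := rfl
    rw [e1]; positivity
  have hctrl1 := hctrl.trans s1
  have hzsmall : ∀ t ∈ Set.Icc 0 T, ∀ x, |z t x| ≤ δ * (20 * a * J) := fun t ht x => by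
    refine (PCF.abs_le_of_partBound hη₀ hη' hA0 hT.le hz hz0 pz pz' ht x).trans_eq ?_
    rw [← hJdef]; ring
  have hWm : ∀ t ∈ Set.Icc 0 T, ∀ x,
      PCF.solB lam μ ε θ σ t x + z t x ∈ Set.Icc (b₀ / 2) (b₁ + b₀ / 2) := fun t ht x => by
    have h1 := abs_le.1 ((hzsmall t ht x).trans s2)
    have h2 := hBm t x
    constructor <;> linarith [h1.1, h1.2, h2.1, h2.2]
  obtain ⟨hboxz, hboxs⟩ := PCF.boxBound_of_isPerturbation hη₀ hη' hεk hA0 hctrl1 (half_pos hb₀)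
    (fun y hy => ⟨(hK₁ y hy).1.trans hK1, (hK₁ y hy).2.trans hK1⟩)
    (fun y hy => ⟨(hK₂ y hy).1.trans hK2, (hK₂ y hy).2.trans hK2⟩)
    hz hs cB cD pz ps pz' ps' (fun t x => (hNB t x).1) (fun t x => (hNB t x).2)
    (fun t _ x => ⟨by linarith [(hBm t x).1], by linarith [(hBm t x).2]⟩) hWm hp
  have hfin : ∀ E : ENNReal, E ≤ ENNReal.ofReal (C₁ * δ ^ 2) →
      2 * E + 16 * ENNReal.ofReal (4 * K * ((3 * J + PCF.charConst η (4 * K)) *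
        PCF.ctrl η (ε * k) (a * δ) ^ 3)) ≤ ENNReal.ofReal (11 / 2 * C₁ * C₀ * δ ^ 2) := by
    intro E hE
    have h1 : 4 * K * ((3 * J + PCF.charConst η (4 * K)) *
        PCF.ctrl η (ε * k) (a * δ) ^ 3) ≤ S * δ ^ 3 := by
      have h2 : PCF.ctrl η (ε * k) (a * δ) ^ 3 ≤ (δ * B₀) ^ 3 :=
        pow_le_pow_left₀ hctrl0.le hctrl 3
      calc _ ≤ 4 * K * ((3 * J + PCF.charConst η (4 * K)) * (δ * B₀) ^ 3) := by gcongr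
        _ = S * δ ^ 3 := by rw [hSdef]; ring
    calc _ ≤ 2 * ENNReal.ofReal (C₁ * δ ^ 2) + 16 * ENNReal.ofReal (S * δ ^ 3) := by gcongr
      _ = ENNReal.ofReal (2 * (C₁ * δ ^ 2) + 16 * (S * δ ^ 3)) := by
          rw [ENNReal.ofReal_add (by positivity) (by positivity),
            ENNReal.ofReal_mul (p := 2) (by norm_num), ENNReal.ofReal_mul (p := 16) (by norm_num), ENNReal.ofReal_ofNat, ENNReal.ofReal_ofNat]
      _ ≤ _ := by
          refine ENNReal.ofReal_le_ofReal ?_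
          -- The total is 2C₁δ² + 3C₁δ² = 5C₁δ² ≤ 5C₁C₀δ², using C₀ ≥ 1, which lies below the
          -- claimed bound.
          have h3 : δ ^ 2 * (δ * (16 * S)) ≤ δ ^ 2 * (3 * C₁) := by gcongr
          have h4 : C₁ * δ ^ 2 * 1 ≤ C₁ * δ ^ 2 * C₀ := by gcongr
          have h5 : 0 ≤ C₁ * δ ^ 2 * C₀ := by positivity
          linarith
  have htot := fun t (ht : t ∈ Set.Icc 0 T) => PCF.total_le hη₀ hη' hεk hA0 hctrl0 hctrl1 hK0 hz hs
    hT.le pz ps pz' ps' hboxz hboxs ht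
  refine ⟨fun t ht => (htot t ht).1.trans (hfin _ (le_self_add.trans hinit)),
    fun t ht => (htot t ht).2.trans (hfin _ (le_add_self.trans hinit)), ?_⟩
  refine (PCF.supNorm_le fun t ht x => (hzsmall t ht x).trans s3).trans_lt ?_
  exact (ENNReal.ofReal_lt_ofReal_iff (by positivity)).2 (by linarith)
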